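/- Theorem 1. Let $n\ge 1$ and use coordinates $(z,w)\in\mathbb{C}^n\times\mathbb{C}$ on $\mathbb{C}^{n+1}$, with $|z|^2=\sum_{i=1}^n|z_i|^2$. Let $M\subset\mathbb{C}^{n+1}$ be a real analytic submanifold which near the origin is given by $w=|z|^2+E(z,\bar z)$, where $E$ is a complex-valued real analytic function near $0\in\mathbb{C}^n$ with $E=O(|z|^3)$. Let $M_\infty=\{w=|z|^2\}$. Then the following are equivalent. (i) $(M,0)$ and $(M_\infty,0)$ are holomorphically equivalent: there is a biholomorphic map $H$ between open neighbourhoods $U$ and $V$ of $0$ in $\mathbb{C}^{n+1}$ with $H(0)=0$ and $H(M\cap U)=M_\infty\cap V$. (ii) $(M,0)$ can be formally transformed to $(M_\infty,0)$: there are formal power series $F_1,\dots,F_n,G$ in $(z,w)$ with complex coefficients, without constant terms, whose linear part at $0$ is an invertible linear map of $\mathbb{C}^{n+1}$, such that $$G(z,\Phi(z,\bar z))=\sum_{i=1}^n F_i(z,\Phi(z,\bar z))\,\overline{F_i(z,\Phi(z,\bar z))}$$ as formal power series in $(z,\bar z)$, where $\Phi(z,\bar z)$ is the Taylor series at $0$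 of $|z|^2+E$. -/

import Mathlib

open Filter Topology Asymptotics

namespace CRSingular

noncomputable section

/-- The space `ℂⁿ` with coordinates `z = (z₁, …, zₙ)` and `|z|² = ‖z‖ ^ 2`. -/
abbrev ZSpace (n : ℕ) : Type := EuclideanSpace ℂ (Fin n)

/-- The space `ℂⁿ⁺¹ = ℂⁿ × ℂ` with coordinates `(z, w)`. -/
abbrev Ambient (n : ℕ) : Type := ZSpace n × ℂ

/-- The quadric `M_∞ : w = |z|²`. -/
def quadric (n : ℕ) : Set (Ambient n) :=
  {p | p.2 = ((‖p.1‖ ^ 2 : ℝ) : ℂ)}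

/-! ### Holomorphic equivalence of germs -/

/-- The germs at the origin of two subsets of `ℂⁿ⁺¹` are holomorphically equivalent: a
biholomorphic map between open neighbourhoods of the origin, fixing the origin, carries the part
of `M` in its source exactly onto the part of `M'` in its target. -/
def HolomorphicallyEquivalent {n : ℕ} (M M' : Set (Ambient n)) : Prop :=
  ∃ H : OpenPartialHomeomorph (Ambient n) (Ambient n),
    (0 : Ambient n) ∈ H.source ∧ H 0 = 0 ∧
    DifferentiableOn ℂ H H.source ∧ DifferentiableOn ℂ H.symm H.target ∧
    H.IsImage M M'

/-! ### Formal power series -/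

/-- Formal power series in `(z, z̄)`: the variable `Sum.inl i` is `zᵢ`, and `Sum.inr i` is the
conjugate variable `z̄ᵢ`. -/
abbrev RealSeries (n : ℕ) : Type := MvPowerSeries (Fin n ⊕ Fin n) ℂ

/-- Formal power series in `(z, w)`: the variable `Sum.inl i` is `zᵢ`, and `Sum.inr ()` is `w`. -/
abbrev HolSeries (n : ℕ) : Type := MvPowerSeries (Fin n ⊕ Unit) ℂ

/-- The formal complex conjugate of a series in `(z, z̄)`: the coefficients are conjugated and the
variables `zᵢ` and `z̄ᵢ` are exchanged. -/
def conjSeries {n : ℕ} (φ : RealSeries n) : RealSeries n :=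
  fun d => starRingEnd ℂ (MvPowerSeries.coeff (Finsupp.mapDomain Sum.swap d) φ)

/-- The value of the monomial with exponent `d` in the variables `(z, z̄)` at a point `z`. -/
def monomialValue {n : ℕ} (d : Fin n ⊕ Fin n →₀ ℕ) (z : ZSpace n) : ℂ :=
  (∏ i, z i ^ d (Sum.inl i)) * ∏ i, (starRingEnd ℂ (z i)) ^ d (Sum.inr i)

/-- `φ` is the (convergent) power series expansion in `(z, z̄)` of the function `Φ` at `0`. -/
def HasExpansion {n : ℕ} (Φ : ZSpace n → ℂ) (φ : RealSeries n) : Prop :=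
  ∀ᶠ z in 𝓝 (0 : ZSpace n),
    HasSum (fun d : Fin n ⊕ Fin n →₀ ℕ => MvPowerSeries.coeff d φ * monomialValue d z) (Φ z)

/-- Near the origin, the set `M` is the real analytic graph `w = φ(z, z̄)` and contains `0`. -/
def IsGraphOf {n : ℕ} (M : Set (Ambient n)) (φ : RealSeries n) : Prop :=
  MvPowerSeries.constantCoeff φ = 0 ∧
  ∃ Φ : ZSpace n → ℂ, HasExpansion Φ φ ∧
    ∀ᶠ p in 𝓝 (0 : Ambient n), p ∈ M ↔ p.2 = Φ p.1

/-! ### Formal equivalence -/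

/-- A formal transformation `(z', w') = H(z, w)` of `(ℂⁿ⁺¹, 0)`, given by its components, is a
formal equivalence if it has no constant term and its linear part is invertible. -/
def IsFormalTransformation {n : ℕ} (H : Fin n ⊕ Unit → HolSeries n) : Prop :=
  (∀ i, MvPowerSeries.constantCoeff (H i) = 0) ∧
  IsUnit (Matrix.of fun i j : Fin n ⊕ Unit =>
    MvPowerSeries.coeff (Finsupp.single j 1) (H i)).det

/-- The series `f(z, φ(z, z̄))` in `(z, z̄)` obtained from `f(z, w)` by substituting
`w = φ(z, z̄)`. -/
def restrictToGraph {n : ℕ} (φ : RealSeries n) (f : HolSeries n) : RealSeries n :=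
  MvPowerSeries.subst
    (Sum.elim (fun i => (MvPowerSeries.X (Sum.inl i) : RealSeries n)) (fun _ => φ)) f

/-- The formal map `H = (F, G)` sends the formal submanifold `w = φ(z, z̄)` to the formal
submanifold `w' = ψ(z', z̄')`: substituting `w = φ(z, z̄)`, the identity
`G = ψ(F, F̄)` holds between formal power series in `(z, z̄)`. -/
def MapsGraph {n : ℕ} (H : Fin n ⊕ Unit → HolSeries n) (φ ψ : RealSeries n) : Prop :=
  restrictToGraph φ (H (Sum.inr ())) =
    MvPowerSeries.subst
      (Sum.elim (fun i => restrictToGraph φ (H (Sum.inl i)))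
        (fun i => conjSeries (restrictToGraph φ (H (Sum.inl i))))) ψ

/-- The germs at the origin of two real analytic graphs `M : w = φ(z, z̄)` and
`M' : w = ψ(z, z̄)` are formally equivalent: some formal transformation of `(ℂⁿ⁺¹, 0)` sends `M`
to `M'`. -/
def FormallyEquivalent {n : ℕ} (M M' : Set (Ambient n)) : Prop :=
  ∃ φ ψ : RealSeries n, IsGraphOf M φ ∧ IsGraphOf M' ψ ∧
    ∃ H : Fin n ⊕ Unit → HolSeries n, IsFormalTransformation H ∧ MapsGraph H φ ψ

end

end CRSingular

/-! A biholomorphism gives a formal map by Taylor expansion. Jets in `(z, z̄)` are unique and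
compatible with products, substitution and conjugation, so an identity of functions near the origin
passes to the series.

The converse is the substance. The given formal map may diverge, because the quadric has a very
large group of formal automorphisms. The remedy is to find another map, fixed by a normalisation,
and to prove that this one converges. One looks for maps `id + (p, q)` in the opposite direction,
from the quadric to the graph `w = |z|² + ε(z, z̄)`. The equation becomes `linPart p q = nonlin ε
p`: the left side is `q - ⟨p, z⟩ - ⟨z, p⟩` on the quadric, and the right side consists of `⟨p, p⟩`
and `ε` evaluated at the perturbed point. The kernel of the left side is removed by three conditions
along the axis `z = 0`: `p(0, w) = 0`, the matrix `∂p/∂z (0, w)` is Hermitian in its Taylor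
coefficients, and `q(0, w)` has coefficients with zero real part.

The key point is that the normalised linear equation is solved without small divisors. On the slice
`z̄ₗ = 0`, `l ≠ i`, of the complexified quadric, `w` becomes the single monomial `zᵢ z̄ᵢ`, so the
coefficients of a series in `(z, w)` reappear unchanged (`coeff_sliceExp_onQuadric`). Each
coefficient of `q` is then bounded by two coefficients of the right side, and each coefficient of
`p` by one of `q` and one of the right side (`norm_coeff_right_le`, `norm_coeff_left_le`). Since the
right side up to weight `N + 2` depends only on `p` up to weight `N`, these bounds give both
uniqueness (`IsNormalSolution.unique`) and, through weighted `ℓ¹` norms on a small polydisc,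
convergence (`exists_summable_of_isNormalSolution`).

Normalised solutions are produced only to finite order. A truncation of the formal map is inverted
as an analytic map (`exists_isApproxMap_of_mapsGraph`), then composed with convergent automorphisms
of the quadric: a linear one, Möbius maps killing `p(0, w)`, unitary rotations making the derivative
self-adjoint, and real dilations fixing the real part of the last component (`exists_isNormalMap`).
By uniqueness the finite-order solutions fit together into one formal solution.

The sum `h` of this solution satisfies the equation to infinite order at `0`. Restriction to discs
`ζ ↦ (ζ z, ζ² |z|²)` and the identity theorem make it exact, and transversality in `w` shows that no
point near `0` off the quadric is sent to the graph. The inverse of `h` is the required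
biholomorphism. -/

namespace CRSingular

open MvPowerSeries (truncTotal coeff constantCoeff)

/-! ### Jets of functions along a coordinate system -/

section Jets

variable {E E' σ τ : Type*} [NormedAddCommGroup E] [NormedAddCommGroup E'] [Fintype σ]

/-- The function `f` has the Taylor expansion `φ` in the coordinates `u` up to an error of order
`N` at the origin. -/
def HasJet (u : E → σ → ℂ) (N : ℕ) (f : E → ℂ) (φ : MvPowerSeries σ ℂ) : Prop :=
  (fun x => f x - MvPolynomial.eval (u x) (truncTotal N φ)) =O[𝓝 0] fun x => ‖x‖ ^ N

/-- Coordinates on a neighbourhood of the origin which vanish there to first order. -/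
def IsCoord (u : E → σ → ℂ) : Prop := ∀ s, (fun x => u x s) =O[𝓝 0] fun x => ‖x‖

theorem isBigO_norm_pow_le {m N : ℕ} (h : N ≤ m) :
    (fun x : E => ‖x‖ ^ m) =O[𝓝 0] fun x => ‖x‖ ^ N := by
  refine IsBigO.of_bound 1 ?_
  filter_upwards [Metric.ball_mem_nhds (0 : E) one_pos] with x hx
  rw [mem_ball_zero_iff] at hx
  rw [norm_pow, norm_norm, norm_pow, norm_norm, one_mul]
  exact pow_le_pow_of_le_one (norm_nonneg _) hx.le h

theorem isBigO_monomial {u : E → σ → ℂ} (hu : IsCoord u) (d : σ →₀ ℕ) :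
    (fun x => ∏ i, u x i ^ d i) =O[𝓝 0] fun x => ‖x‖ ^ d.degree := by
  have h : (fun x => ∏ i, u x i ^ d i) =O[𝓝 0] fun x : E => ∏ i, ‖x‖ ^ d i :=
    IsBigO.finsetProd fun i _ => (hu i).pow (d i)
  refine h.congr_right fun x => ?_
  rw [Finset.prod_pow_eq_pow_sum, Finsupp.degree_eq_sum]

theorem isBigO_eval {u : E → σ → ℂ} (hu : IsCoord u) {p : MvPolynomial σ ℂ} {N : ℕ}
    (hp : ∀ d : σ →₀ ℕ, d.degree < N → p.coeff d = 0) :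
    (fun x => MvPolynomial.eval (u x) p) =O[𝓝 0] fun x => ‖x‖ ^ N := by
  simp_rw [MvPolynomial.eval_eq']
  refine IsBigO.fun_sum fun d hd => ?_
  have hN : N ≤ d.degree := by
    by_contra h
    exact (MvPolynomial.mem_support_iff.1 hd) (hp d (not_le.1 h))
  exact ((isBigO_monomial hu d).trans (isBigO_norm_pow_le hN)).const_mul_left _

/-- Monomials of degree at least `N` are `O(‖x‖ ^ N)`, so the canonical truncation may be replaced
by any polynomial with the same low-order coefficients. -/
theorem hasJet_iff {u : E → σ → ℂ} (hu : IsCoord u) {N : ℕ} {f : E → ℂ} {φ : MvPowerSeries σ ℂ}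
    {p : MvPolynomial σ ℂ} (hp : ∀ d : σ →₀ ℕ, d.degree < N → p.coeff d = coeff d φ) :
    HasJet u N f φ ↔
      (fun x => f x - MvPolynomial.eval (u x) p) =O[𝓝 0] fun x => ‖x‖ ^ N := by
  have h : (fun x => MvPolynomial.eval (u x) (truncTotal N φ - p)) =O[𝓝 0] fun x => ‖x‖ ^ N := by
    refine isBigO_eval hu fun d hd => ?_
    rw [MvPolynomial.coeff_sub, MvPowerSeries.coeff_truncTotal _ hd, hp d hd, sub_self]
  constructor
  · intro hf
    refine (hf.add h).congr_left fun x => ?_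
    rw [map_sub]; ring
  · intro hf
    refine (hf.sub h).congr_left fun x => ?_
    rw [map_sub]; ring

theorem HasJet.congr_series {u : E → σ → ℂ} {N : ℕ} {f : E → ℂ} {φ ψ : MvPowerSeries σ ℂ}
    (hf : HasJet u N f φ) (h : ∀ d : σ →₀ ℕ, d.degree < N → coeff d φ = coeff d ψ) :
    HasJet u N f ψ := by
  have : truncTotal N φ = truncTotal N ψ := by
    ext d
    rw [MvPowerSeries.coeff_truncTotal_eq_ite, MvPowerSeries.coeff_truncTotal_eq_ite]
    split_ifs with hd
    · exact h d hd
    · rfl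
  unfold HasJet at *
  rwa [this] at hf

theorem HasJet.congr_fun {u : E → σ → ℂ} {N : ℕ} {f g : E → ℂ} {φ : MvPowerSeries σ ℂ}
    (hf : HasJet u N f φ) (h : (fun x => f x - g x) =O[𝓝 0] fun x => ‖x‖ ^ N) :
    HasJet u N g φ :=
  (IsBigO.sub hf h).congr_left fun x => by ring

theorem HasJet.congr_eventually {u : E → σ → ℂ} {N : ℕ} {f g : E → ℂ} {φ : MvPowerSeries σ ℂ}
    (hf : HasJet u N f φ) (h : f =ᶠ[𝓝 0] g) : HasJet u N g φ :=
  hf.congr_fun (EventuallyEq.trans_isBigO (by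
    filter_upwards [h] with x hx
    rw [hx, sub_self]) (isBigO_zero _ _))

theorem hasJet_eval {u : E → σ → ℂ} (hu : IsCoord u) (N : ℕ) (p : MvPolynomial σ ℂ) :
    HasJet u N (fun x => MvPolynomial.eval (u x) p) (p : MvPowerSeries σ ℂ) := by
  rw [hasJet_iff hu (p := p) fun d _ => (MvPolynomial.coeff_coe p d).symm]
  simpa using isBigO_zero _ _

theorem hasJet_coord {u : E → σ → ℂ} (hu : IsCoord u) (N : ℕ) (s : σ) :
    HasJet u N (fun x => u x s) (MvPowerSeries.X s) := by
  simpa using hasJet_eval hu N (MvPolynomial.X s)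

theorem hasJet_const {u : E → σ → ℂ} (hu : IsCoord u) (N : ℕ) (c : ℂ) :
    HasJet u N (fun _ => c) (MvPowerSeries.C c) := by
  simpa using hasJet_eval hu N (MvPolynomial.C c)

theorem hasJet_zero_iff {u : E → σ → ℂ} {N : ℕ} {f : E → ℂ} :
    HasJet u N f 0 ↔ f =O[𝓝 0] fun x => ‖x‖ ^ N := by
  simp [HasJet]

theorem HasJet.mono {u : E → σ → ℂ} (hu : IsCoord u) {N M : ℕ} {f : E → ℂ}
    {φ : MvPowerSeries σ ℂ} (hf : HasJet u N f φ) (h : M ≤ N) : HasJet u M f φ := by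
  rw [hasJet_iff hu (p := truncTotal N φ)
    fun d hd => MvPowerSeries.coeff_truncTotal _ (hd.trans_le h)]
  exact IsBigO.trans hf (isBigO_norm_pow_le h)

theorem HasJet.isBigO {u : E → σ → ℂ} (hu : IsCoord u) {N M : ℕ} {f : E → ℂ}
    {φ : MvPowerSeries σ ℂ} (hf : HasJet u N f φ) (h : M ≤ N)
    (hφ : ∀ d : σ →₀ ℕ, d.degree < M → coeff d φ = 0) :
    f =O[𝓝 0] fun x => ‖x‖ ^ M :=
  hasJet_zero_iff.1 ((hf.mono hu h).congr_series (ψ := 0) fun d hd => by rw [hφ d hd]; simp)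

theorem HasJet.isBigO_one {u : E → σ → ℂ} (hu : IsCoord u) {N : ℕ} {f : E → ℂ}
    {φ : MvPowerSeries σ ℂ} (hf : HasJet u N f φ) : f =O[𝓝 0] fun _ => (1 : ℝ) := by
  simpa using hf.isBigO hu (Nat.zero_le N) (by simp)

theorem HasJet.add {u : E → σ → ℂ} {N : ℕ} {f g : E → ℂ} {φ ψ : MvPowerSeries σ ℂ}
    (hf : HasJet u N f φ) (hg : HasJet u N g ψ) : HasJet u N (fun x => f x + g x) (φ + ψ) :=
  (IsBigO.add hf hg).congr_left fun x => by rw [map_add, map_add]; ring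

theorem HasJet.sub {u : E → σ → ℂ} {N : ℕ} {f g : E → ℂ} {φ ψ : MvPowerSeries σ ℂ}
    (hf : HasJet u N f φ) (hg : HasJet u N g ψ) : HasJet u N (fun x => f x - g x) (φ - ψ) :=
  (IsBigO.sub hf hg).congr_left fun x => by rw [map_sub, map_sub]; ring

theorem HasJet.sum {u : E → σ → ℂ} {N : ℕ} {ι : Type*} {s : Finset ι} {f : ι → E → ℂ}
    {φ : ι → MvPowerSeries σ ℂ} (h : ∀ i ∈ s, HasJet u N (f i) (φ i)) :
    HasJet u N (fun x => ∑ i ∈ s, f i x) (∑ i ∈ s, φ i) := by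
  refine (IsBigO.sum h).congr_left fun x => ?_
  rw [map_sum, map_sum, Finset.sum_apply, Finset.sum_sub_distrib]

theorem HasJet.mul {u : E → σ → ℂ} (hu : IsCoord u) {N : ℕ} {f g : E → ℂ}
    {φ ψ : MvPowerSeries σ ℂ} (hf : HasJet u N f φ) (hg : HasJet u N g ψ) :
    HasJet u N (fun x => f x * g x) (φ * ψ) := by
  rw [hasJet_iff hu (p := truncTotal N φ * truncTotal N ψ)
    fun d hd => MvPowerSeries.coeff_truncTotal_mul_truncTotal_eq_coeff_mul _ _ hd]
  have hg1 : (fun x => MvPolynomial.eval (u x) (truncTotal N ψ)) =O[𝓝 0] fun _ => (1 : ℝ) := by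
    simpa using isBigO_eval hu (N := 0) (p := truncTotal N ψ) (by simp)
  have h1 := (hf.isBigO_one hu).mul hg
  have h2 := IsBigO.mul hf hg1
  simp only [one_mul, mul_one] at h1 h2
  exact (h1.add h2).congr_left fun x => by rw [map_mul]; ring

theorem HasJet.aeval {u : E → σ → ℂ} (hu : IsCoord u) {N : ℕ} {v : E → τ → ℂ}
    {a : τ → MvPowerSeries σ ℂ} (hv : ∀ s, HasJet u N (fun x => v x s) (a s))
    (p : MvPolynomial τ ℂ) :
    HasJet u N (fun x => MvPolynomial.eval (v x) p) (MvPolynomial.aeval a p) := by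
  induction p using MvPolynomial.induction_on with
  | C c =>
    rw [MvPolynomial.aeval_C, ← MvPowerSeries.c_eq_algebraMap]
    simpa using hasJet_const hu N c
  | add p q hp hq => simpa using hp.add hq
  | mul_X p s hp => simpa using hp.mul hu (hv s)

/-- As the substituted series have no constant term, the coefficients of degree below `N` of a
substitution depend only on the truncation of the outer series at `N`. This reduces the claim to
polynomials. -/
theorem HasJet.comp [Fintype τ] {u : E → σ → ℂ} (hu : IsCoord u) {N : ℕ} {w : E' → τ → ℂ}
    {a : τ → MvPowerSeries σ ℂ} {h : E → E'} (h0 : Tendsto h (𝓝 0) (𝓝 0))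
    (hO : h =O[𝓝 0] fun x => ‖x‖)
    (hv : ∀ s, HasJet u N (fun x => w (h x) s) (a s)) (ha : ∀ s, constantCoeff (a s) = 0)
    {f : E' → ℂ} {φ : MvPowerSeries τ ℂ} (hf : HasJet w N f φ) :
    HasJet u N (fun x => f (h x)) (MvPowerSeries.subst a φ) := by
  have h1 : (fun x => f (h x) - MvPolynomial.eval (w (h x)) (truncTotal N φ)) =O[𝓝 0]
      fun x => ‖x‖ ^ N :=
    (IsBigO.comp_tendsto hf h0).trans (hO.norm_left.pow N)
  have h2 := (HasJet.aeval hu hv (truncTotal N φ)).congr_series (ψ := MvPowerSeries.subst a φ) (by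
    intro d hd
    rw [← MvPowerSeries.coeff_truncTotal _ hd,
      ← MvPowerSeries.coeff_truncTotal (MvPowerSeries.subst a φ) hd,
      MvPowerSeries.truncTotal_subst_eq_truncTotal_truncTotal_subst ha, MvPowerSeries.subst_coe])
  exact h2.congr_fun (h1.neg_left.congr_left fun x => by ring)

/-- The coordinates `u` separate jets: a polynomial of degree less than `N` in the coordinates
which is of order `N` at the origin vanishes. -/
def SeparatesJets (u : E → σ → ℂ) : Prop :=
  ∀ (N : ℕ) (φ : MvPowerSeries σ ℂ), HasJet u N (fun _ => 0) φ →
    ∀ d : σ →₀ ℕ, d.degree < N → coeff d φ = 0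

theorem HasJet.unique {u : E → σ → ℂ} (hs : SeparatesJets u) {N : ℕ} {f : E → ℂ}
    {φ ψ : MvPowerSeries σ ℂ} (hf : HasJet u N f φ) (hg : HasJet u N f ψ) :
    ∀ d : σ →₀ ℕ, d.degree < N → coeff d φ = coeff d ψ := by
  intro d hd
  have h := hf.sub hg
  simp only [sub_self] at h
  have := hs N _ h d hd
  rwa [map_sub, sub_eq_zero] at this

theorem HasJet.unique_of_forall {u : E → σ → ℂ} (hs : SeparatesJets u) {f : E → ℂ}
    {φ ψ : MvPowerSeries σ ℂ} (hf : ∀ N, HasJet u N f φ) (hg : ∀ N, HasJet u N f ψ) : φ = ψ := by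
  ext d
  exact (hf _).unique hs (hg _) d (Nat.lt_succ_self d.degree)

/-- Compatible jets of all orders come from one formal power series. -/
theorem exists_series_of_forall_jet {u : E → σ → ℂ} (hu : IsCoord u) (hs : SeparatesJets u)
    {f : E → ℂ} (h : ∀ N, ∃ φ, HasJet u N f φ) : ∃ φ, ∀ N, HasJet u N f φ := by
  choose φ hφ using h
  refine ⟨fun d => coeff d (φ (d.degree + 1)), fun N => (hφ N).congr_series fun d hd => ?_⟩
  exact ((hφ N).mono hu hd).unique hs (hφ (d.degree + 1)) d (Nat.lt_succ_self _)

theorem HasJet.map_isometry {u : E → σ → ℂ} {N : ℕ} {f : E → ℂ} {φ ψ : MvPowerSeries σ ℂ}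
    (hf : HasJet u N f φ)
    (h : ∀ x, MvPolynomial.eval (u x) (truncTotal N ψ) =
      starRingEnd ℂ (MvPolynomial.eval (u x) (truncTotal N φ))) :
    HasJet u N (fun x => starRingEnd ℂ (f x)) ψ := by
  refine IsBigO.trans (IsBigO.of_bound 1 (Eventually.of_forall fun x => ?_)) hf
  rw [h, ← map_sub, RCLike.norm_conj, one_mul]

end Jets

/-! ### Coordinates in which jets are unique. -/

section Separation

variable {E σ : Type*} [NormedAddCommGroup E] [NormedSpace ℝ E] [Fintype σ]

/-- Along the ray through `x` the truncation is a polynomial in `t` of degree less than `N` whose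
coefficients are its homogeneous components at `x`. Being `O(t ^ N)`, it vanishes identically. -/
theorem separatesJets_of_homogeneous {u : E → σ → ℂ}
    (hhom : ∀ (t : ℝ) x s, u (t • x) s = t * u x s)
    (hinj : ∀ p : MvPolynomial σ ℂ, (∀ x, MvPolynomial.eval (u x) p = 0) → p = 0) :
    SeparatesJets u := by
  intro N φ hφ
  set p := truncTotal N φ with hp
  have key : ∀ k < N, MvPolynomial.homogeneousComponent k p = 0 := by
    intro k hk
    refine hinj _ fun x => ?_
    -- one variable polynomial along the ray through `x`
    set P : Polynomial ℂ := ∑ j ∈ Finset.range N,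
      Polynomial.C (MvPolynomial.eval (u x) (MvPolynomial.homogeneousComponent j p)) *
        Polynomial.X ^ j with hP
    have hPe : ∀ t : ℝ, MvPolynomial.eval (u (t • x)) p = P.eval (t : ℂ) := by
      intro t
      have h1 : p = ∑ j ∈ Finset.range N, MvPolynomial.homogeneousComponent j p := by
        ext d
        rw [MvPolynomial.coeff_sum]
        simp only [MvPolynomial.coeff_homogeneousComponent, Finset.sum_ite_eq, Finset.mem_range]
        split_ifs with h
        · rfl
        · rw [hp, MvPowerSeries.coeff_truncTotal_eq_zero _ (not_lt.1 h)]
      conv_lhs => rw [h1]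
      rw [map_sum, hP, Polynomial.eval_finsetSum]
      refine Finset.sum_congr rfl fun j _ => ?_
      have h2 : u (t • x) = fun s => (t : ℂ) * u x s := funext fun s => hhom t x s
      rw [h2]
      have h3 := MvPolynomial.homogeneousComponent_isHomogeneous j p
      rw [Polynomial.eval_mul, Polynomial.eval_C, Polynomial.eval_pow, Polynomial.eval_X,
        MvPolynomial.eval_eq', MvPolynomial.eval_eq', Finset.sum_mul]
      refine Finset.sum_congr rfl fun d hd => ?_
      have h4 : d.degree = j := by
        have := h3 (MvPolynomial.mem_support_iff.1 hd)
        rw [← this, Finsupp.degree_eq_weight_one]; rfl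
      simp only [mul_pow, Finset.prod_mul_distrib, Finset.prod_pow_eq_pow_sum]
      rw [← Finsupp.degree_eq_sum, h4]; ring
    have hO : (fun t : ℝ => P.eval (t : ℂ)) =O[𝓝 0] fun t => t ^ N := by
      have ht : Tendsto (fun t : ℝ => t • x) (𝓝 0) (𝓝 0) := by
        have : Continuous fun t : ℝ => t • x := by fun_prop
        simpa using this.tendsto 0
      have h := IsBigO.comp_tendsto hφ ht
      have h' : ((fun x : E => ‖x‖ ^ N) ∘ fun t : ℝ => t • x) =O[𝓝 0] fun t : ℝ => t ^ N := by
        refine IsBigO.of_bound (‖x‖ ^ N) (Eventually.of_forall fun t => ?_)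
        simp [norm_smul, mul_pow, mul_comm]
      refine (h.trans h').neg_left.congr_left fun t => ?_
      simp [← hPe, hp]
    -- Once `X ^ k` divides `P`, the next coefficient is the value at `0` of the quotient, which
    -- tends to zero by the `O(t ^ N)` bound with `k < N`.
    have hcoef : ∀ k < N, P.coeff k = 0 := by
      intro k
      induction k using Nat.strong_induction_on with
      | _ k ih =>
        intro hk
        obtain ⟨Q, hQ⟩ : (Polynomial.X : Polynomial ℂ) ^ k ∣ P :=
          Polynomial.X_pow_dvd_iff.2 fun d hd => ih d hd (hd.trans hk)
        have hQ0 : P.coeff k = Q.eval 0 := by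
          rw [hQ, ← Polynomial.coeff_zero_eq_eval_zero]
          simpa using Polynomial.coeff_X_pow_mul Q k 0
        rw [hQ0]
        have hlim : Tendsto (fun t : ℝ => Q.eval (t : ℂ)) (𝓝[≠] 0) (𝓝 (Q.eval 0)) := by
          have : Continuous fun t : ℝ => Q.eval (t : ℂ) := by fun_prop
          simpa using (this.tendsto 0).mono_left nhdsWithin_le_nhds
        have hlim' : Tendsto (fun t : ℝ => Q.eval (t : ℂ)) (𝓝[≠] 0) (𝓝 0) := by
          have hb : (fun t : ℝ => Q.eval (t : ℂ)) =O[𝓝[≠] 0] fun t : ℝ => t := by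
            obtain ⟨C, hC⟩ := hO.bound
            refine IsBigO.of_bound C ?_
            have h1 : ∀ᶠ t : ℝ in 𝓝[≠] 0, |t| < 1 := by
              refine nhdsWithin_le_nhds ?_
              filter_upwards [Metric.ball_mem_nhds (0 : ℝ) one_pos] with t ht
              simpa using ht
            filter_upwards [nhdsWithin_le_nhds hC, self_mem_nhdsWithin, h1] with t ht ht0 ht1
            have ht0' : 0 < |t| := abs_pos.2 ht0
            rw [hQ, Polynomial.eval_mul, Polynomial.eval_pow, Polynomial.eval_X, norm_mul,
              norm_pow, norm_pow, Complex.norm_real, Real.norm_eq_abs] at ht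
            obtain ⟨j, rfl⟩ := Nat.exists_eq_add_of_lt hk
            have h5 : |t| ^ k * ‖Q.eval (t : ℂ)‖ ≤ |t| ^ k * (C * |t| ^ (j + 1)) := by
              refine ht.trans (le_of_eq ?_); ring
            have h6 := le_of_mul_le_mul_left h5 (by positivity)
            have hC0 : 0 ≤ C := by
              by_contra hneg
              have := norm_nonneg (Q.eval (t : ℂ))
              have : C * |t| ^ (j + 1) < 0 := mul_neg_of_neg_of_pos (not_le.1 hneg) (by positivity)
              linarith
            refine h6.trans (mul_le_mul_of_nonneg_left ?_ hC0)
            rw [Real.norm_eq_abs, pow_succ]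
            exact mul_le_of_le_one_left ht0'.le (pow_le_one₀ ht0'.le ht1.le)
          refine hb.trans_tendsto ?_
          exact (continuous_id.tendsto (0 : ℝ)).mono_left nhdsWithin_le_nhds
        exact tendsto_nhds_unique hlim hlim'
    have := hcoef k hk
    rw [hP, Polynomial.finsetSum_coeff] at this
    simpa [Polynomial.coeff_C_mul, Polynomial.coeff_X_pow, hk] using this
  intro d hd
  have := congrArg (MvPolynomial.coeff d) (key d.degree hd)
  rw [MvPolynomial.coeff_homogeneousComponent, if_pos rfl] at this
  rw [← MvPowerSeries.coeff_truncTotal φ hd]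
  simpa using this

end Separation

/-! ### The two coordinate systems -/

/-- The coordinates `(z, z̄)` on `ℂⁿ`. -/
noncomputable def realCoord {n : ℕ} (z : ZSpace n) : Fin n ⊕ Fin n → ℂ :=
  Sum.elim (fun i => z i) (fun i => starRingEnd ℂ (z i))

/-- The coordinates `(z, w)` on `ℂⁿ⁺¹`. -/
def holCoord {n : ℕ} (p : Ambient n) : Fin n ⊕ Unit → ℂ :=
  Sum.elim (fun i => p.1 i) (fun _ => p.2)

theorem isCoord_realCoord {n : ℕ} : IsCoord (realCoord (n := n)) := by
  rintro (i | i)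
  · exact IsBigO.of_bound 1 (Eventually.of_forall fun z => by
      simpa [realCoord] using PiLp.norm_apply_le z i)
  · exact IsBigO.of_bound 1 (Eventually.of_forall fun z => by
      simpa [realCoord] using PiLp.norm_apply_le z i)

theorem norm_holCoord_le {n : ℕ} (p : Ambient n) (s : Fin n ⊕ Unit) : ‖holCoord p s‖ ≤ ‖p‖ := by
  rcases s with i | i
  · exact (PiLp.norm_apply_le p.1 i).trans (norm_fst_le p)
  · exact norm_snd_le p

theorem isCoord_holCoord {n : ℕ} : IsCoord (holCoord (n := n)) := fun s =>
  IsBigO.of_bound 1 (Eventually.of_forall fun p => by simpa using norm_holCoord_le p s)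

theorem separatesJets_holCoord {n : ℕ} : SeparatesJets (holCoord (n := n)) := by
  refine separatesJets_of_homogeneous ?_ ?_
  · rintro t x (i | i) <;> simp [holCoord]
  · intro p hp
    refine MvPolynomial.funext fun v => ?_
    have := hp (WithLp.toLp 2 fun i => v (Sum.inl i), v (Sum.inr ()))
    rw [map_zero, ← this]
    congr 1
    congr 1
    ext (i | i) <;> simp [holCoord]

theorem separatesJets_realCoord {n : ℕ} : SeparatesJets (realCoord (n := n)) := by
  refine separatesJets_of_homogeneous ?_ ?_
  · rintro t x (i | i) <;> simp [realCoord]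
  · intro p hp
    -- change to the real and imaginary parts
    set a : Fin n ⊕ Fin n → MvPolynomial (Fin n ⊕ Fin n) ℂ :=
      Sum.elim (fun i => MvPolynomial.X (Sum.inl i) + MvPolynomial.C Complex.I *
          MvPolynomial.X (Sum.inr i))
        (fun i => MvPolynomial.X (Sum.inl i) - MvPolynomial.C Complex.I *
          MvPolynomial.X (Sum.inr i)) with ha
    have h1 : MvPolynomial.aeval a p = 0 := by
      refine MvPolynomial.funext_set (fun _ => Set.range ((↑) : ℝ → ℂ))
        (fun _ => Set.infinite_range_of_injective Complex.ofReal_injective) ?_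
      intro v hv
      choose x hx using fun s => hv s (Set.mem_univ s)
      have h2 := hp (WithLp.toLp 2 fun i => (x (Sum.inl i) : ℂ) + Complex.I * x (Sum.inr i))
      rw [map_zero, ← h2, ← MvPolynomial.coe_aeval_eq_eval, ← MvPolynomial.coe_aeval_eq_eval,
        MvPolynomial.aeval_eq_bind₁, RingHom.coe_coe, RingHom.coe_coe, MvPolynomial.aeval_bind₁]
      congr 2
      ext (i | i)
      · simp [ha, realCoord, hx]
      · simp [ha, realCoord, ← hx, sub_eq_add_neg]
    -- The inverse linear substitution: `(z + z̄) / 2` and `-i (z - z̄) / 2`. Following `a` by `b`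
    -- gives the identity, so `p` is recovered from a zero polynomial.
    set b : Fin n ⊕ Fin n → MvPolynomial (Fin n ⊕ Fin n) ℂ :=
      Sum.elim (fun i => MvPolynomial.C (1 / 2) * (MvPolynomial.X (Sum.inl i) +
          MvPolynomial.X (Sum.inr i)))
        (fun i => MvPolynomial.C (-Complex.I / 2) * (MvPolynomial.X (Sum.inl i) -
          MvPolynomial.X (Sum.inr i))) with hb
    have h2 := congrArg (MvPolynomial.aeval b) h1
    rw [MvPolynomial.aeval_eq_bind₁, MvPolynomial.aeval_eq_bind₁, MvPolynomial.bind₁_bind₁,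
      map_zero] at h2
    rw [← h2]
    conv_lhs => rw [← MvPolynomial.aeval_X_left_apply p]
    rw [MvPolynomial.aeval_eq_bind₁]
    congr 2
    have hI : (MvPolynomial.C Complex.I : MvPolynomial (Fin n ⊕ Fin n) ℂ) *
        MvPolynomial.C (-Complex.I / 2) = MvPolynomial.C (1 / 2) := by
      rw [← MvPolynomial.C_mul]
      congr 1
      linear_combination (-1 / 2 : ℂ) * Complex.I_mul_I
    have h12 : (MvPolynomial.C (1 / 2) : MvPolynomial (Fin n ⊕ Fin n) ℂ) * 2 = 1 := by
      rw [show (2 : MvPolynomial (Fin n ⊕ Fin n) ℂ) = MvPolynomial.C 2 from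
        (map_ofNat MvPolynomial.C 2).symm, ← MvPolynomial.C_mul]
      norm_num
    funext s
    rcases s with i | i
    · simp only [ha, hb, Sum.elim_inl, map_add, map_mul, MvPolynomial.bind₁_X_right,
        MvPolynomial.bind₁_C_right, Sum.elim_inr]
      linear_combination (MvPolynomial.X (Sum.inr i) - MvPolynomial.X (Sum.inl i)) * hI -
        MvPolynomial.X (Sum.inl i) * h12
    · simp only [ha, hb, Sum.elim_inl, map_sub, map_mul, MvPolynomial.bind₁_X_right,
        MvPolynomial.bind₁_C_right, Sum.elim_inr]
      linear_combination (-MvPolynomial.X (Sum.inr i) + MvPolynomial.X (Sum.inl i)) * hI -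
        MvPolynomial.X (Sum.inr i) * h12

end CRSingular

namespace CRSingular

open MvPowerSeries (truncTotal coeff constantCoeff)

/-! ### Convergent expansions -/

theorem eval_truncTotal {σ : Type*} [Fintype σ] (v : σ → ℂ) (N : ℕ) (φ : MvPowerSeries σ ℂ) :
    MvPolynomial.eval v (truncTotal N φ) =
    ∑ d ∈ (Finsupp.finite_of_degree_lt (σ := σ) N).toFinset, coeff d φ * ∏ s, v s ^ d s := by
  rw [MvPolynomial.eval_eq']
  refine Finset.sum_subset_zero_on_sdiff ?_ ?_ ?_
  · intro d hd
    rw [Set.Finite.mem_toFinset]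
    by_contra h
    exact MvPolynomial.mem_support_iff.1 hd
      (MvPowerSeries.coeff_truncTotal_eq_zero _ (not_lt.1 h))
  · intro d hd
    rw [Finset.mem_sdiff, Set.Finite.mem_toFinset] at hd
    rw [← MvPowerSeries.coeff_truncTotal φ hd.1, MvPolynomial.notMem_support_iff.1 hd.2, zero_mul]
  · intro d hd
    have hd' : d.degree < N := by
      by_contra h
      exact MvPolynomial.mem_support_iff.1 hd
        (MvPowerSeries.coeff_truncTotal_eq_zero _ (not_lt.1 h))
    rw [MvPowerSeries.coeff_truncTotal φ hd']

/-- For `‖x‖ < ρ` each term of degree at least `N` is at most `(‖x‖ / ρ) ^ N` times the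
corresponding term of the majorant at `ρ`. -/
theorem hasJet_of_hasSum {E σ : Type*} [NormedAddCommGroup E] [Fintype σ] {u : E → σ → ℂ}
    (hu : ∀ x s, ‖u x s‖ ≤ ‖x‖) {f : E → ℂ} {φ : MvPowerSeries σ ℂ} {ρ : ℝ} (hρ : 0 < ρ)
    (hs : Summable fun d : σ →₀ ℕ => ‖coeff d φ‖ * ρ ^ d.degree)
    (hf : ∀ᶠ x in 𝓝 0, HasSum (fun d : σ →₀ ℕ => coeff d φ * ∏ s, u x s ^ d s) (f x)) (N : ℕ) :
    HasJet u N f φ := by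
  refine IsBigO.of_bound ((∑' d : σ →₀ ℕ, ‖coeff d φ‖ * ρ ^ d.degree) / ρ ^ N) ?_
  filter_upwards [hf, Metric.ball_mem_nhds (0 : E) hρ] with x hx hxρ
  rw [mem_ball_zero_iff] at hxρ
  have he := eval_truncTotal (u x) N φ
  have h1 : HasSum (fun d : σ →₀ ℕ => if d.degree < N then 0 else coeff d φ * ∏ s, u x s ^ d s)
      (f x - MvPolynomial.eval (u x) (truncTotal N φ)) := by
    have h2 : HasSum (fun d : σ →₀ ℕ =>
        if d.degree < N then coeff d φ * ∏ s, u x s ^ d s else 0)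
        (MvPolynomial.eval (u x) (truncTotal N φ)) := by
      rw [he]
      have h3 := hasSum_sum_of_ne_finset_zero
        (f := fun d : σ →₀ ℕ => if d.degree < N then coeff d φ * ∏ s, u x s ^ d s else 0)
        (s := (Finsupp.finite_of_degree_lt (σ := σ) N).toFinset) (L := .unconditional _)
        (fun d hd => if_neg (by simpa using hd))
      convert h3 using 1
      refine Finset.sum_congr rfl fun d hd => ?_
      rw [if_pos (by simpa using hd)]
    refine (hx.sub h2).congr_fun fun d => ?_
    split_ifs <;> simp
  rw [← h1.tsum_eq, norm_pow, norm_norm, div_mul_eq_mul_div, mul_div_assoc, ← div_pow]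
  refine tsum_of_norm_bounded (hs.hasSum.mul_right _) fun d => ?_
  split_ifs with hd
  · rw [norm_zero]; positivity
  · rw [norm_mul, norm_prod, mul_assoc]
    refine mul_le_mul_of_nonneg_left ?_ (norm_nonneg _)
    calc ∏ s, ‖u x s ^ d s‖ ≤ ∏ s, ‖x‖ ^ d s := by
          refine Finset.prod_le_prod (fun _ _ => norm_nonneg _) fun s _ => ?_
          rw [norm_pow]
          exact pow_le_pow_left₀ (norm_nonneg _) (hu x s) _
      _ = ‖x‖ ^ d.degree := by rw [Finset.prod_pow_eq_pow_sum, Finsupp.degree_eq_sum]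
      _ = ρ ^ d.degree * (‖x‖ / ρ) ^ d.degree := by
          rw [div_pow, mul_div_cancel₀ _ (by positivity)]
      _ ≤ ρ ^ d.degree * (‖x‖ / ρ) ^ N := by
          refine mul_le_mul_of_nonneg_left ?_ (by positivity)
          exact pow_le_pow_of_le_one (by positivity) ((div_le_one hρ).2 hxρ.le) (not_lt.1 hd)

theorem norm_realCoord_le {n : ℕ} (z : ZSpace n) (s : Fin n ⊕ Fin n) :
    ‖realCoord z s‖ ≤ ‖z‖ := by
  rcases s with i | i
  · exact PiLp.norm_apply_le z i
  · simpa [realCoord] using PiLp.norm_apply_le z i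

theorem monomialValue_eq {n : ℕ} (d : Fin n ⊕ Fin n →₀ ℕ) (z : ZSpace n) :
    monomialValue d z = ∏ s, realCoord z s ^ d s := by
  rw [Fintype.prod_sum_type]; rfl

/-- At the point `(t, …, t)` with `t > 0` every monomial in `(z, z̄)` takes the value `t ^ |d|`, and
unconditional convergence there is absolute. -/
theorem HasExpansion.exists_summable {n : ℕ} {Φ : ZSpace n → ℂ} {φ : RealSeries n}
    (h : HasExpansion Φ φ) :
    ∃ ρ : ℝ, 0 < ρ ∧ Summable fun d : Fin n ⊕ Fin n →₀ ℕ => ‖coeff d φ‖ * ρ ^ d.degree := by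
  have ht : Tendsto (fun t : ℝ => WithLp.toLp 2 fun _ : Fin n => (t : ℂ)) (𝓝[>] 0)
      (𝓝 (0 : ZSpace n)) := by
    have : Continuous fun t : ℝ => (WithLp.toLp 2 fun _ : Fin n => (t : ℂ) : ZSpace n) := by
      fun_prop
    have h0 := this.tendsto 0
    have h00 : (WithLp.toLp 2 fun _ : Fin n => ((0 : ℝ) : ℂ) : ZSpace n) = 0 := by
      ext; simp
    rw [h00] at h0
    exact h0.mono_left nhdsWithin_le_nhds
  obtain ⟨t, h1, h2⟩ := ((ht.eventually h).and self_mem_nhdsWithin).exists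
  have h2 : 0 < t := h2
  refine ⟨t, h2, ?_⟩
  have h3 := h1.summable.norm
  refine h3.congr fun d => ?_
  rw [norm_mul, monomialValue_eq, norm_prod, Finsupp.degree_eq_sum, ← Finset.prod_pow_eq_pow_sum]
  congr 1
  refine Finset.prod_congr rfl fun s _ => ?_
  rcases s with i | i <;> simp [realCoord, abs_of_pos h2]

theorem HasExpansion.hasJet {n : ℕ} {Φ : ZSpace n → ℂ} {φ : RealSeries n}
    (h : HasExpansion Φ φ) (N : ℕ) : HasJet realCoord N Φ φ := by
  obtain ⟨ρ, hρ, hs⟩ := h.exists_summable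
  refine hasJet_of_hasSum norm_realCoord_le hρ hs ?_ N
  filter_upwards [h] with z hz
  simpa only [monomialValue_eq] using hz

/-- A function which is real analytic at the origin has a convergent expansion in `(z, z̄)`. -/
theorem exists_hasExpansion_of_analyticAt {n : ℕ} {f : ZSpace n → ℂ} (hf : AnalyticAt ℝ f 0) :
    ∃ φ : RealSeries n, HasExpansion f φ := by
  obtain ⟨p, r, hp⟩ := hf
  -- real coordinates
  let b : Fin n ⊕ Fin n → ZSpace n := Sum.elim (fun i => EuclideanSpace.single i 1)
    (fun i => EuclideanSpace.single i Complex.I)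
  let x : ZSpace n → Fin n ⊕ Fin n → ℝ := fun z => Sum.elim (fun i => (z i).re) (fun i => (z i).im)
  -- The matrix expressing real and imaginary parts through `z` and `z̄`.
  let A : Fin n ⊕ Fin n → Fin n ⊕ Fin n → ℂ := fun s t =>
    Sum.elim (fun i => Sum.elim (fun j => if i = j then 1 / 2 else 0)
      (fun j => if i = j then 1 / 2 else 0) t)
      (fun i => Sum.elim (fun j => if i = j then -Complex.I / 2 else 0)
      (fun j => if i = j then Complex.I / 2 else 0) t) s
  have hA : ∀ s t, ‖A s t‖ ≤ 1 := by
    rintro (i | i) (j | j) <;> simp only [A, Sum.elim_inl, Sum.elim_inr] <;> split_ifs <;>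
      norm_num
  have hb : ∀ s, ‖b s‖ ≤ 1 := by
    rintro (i | i) <;> simp [b]
  have hxz : ∀ z, z = ∑ s, x z s • b s := by
    intro z
    ext i
    simp only [x, b, Fintype.sum_sum_type, Sum.elim_inl, Sum.elim_inr, PiLp.add_apply,
      WithLp.ofLp_sum, Finset.sum_apply, PiLp.smul_apply, PiLp.single_apply, smul_ite, smul_zero,
      Finset.sum_ite_eq, Finset.mem_univ, if_true, Complex.real_smul, mul_one]
    exact (Complex.re_add_im (z i)).symm
  have hxu : ∀ z s, (x z s : ℂ) = ∑ t, A s t * realCoord z t := by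
    rintro z (i | i)
    · simp only [x, A, realCoord, Fintype.sum_sum_type, Sum.elim_inl, Sum.elim_inr, ite_mul,
        zero_mul, Finset.sum_ite_eq, Finset.mem_univ, if_true]
      rw [Complex.re_eq_add_conj]; ring
    · simp only [x, A, realCoord, Fintype.sum_sum_type, Sum.elim_inl, Sum.elim_inr, ite_mul,
        zero_mul, Finset.sum_ite_eq, Finset.mem_univ, if_true]
      rw [Complex.im_eq_sub_conj]
      field_simp
      linear_combination (z i - starRingEnd ℂ (z i)) * Complex.I_sq
  -- Coefficients indexed by words in the variables `z, z̄`; words with the same multidegree are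
  -- grouped afterwards.
  let c : (Σ k, Fin k → Fin n ⊕ Fin n) → ℂ := fun h =>
    ∑ g : Fin h.1 → Fin n ⊕ Fin n, (∏ j, A (g j) (h.2 j)) * p h.1 fun j => b (g j)
  have hc : ∀ h, ‖c h‖ ≤ (2 * n : ℝ) ^ h.1 * ‖p h.1‖ := by
    intro h
    refine (norm_sum_le _ _).trans ?_
    have : ∀ g : Fin h.1 → Fin n ⊕ Fin n,
        ‖(∏ j, A (g j) (h.2 j)) * p h.1 fun j => b (g j)‖ ≤ ‖p h.1‖ := by
      intro g
      rw [norm_mul, norm_prod]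
      have h1 : ∏ j, ‖A (g j) (h.2 j)‖ ≤ 1 :=
        Finset.prod_le_one (fun _ _ => norm_nonneg _) fun _ _ => hA _ _
      have h2 : ‖p h.1 fun j => b (g j)‖ ≤ ‖p h.1‖ :=
        (p h.1).unit_le_opNorm ((pi_norm_le_iff_of_nonneg zero_le_one).2 fun j => hb _)
      exact (mul_le_of_le_one_left (norm_nonneg _) h1).trans h2
    refine (Finset.sum_le_sum fun g _ => this g).trans ?_
    rw [Finset.sum_const, Finset.card_univ, Fintype.card_fun, Fintype.card_sum, Fintype.card_fin,
      Fintype.card_fin, nsmul_eq_mul, ← two_mul]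
    push_cast
    exact le_rfl
  have hpz : ∀ k z, p k (fun _ => z) =
      ∑ h : Fin k → Fin n ⊕ Fin n, c ⟨k, h⟩ * ∏ j, realCoord z (h j) := by
    intro k z
    conv_lhs => rw [hxz z]
    rw [ContinuousMultilinearMap.map_sum]
    have h1 : ∀ g : Fin k → Fin n ⊕ Fin n, p k (fun j => x z (g j) • b (g j)) =
        ∑ h : Fin k → Fin n ⊕ Fin n,
          ((∏ j, A (g j) (h j)) * p k fun j => b (g j)) * ∏ j, realCoord z (h j) := by
      intro g
      rw [ContinuousMultilinearMap.map_smul_univ, Complex.real_smul, Complex.ofReal_prod]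
      simp_rw [hxu]
      rw [Finset.prod_univ_sum, Fintype.piFinset_univ, Finset.sum_mul]
      refine Finset.sum_congr rfl fun h _ => ?_
      rw [Finset.prod_mul_distrib]; ring
    simp_rw [h1]
    rw [Finset.sum_comm]
    refine Finset.sum_congr rfl fun h _ => ?_
    rw [← Finset.sum_mul]
  let ty : (Σ k, Fin k → Fin n ⊕ Fin n) → (Fin n ⊕ Fin n →₀ ℕ) :=
    fun h => ∑ j, Finsupp.single (h.2 j) 1
  have hty : ∀ h (v : Fin n ⊕ Fin n → ℂ), ∏ j, v (h.2 j) = ∏ s, v s ^ (ty h) s := by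
    intro h v
    simp only [ty, Finsupp.coe_finsetSum, Finset.sum_apply]
    simp_rw [← Finset.prod_pow_eq_pow_sum]
    rw [Finset.prod_comm]
    refine Finset.prod_congr rfl fun j _ => ?_
    rw [Finset.prod_eq_single (h.2 j)]
    · simp
    · intro s _ hs
      rw [Finsupp.single_eq_of_ne hs, pow_zero]
    · simp
  refine ⟨fun d => ∑' h : {h // ty h = d}, c h, ?_⟩
  obtain ⟨r', hr'0, hr'⟩ := ENNReal.lt_iff_exists_nnreal_btwn.1 hp.r_pos
  have hr'p : 0 < (r' : ℝ) := by exact_mod_cast hr'0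
  have hsum := p.summable_norm_mul_pow (hr'.trans_le hp.r_le)
  -- There are `(2n) ^ k` words of length `k`, each with a coefficient of size at most `(2n) ^ k ‖p
  -- k‖`; hence the radius shrinks by the square of `2n`. The `+ 1` keeps the denominator positive.
  have hδ : 0 < (r' : ℝ) / ((2 * n + 1) ^ 2) := by positivity
  filter_upwards [Metric.ball_mem_nhds (0 : ZSpace n) hδ,
    Metric.eball_mem_nhds (0 : ZSpace n) hp.r_pos] with z hz hzr
  rw [mem_ball_zero_iff, lt_div_iff₀ (by positivity)] at hz
  have hbound : ∀ k (h : Fin k → Fin n ⊕ Fin n), ‖c ⟨k, h⟩ * ∏ j, realCoord z (h j)‖ ≤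
      (2 * n : ℝ) ^ k * ‖p k‖ * ‖z‖ ^ k := by
    intro k h
    rw [norm_mul]
    refine mul_le_mul (hc ⟨k, h⟩) ?_ (norm_nonneg _) (by positivity)
    rw [norm_prod]
    refine (Finset.prod_le_prod (fun _ _ => norm_nonneg _)
      fun j _ => norm_realCoord_le z (h j)).trans ?_
    simp
  have hS : Summable fun h : Σ k, Fin k → Fin n ⊕ Fin n =>
      c h * ∏ j, realCoord z (h.2 j) := by
    refine Summable.of_norm ?_
    rw [summable_sigma_of_nonneg fun _ => norm_nonneg _]
    refine ⟨fun k => (hasSum_fintype _).summable, ?_⟩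
    refine Summable.of_nonneg_of_le (fun k => tsum_nonneg fun _ => norm_nonneg _) (fun k => ?_) hsum
    rw [tsum_fintype]
    refine (Finset.sum_le_sum fun h _ => hbound k h).trans ?_
    rw [Finset.sum_const, Finset.card_univ, Fintype.card_fun, Fintype.card_sum, Fintype.card_fin,
      Fintype.card_fin, nsmul_eq_mul, ← two_mul]
    push_cast
    have h1 : ((2 * n : ℝ) ^ 2 * ‖z‖) ^ k ≤ (r' : ℝ) ^ k := by
      refine pow_le_pow_left₀ (by positivity) (le_trans ?_ hz.le) _
      rw [mul_comm]
      refine mul_le_mul_of_nonneg_left ?_ (norm_nonneg _)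
      exact pow_le_pow_left₀ (by positivity) (by linarith) 2
    calc (2 * n : ℝ) ^ k * ((2 * n) ^ k * ‖p k‖ * ‖z‖ ^ k)
        = ‖p k‖ * ((2 * n : ℝ) ^ 2 * ‖z‖) ^ k := by
          rw [mul_pow _ ‖z‖, ← pow_mul (2 * (n : ℝ)) 2 k, mul_comm 2 k, pow_mul (2 * (n : ℝ)) k 2]
          ring
      _ ≤ ‖p k‖ * (r' : ℝ) ^ k := mul_le_mul_of_nonneg_left h1 (norm_nonneg _)
  have hf : HasSum (fun h : Σ k, Fin k → Fin n ⊕ Fin n => c h * ∏ j, realCoord z (h.2 j))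
      (f z) := by
    have h1 := hS.hasSum.sigma fun k => hasSum_fintype _
    have h2 := hp.hasSum hzr
    rw [zero_add] at h2
    have h3 := h2.unique (h1.congr_fun fun k => hpz k z)
    rw [h3]
    exact hS.hasSum
  have hf2 := (Equiv.sigmaFiberEquiv ty).hasSum_iff.2 hf
  have hf3 := hf2.sigma fun d => (hf2.summable.sigma_factor d).hasSum
  refine hf3.congr_fun fun d => ?_
  have : ∀ h : {h // ty h = d}, c h * ∏ j, realCoord z (h.1.2 j) = c h * monomialValue d z := by
    rintro ⟨h, rfl⟩
    rw [monomialValue_eq, hty]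
  change (∑' h : {h // ty h = d}, c h) * _ = ∑' h : {h // ty h = d}, c h * ∏ j, realCoord z (h.1.2 j)
  rw [tsum_congr this, tsum_mul_right]

end CRSingular

namespace CRSingular

open MvPowerSeries (truncTotal coeff constantCoeff)

/-! ### Holomorphic functions of several variables -/

section Osgood

variable {V : Type*} [NormedAddCommGroup V] [NormedSpace ℂ V]

theorem hasDerivAt_along_line {f : V → ℂ} {y w : V} {ζ : ℂ}
    (h : DifferentiableAt ℂ f (y + ζ • w)) :
    HasDerivAt (fun ζ : ℂ => f (y + ζ • w)) (fderiv ℂ f (y + ζ • w) w) ζ := by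
  have h1 : HasDerivAt (fun ζ : ℂ => y + ζ • w) w ζ := by
    simpa using ((hasDerivAt_id ζ).smul_const w).const_add y
  exact h.hasFDerivAt.comp_hasDerivAt ζ h1

/-- The one-variable Cauchy estimate on the complex line through `y` in each direction `w`, over the
disc of radius `r / ‖w‖`. -/
theorem norm_fderiv_le_of_forall_ball {f : V → ℂ} {y : V} {r M : ℝ} (hr : 0 < r)
    (hd : ∀ x ∈ Metric.closedBall y r, DifferentiableAt ℂ f x)
    (hM : ∀ x ∈ Metric.closedBall y r, ‖f x‖ ≤ M) : ‖fderiv ℂ f y‖ ≤ M / r := by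
  have hM0 : 0 ≤ M := (norm_nonneg _).trans (hM y (Metric.mem_closedBall_self hr.le))
  refine ContinuousLinearMap.opNorm_le_bound _ (by positivity) fun w => ?_
  rcases eq_or_ne w 0 with rfl | hw
  · simp
  have hw' : 0 < ‖w‖ := norm_pos_iff.2 hw
  have hmem : ∀ ζ ∈ Metric.closedBall (0 : ℂ) (r / ‖w‖), y + ζ • w ∈ Metric.closedBall y r := by
    intro ζ hζ
    rw [mem_closedBall_zero_iff, le_div_iff₀ hw'] at hζ
    simpa [norm_smul] using hζ
  have h1 := hasDerivAt_along_line (w := w) (ζ := 0)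
    (hd _ (hmem 0 (Metric.mem_closedBall_self (by positivity))))
  have h2 : ‖deriv (fun ζ : ℂ => f (y + ζ • w)) 0‖ ≤ M / (r / ‖w‖) := by
    refine Complex.norm_deriv_le_of_forall_mem_sphere_norm_le (by positivity) ?_ ?_
    · refine DifferentiableOn.diffContOnCl fun ζ hζ => ?_
      rw [closure_ball _ (by positivity)] at hζ
      exact (hasDerivAt_along_line (hd _ (hmem ζ hζ))).differentiableAt.differentiableWithinAt
    · intro ζ hζ
      exact hM _ (hmem ζ (Metric.sphere_subset_closedBall hζ))
  rw [h1.deriv, zero_smul, add_zero] at h2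
  refine h2.trans (le_of_eq ?_)
  field_simp

/-- The derivative in direction `v` is a Cauchy integral of `f` over a small circle in that
direction. One differentiates under the integral sign, with the Cauchy estimate as domination. This
is what allows jets to be built by induction on the order. -/
theorem differentiableAt_fderiv_apply [FiniteDimensional ℂ V] {f : V → ℂ} {x₀ : V}
    (hf : ∀ᶠ x in 𝓝 x₀, DifferentiableAt ℂ f x) (v : V) :
    DifferentiableAt ℂ (fun x => fderiv ℂ f x v) x₀ := by
  have : ProperSpace V := FiniteDimensional.proper ℂ V
  obtain ⟨R, hR, hRf⟩ := Metric.eventually_nhds_iff_ball.1 hf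
  set r := R / 4 with hr
  have hr0 : 0 < r := by positivity
  have hcont : ContinuousOn f (Metric.ball x₀ R) := fun x hx =>
    (hRf x hx).continuousAt.continuousWithinAt
  have hsub : Metric.closedBall x₀ (3 * r) ⊆ Metric.ball x₀ R :=
    Metric.closedBall_subset_ball (by rw [hr]; linarith)
  obtain ⟨M, hM⟩ := (isCompact_closedBall x₀ (3 * r)).exists_bound_of_continuousOn
    (hcont.mono hsub)
  -- Circles of this radius in direction `v` around points of the `r`-ball stay in the `2r`-ball; a
  -- further `r` is left for the Cauchy estimate, and `3r < R`.
  set ρ := r / (‖v‖ + 1) with hρ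
  have hρ0 : 0 < ρ := by positivity
  have hρv : ρ * ‖v‖ ≤ r := by
    rw [hρ, div_mul_eq_mul_div, div_le_iff₀ (by positivity)]
    nlinarith [norm_nonneg v]
  have hmem : ∀ x ∈ Metric.ball x₀ r, ∀ ζ ∈ Metric.closedBall (0 : ℂ) ρ,
      x + ζ • v ∈ Metric.closedBall x₀ (2 * r) := by
    intro x hx ζ hζ
    rw [mem_closedBall_zero_iff] at hζ
    rw [mem_ball_iff_norm] at hx
    rw [mem_closedBall_iff_norm]
    calc ‖x + ζ • v - x₀‖ = ‖(x - x₀) + ζ • v‖ := by congr 1; abel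
      _ ≤ ‖x - x₀‖ + ‖ζ‖ * ‖v‖ := (norm_add_le _ _).trans (by rw [norm_smul])
      _ ≤ r + ρ * ‖v‖ := add_le_add hx.le (mul_le_mul_of_nonneg_right hζ (norm_nonneg _))
      _ ≤ 2 * r := by linarith
  have hsub2 : Metric.closedBall x₀ (2 * r) ⊆ Metric.ball x₀ R :=
    Metric.closedBall_subset_ball (by rw [hr]; linarith)
  have hcirc : ∀ θ, circleMap (0 : ℂ) ρ θ ∈ Metric.closedBall (0 : ℂ) ρ := fun θ =>
    circleMap_mem_closedBall 0 hρ0.le θ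
  have hfd : ∀ y ∈ Metric.closedBall x₀ (2 * r), ‖fderiv ℂ f y‖ ≤ M / r := by
    intro y hy
    have hs : Metric.closedBall y r ⊆ Metric.closedBall x₀ (3 * r) := by
      refine Metric.closedBall_subset_closedBall' ?_
      have := Metric.mem_closedBall.1 hy
      linarith
    exact norm_fderiv_le_of_forall_ball hr0 (fun x hx => hRf x (hsub (hs hx)))
      fun x hx => hM x (hs hx)
  let k : ℝ → ℂ := fun θ => deriv (circleMap 0 ρ) θ * ((circleMap (0 : ℂ) ρ θ - 0) ^ 2)⁻¹
  have hk : Continuous k := by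
    have h1 : Continuous (deriv (circleMap 0 ρ)) := by
      simp_rw [funext (deriv_circleMap (0 : ℂ) ρ)]
      fun_prop
    refine h1.mul (Continuous.inv₀ (by fun_prop) fun θ => ?_)
    rw [sub_zero]
    exact pow_ne_zero _ (circleMap_ne_center hρ0.ne')
  let F : V → ℝ → ℂ := fun x θ => k θ * f (x + circleMap 0 ρ θ • v)
  let F' : V → ℝ → V →L[ℂ] ℂ := fun x θ => k θ • fderiv ℂ f (x + circleMap 0 ρ θ • v)
  have hFc : ∀ x ∈ Metric.ball x₀ r, Continuous (F x) := by
    intro x hx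
    refine hk.mul (hcont.comp_continuous (by fun_prop) fun θ => ?_)
    exact hsub2 (hmem x hx _ (hcirc θ))
  have hball : Metric.ball x₀ r ∈ 𝓝 x₀ := Metric.ball_mem_nhds x₀ hr0
  obtain ⟨K, hK⟩ := (isCompact_Icc (a := (0 : ℝ)) (b := 2 * Real.pi)).exists_bound_of_continuousOn
    hk.continuousOn
  have hint := intervalIntegral.hasFDerivAt_integral_of_dominated_of_fderiv_le (𝕜 := ℂ)
    (μ := MeasureTheory.volume) (a := 0) (b := 2 * Real.pi) (F := F) (F' := F') (x₀ := x₀)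
    (s := Metric.ball x₀ r) (bound := fun _ => K * (M / r)) hball
    (by
      filter_upwards [hball] with x hx
      exact (hFc x hx).aestronglyMeasurable)
    ((hFc x₀ (Metric.mem_ball_self hr0)).intervalIntegrable _ _)
    (by
      borelize V
      refine MeasureTheory.AEStronglyMeasurable.smul hk.aestronglyMeasurable ?_
      refine Measurable.aestronglyMeasurable ?_
      exact (measurable_fderiv ℂ f).comp (by fun_prop : Continuous fun θ : ℝ =>
        x₀ + circleMap 0 ρ θ • v).measurable)
    (by
      refine Eventually.of_forall fun θ hθ x hx => ?_
      rw [Set.uIoc_of_le (by positivity)] at hθ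
      rw [norm_smul]
      have h1 := hK θ (Set.Ioc_subset_Icc_self hθ)
      exact mul_le_mul h1 (hfd _ (hmem x hx _ (hcirc θ))) (norm_nonneg _)
        ((norm_nonneg _).trans h1))
    (intervalIntegrable_const)
    (by
      refine Eventually.of_forall fun θ hθ x hx => ?_
      have h1 := (hRf _ (hsub2 (hmem x hx _ (hcirc θ)))).hasFDerivAt
      have h2 := h1.comp x ((hasFDerivAt_id x).add_const (circleMap 0 ρ θ • v))
      simpa [F, F', Function.comp_def] using h2.const_mul (k θ))
  have heq : ∀ᶠ x in 𝓝 x₀, (2 * Real.pi * Complex.I : ℂ)⁻¹ * ∫ θ in (0)..(2 * Real.pi), F x θ =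
      fderiv ℂ f x v := by
    filter_upwards [hball] with x hx
    have hU : IsOpen ((fun ζ : ℂ => x + ζ • v) ⁻¹' Metric.ball x₀ R) :=
      Metric.isOpen_ball.preimage (by fun_prop)
    have hc : Metric.closedBall (0 : ℂ) ρ ⊆ (fun ζ : ℂ => x + ζ • v) ⁻¹' Metric.ball x₀ R :=
      fun ζ hζ => hsub2 (hmem x hx ζ hζ)
    have h1 := Complex.two_pi_I_inv_smul_circleIntegral_sub_sq_inv_smul_of_differentiable
      (f := fun ζ : ℂ => f (x + ζ • v)) (w₀ := 0) hU hc
      (fun ζ hζ => (hasDerivAt_along_line (hRf _ hζ)).differentiableAt.differentiableWithinAt)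
      (Metric.mem_ball_self hρ0)
    have h2 := (hasDerivAt_along_line (f := f) (y := x) (w := v) (ζ := 0)
      (hRf _ (hc (Metric.mem_closedBall_self hρ0.le)))).deriv
    rw [h2, zero_smul, add_zero] at h1
    rw [← h1, smul_eq_mul, circleIntegral]
    congr 1
    refine intervalIntegral.integral_congr fun θ _ => ?_
    simp only [F, k, smul_eq_mul]
    ring
  exact ((hint.const_mul _).congr_of_eventuallyEq (heq.mono fun x hx => hx.symm)).differentiableAt

theorem eventually_differentiableAt_fderiv_apply [FiniteDimensional ℂ V] {f : V → ℂ} {x₀ : V}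
    (hf : ∀ᶠ x in 𝓝 x₀, DifferentiableAt ℂ f x) (v : V) :
    ∀ᶠ y in 𝓝 x₀, DifferentiableAt ℂ (fun x => fderiv ℂ f x v) y := by
  filter_upwards [hf.eventually_nhds] with y hy
  exact differentiableAt_fderiv_apply hy v

end Osgood

/-- The standard basis of `ℂⁿ⁺¹`. -/
noncomputable def holBasis {n : ℕ} : Fin n ⊕ Unit → Ambient n :=
  Sum.elim (fun i => (EuclideanSpace.single i 1, 0)) (fun _ => (0, 1))

theorem sum_holCoord_smul {n : ℕ} (p : Ambient n) : ∑ s, holCoord p s • holBasis s = p := by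
  rw [Fintype.sum_sum_type]
  refine Prod.ext ?_ ?_
  · ext i
    simp [holCoord, holBasis, Prod.fst_sum, Pi.single_apply]
  · simp [holCoord, holBasis, Prod.snd_sum]

/-- Holomorphic functions have jets of all orders. -/
theorem exists_hasJet_of_eventually_differentiableAt {n : ℕ} (N : ℕ) :
    ∀ f : Ambient n → ℂ, (∀ᶠ x in 𝓝 0, DifferentiableAt ℂ f x) →
      ∃ φ, HasJet holCoord N f φ := by
  induction N with
  | zero =>
    intro f hf
    refine ⟨0, ?_⟩
    rw [hasJet_zero_iff]
    simpa using hf.self_of_nhds.continuousAt.isBigO_one ℝ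
  | succ N ih =>
    intro f hf
    choose ψ hψ using fun s => ih (fun x => fderiv ℂ f x (holBasis s))
      (eventually_differentiableAt_fderiv_apply hf _)
    let p : Fin n ⊕ Unit → MvPolynomial (Fin n ⊕ Unit) ℂ := fun s => truncTotal N (ψ s)
    -- The radial antiderivative of the jets of the partial derivatives: `∫₀¹ ∑ xₛ pₛ(t x) dt`
    -- divides the degree-`d` part by `d + 1`.
    let q : MvPolynomial (Fin n ⊕ Unit) ℂ := MvPolynomial.C (f 0) +
      ∑ s, ∑ d ∈ (p s).support, MvPolynomial.monomial (d + Finsupp.single s 1)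
        ((p s).coeff d / (d.degree + 1))
    refine ⟨q, (hasJet_iff isCoord_holCoord (p := q) fun d _ => (MvPolynomial.coeff_coe q d).symm).2
      ?_⟩
    have hb : ∀ s, ∃ C, 0 ≤ C ∧ ∀ᶠ x : Ambient n in 𝓝 0,
        ‖fderiv ℂ f x (holBasis s) - MvPolynomial.eval (holCoord x) (p s)‖ ≤ C * ‖x‖ ^ N := by
      intro s
      obtain ⟨C, hC0, hC⟩ := (hψ s).exists_nonneg
      exact ⟨C, hC0, hC.bound.mono fun x hx => by simpa using hx⟩
    choose C hC0 hC using hb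
    have hev : ∀ᶠ x : Ambient n in 𝓝 0, DifferentiableAt ℂ f x ∧ ∀ s,
        ‖fderiv ℂ f x (holBasis s) - MvPolynomial.eval (holCoord x) (p s)‖ ≤ C s * ‖x‖ ^ N :=
      hf.and (eventually_all.2 hC)
    obtain ⟨δ, hδ, hδf⟩ := Metric.eventually_nhds_iff_ball.1 hev
    refine IsBigO.of_bound (∑ s, C s) ?_
    filter_upwards [Metric.ball_mem_nhds (0 : Ambient n) hδ] with x hx
    rw [mem_ball_zero_iff] at hx
    have hq : ∀ t : ℝ, MvPolynomial.eval (holCoord (t • x)) q = f 0 +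
        ∑ s, ∑ d ∈ (p s).support, ((p s).coeff d / (d.degree + 1)) *
          ((t : ℂ) ^ (d.degree + 1) * (holCoord x s * ∏ i, holCoord x i ^ d i)) := by
      intro t
      have hh : holCoord (t • x) = fun s => (t : ℂ) * holCoord x s := by
        ext (i | i) <;> simp [holCoord]
      simp only [q, map_add, map_sum, MvPolynomial.eval_C, MvPolynomial.eval_monomial]
      congr 1
      refine Finset.sum_congr rfl fun s _ => Finset.sum_congr rfl fun d _ => ?_
      rw [Finsupp.prod_fintype _ _ (fun _ => pow_zero _)]
      congr 1
      simp only [hh, Finsupp.add_apply, pow_add, mul_pow, Finset.prod_mul_distrib,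
        Finset.prod_pow_eq_pow_sum]
      rw [← Finsupp.degree_eq_sum, ← Finsupp.degree_eq_sum, Finsupp.degree_single]
      have h1 : ∏ i, holCoord x i ^ (Finsupp.single s 1) i = holCoord x s := by
        rw [Finset.prod_eq_single s]
        · simp
        · intro i _ hi
          rw [Finsupp.single_eq_of_ne hi, pow_zero]
        · simp
      rw [h1]; ring
    have hp : ∀ (t : ℝ) s, MvPolynomial.eval (holCoord (t • x)) (p s) =
        ∑ d ∈ (p s).support, (p s).coeff d * ((t : ℂ) ^ d.degree * ∏ i, holCoord x i ^ d i) := by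
      intro t s
      have hh : holCoord (t • x) = fun s => (t : ℂ) * holCoord x s := by
        ext (i | i) <;> simp [holCoord]
      rw [MvPolynomial.eval_eq']
      refine Finset.sum_congr rfl fun d _ => ?_
      simp only [hh, mul_pow, Finset.prod_mul_distrib, Finset.prod_pow_eq_pow_sum]
      rw [← Finsupp.degree_eq_sum]
    -- The derivative of the remainder along the segment from `0` to `x`. It is `O(‖x‖ ^ (N + 1))`,
    -- so the mean value inequality finishes.
    let g' : ℝ → ℂ := fun t => ∑ s, holCoord x s *
      (fderiv ℂ f (t • x) (holBasis s) - MvPolynomial.eval (holCoord (t • x)) (p s))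
    have htx : ∀ t ∈ Set.Icc (0 : ℝ) 1, ‖t • x‖ ≤ ‖x‖ := by
      intro t ht
      rw [norm_smul, Real.norm_eq_abs, abs_of_nonneg ht.1]
      exact mul_le_of_le_one_left (norm_nonneg _) ht.2
    have htb : ∀ t ∈ Set.Icc (0 : ℝ) 1, t • x ∈ Metric.ball (0 : Ambient n) δ := by
      intro t ht
      rw [mem_ball_zero_iff]
      exact (htx t ht).trans_lt hx
    have hder : ∀ t ∈ Set.Icc (0 : ℝ) 1,
        HasDerivAt (fun t : ℝ => f (t • x) - MvPolynomial.eval (holCoord (t • x)) q) (g' t) t := by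
      intro t ht
      have h1 : HasDerivAt (fun t : ℝ => f (t • x)) (fderiv ℂ f (t • x) x) t := by
        have h2 := ((hδf _ (htb t ht)).1.hasFDerivAt.restrictScalars ℝ).comp_hasDerivAt t
          ((hasDerivAt_id t).smul_const x)
        rw [one_smul] at h2
        exact h2
      have h3 : fderiv ℂ f (t • x) x = ∑ s, holCoord x s * fderiv ℂ f (t • x) (holBasis s) := by
        conv_lhs => rw [← sum_holCoord_smul x, map_sum, sum_holCoord_smul x]
        refine Finset.sum_congr rfl fun s _ => ?_
        rw [map_smul, smul_eq_mul]
      have h4 : HasDerivAt (fun t : ℝ => MvPolynomial.eval (holCoord (t • x)) q)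
          (∑ s, holCoord x s * MvPolynomial.eval (holCoord (t • x)) (p s)) t := by
        simp_rw [hq, hp]
        refine HasDerivAt.const_add _ ?_
        refine HasDerivAt.fun_sum fun s _ => ?_
        rw [Finset.mul_sum]
        refine HasDerivAt.fun_sum fun d _ => ?_
        have h5 : HasDerivAt (fun t : ℝ => (t : ℂ) ^ (d.degree + 1))
            (((d.degree + 1 : ℕ) : ℂ) * (t : ℂ) ^ d.degree) t := by
          have := (Complex.ofRealCLM.hasDerivAt (x := t)).fun_pow (d.degree + 1)
          simpa using this
        have h6 := (h5.mul_const (holCoord x s * ∏ i, holCoord x i ^ d i)).const_mul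
          ((p s).coeff d / (d.degree + 1))
        refine h6.congr_deriv ?_
        have hne : (d.degree : ℂ) + 1 ≠ 0 := Nat.cast_add_one_ne_zero _
        rw [Nat.cast_add_one]
        generalize (p s).coeff d = a
        generalize (d.degree : ℂ) + 1 = D at hne
        field_simp
      have h5 := h1.fun_sub h4
      rw [h3, ← Finset.sum_sub_distrib] at h5
      simp only [g', mul_sub]
      exact h5
    have hbd : ∀ t ∈ Set.Ico (0 : ℝ) 1, ‖g' t‖ ≤ (∑ s, C s) * ‖x‖ ^ (N + 1) := by
      intro t ht
      have ht' := Set.Ico_subset_Icc_self ht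
      refine (norm_sum_le _ _).trans ?_
      rw [Finset.sum_mul]
      refine Finset.sum_le_sum fun s _ => ?_
      rw [norm_mul, pow_succ', mul_left_comm]
      refine mul_le_mul (norm_holCoord_le x s) ?_ (norm_nonneg _) (norm_nonneg _)
      refine ((hδf _ (htb t ht')).2 s).trans ?_
      exact mul_le_mul_of_nonneg_left (pow_le_pow_left₀ (norm_nonneg _) (htx t ht') _) (hC0 s)
    have := norm_image_sub_le_of_norm_deriv_le_segment_01'
      (fun t ht => (hder t ht).hasDerivWithinAt) hbd
    have h0 : f ((0 : ℝ) • x) - MvPolynomial.eval (holCoord ((0 : ℝ) • x)) q = 0 := by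
      rw [hq]
      simp
    rw [h0, one_smul, sub_zero] at this
    rw [norm_pow, norm_norm]
    exact this

theorem exists_series_of_eventually_differentiableAt {n : ℕ} {f : Ambient n → ℂ}
    (hf : ∀ᶠ x in 𝓝 0, DifferentiableAt ℂ f x) : ∃ φ : HolSeries n, ∀ N, HasJet holCoord N f φ :=
  exists_series_of_forall_jet isCoord_holCoord separatesJets_holCoord fun N =>
    exists_hasJet_of_eventually_differentiableAt N f hf

end CRSingular

namespace CRSingular

open MvPowerSeries (truncTotal coeff constantCoeff)

/-! ### Values and derivatives from jets -/

theorem HasJet.apply_zero {E σ : Type*} [NormedAddCommGroup E] [Fintype σ] {u : E → σ → ℂ}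
    (hu : IsCoord u) {N : ℕ} (hN : 1 ≤ N) {f : E → ℂ}
    {φ : MvPowerSeries σ ℂ} (hf : HasJet u N f φ) : f 0 = constantCoeff φ := by
  have h1 := hf.mono hu hN
  rw [hasJet_iff hu (p := MvPolynomial.C (constantCoeff φ)) (fun d hd => by
    obtain rfl : d = 0 := (Finsupp.degree_eq_zero_iff d).1 (by omega)
    simp)] at h1
  obtain ⟨C, hC⟩ := h1.bound
  have := hC.self_of_nhds
  simpa [sub_eq_zero] using this

/-- The coordinates of `ℂⁿ⁺¹` as continuous linear functionals. -/
noncomputable def holCoordCLM {n : ℕ} : Fin n ⊕ Unit → Ambient n →L[ℂ] ℂ :=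
  Sum.elim (fun i => (EuclideanSpace.proj i).comp (ContinuousLinearMap.fst ℂ _ _))
    (fun _ => ContinuousLinearMap.snd ℂ _ _)

@[simp] theorem holCoordCLM_apply {n : ℕ} (s : Fin n ⊕ Unit) (p : Ambient n) :
    holCoordCLM s p = holCoord p s := by
  rcases s with i | i <;> rfl

@[simp] theorem holCoord_zero {n : ℕ} (s : Fin n ⊕ Unit) : holCoord (0 : Ambient n) s = 0 := by
  rcases s with i | i <;> rfl

theorem isBigO_sub_linear_of_hasJet {E σ : Type*} [NormedAddCommGroup E] [Fintype σ]
    {u : E → σ → ℂ} (hu : IsCoord u) {f : E → ℂ} {φ : MvPowerSeries σ ℂ} (hf : HasJet u 2 f φ) :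
    (fun x => f x - (constantCoeff φ + ∑ s, coeff (Finsupp.single s 1) φ * u x s)) =O[𝓝 0]
      fun x => ‖x‖ ^ 2 := by
  classical
  have h := (hasJet_iff hu (p := MvPolynomial.C (constantCoeff φ) +
    ∑ s, MvPolynomial.C (coeff (Finsupp.single s 1) φ) * MvPolynomial.X s) (fun d hd => by
      rw [MvPolynomial.coeff_add, MvPolynomial.coeff_C, MvPolynomial.coeff_sum]
      simp only [MvPolynomial.coeff_C_mul, MvPolynomial.coeff_X]
      rcases Nat.lt_succ_iff_lt_or_eq.1 hd with h0 | h1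
      · obtain rfl : d = 0 := (Finsupp.degree_eq_zero_iff d).1 (by omega)
        rw [if_pos rfl, Finset.sum_eq_zero, add_zero]
        · rfl
        · intro s _
          rw [if_neg (by simp), mul_zero]
      · obtain ⟨s, rfl⟩ : ∃ s, d = Finsupp.single s 1 := (Finsupp.sum_eq_one_iff d).1 h1
        rw [if_neg (by simp [eq_comm]), zero_add, Finset.sum_eq_single s]
        · simp
        · intro t _ ht
          rw [if_neg, mul_zero]
          intro h
          exact ht (Finsupp.single_left_injective one_ne_zero h)
        · simp)).1 hf
  refine h.congr_left fun x => ?_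
  simp [map_sum]

theorem HasJet.hasFDerivAt {n : ℕ} {f : Ambient n → ℂ} {φ : HolSeries n}
    (hf : HasJet holCoord 2 f φ) :
    HasFDerivAt f (∑ s, coeff (Finsupp.single s 1) φ • holCoordCLM s) 0 := by
  have h := isBigO_sub_linear_of_hasJet isCoord_holCoord hf
  refine HasFDerivAt.of_isLittleO ?_
  have h0 := hf.apply_zero isCoord_holCoord (by norm_num)
  have h2 : (fun x : Ambient n => ‖x‖ ^ 2) =o[𝓝 0] fun x => x - 0 := by
    simpa using (isLittleO_norm_pow_id (E' := Ambient n) one_lt_two)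
  refine (h.trans_isLittleO h2).congr_left fun x => ?_
  simp [h0, sub_sub]

/-! ### Conjugation -/

theorem degree_mapDomain_swap {n : ℕ} (d : Fin n ⊕ Fin n →₀ ℕ) :
    (Finsupp.mapDomain Sum.swap d).degree = d.degree := by
  rw [Finsupp.degree_mapDomain]

theorem mapDomain_swap_swap {n : ℕ} (d : Fin n ⊕ Fin n →₀ ℕ) :
    Finsupp.mapDomain Sum.swap (Finsupp.mapDomain Sum.swap d) = d := by
  rw [← Finsupp.mapDomain_comp, Sum.swap_swap_eq, Finsupp.mapDomain_id]

theorem mapDomain_swap_apply {n : ℕ} (d : Fin n ⊕ Fin n →₀ ℕ) (s : Fin n ⊕ Fin n) :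
    Finsupp.mapDomain Sum.swap d s = d s.swap := by
  have h : (Sum.swap : Fin n ⊕ Fin n → Fin n ⊕ Fin n).Injective :=
    (Equiv.sumComm (Fin n) (Fin n)).injective
  conv_lhs => rw [← Sum.swap_swap s]
  exact Finsupp.mapDomain_apply h d s.swap

theorem coeff_conjSeries {n : ℕ} (φ : RealSeries n) (d : Fin n ⊕ Fin n →₀ ℕ) :
    coeff d (conjSeries φ) = starRingEnd ℂ (coeff (Finsupp.mapDomain Sum.swap d) φ) := rfl

theorem HasJet.conj {n N : ℕ} {f : ZSpace n → ℂ} {φ : RealSeries n}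
    (hf : HasJet realCoord N f φ) :
    HasJet realCoord N (fun z => starRingEnd ℂ (f z)) (conjSeries φ) := by
  refine hf.map_isometry fun z => ?_
  rw [eval_truncTotal, eval_truncTotal, map_sum]
  refine Finset.sum_nbij' (Finsupp.mapDomain Sum.swap) (Finsupp.mapDomain Sum.swap) ?_ ?_
    (fun d _ => mapDomain_swap_swap d) (fun d _ => mapDomain_swap_swap d) ?_
  · intro d hd
    simpa [degree_mapDomain_swap] using hd
  · intro d hd
    simpa [degree_mapDomain_swap] using hd
  · intro d _
    rw [coeff_conjSeries, map_mul, map_prod]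
    congr 1
    rw [Fintype.prod_sum_type, Fintype.prod_sum_type, mul_comm]
    simp [realCoord, mapDomain_swap_apply]

/-! ### The quadric -/

/-- The series `∑ zᵢ z̄ᵢ`. -/
noncomputable def quadSeries (n : ℕ) : RealSeries n :=
  ∑ i, MvPowerSeries.X (Sum.inl i) * MvPowerSeries.X (Sum.inr i)

theorem normSq_eq_sum {n : ℕ} (z : ZSpace n) :
    ((‖z‖ ^ 2 : ℝ) : ℂ) = ∑ i, z i * starRingEnd ℂ (z i) := by
  rw [EuclideanSpace.norm_sq_eq, Complex.ofReal_sum]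
  refine Finset.sum_congr rfl fun i _ => ?_
  rw [Complex.mul_conj, Complex.normSq_eq_norm_sq]

theorem hasJet_quadSeries {n : ℕ} (N : ℕ) :
    HasJet realCoord N (fun z : ZSpace n => ((‖z‖ ^ 2 : ℝ) : ℂ)) (quadSeries n) := by
  have h : HasJet realCoord N (fun z : ZSpace n => ∑ i, realCoord z (Sum.inl i) *
      realCoord z (Sum.inr i)) (quadSeries n) :=
    HasJet.sum fun i _ => (hasJet_coord isCoord_realCoord N _).mul isCoord_realCoord
      (hasJet_coord isCoord_realCoord N _)
  exact h.congr_eventually (Eventually.of_forall fun z => (normSq_eq_sum z).symm)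

theorem constantCoeff_quadSeries (n : ℕ) : constantCoeff (quadSeries n) = 0 := by
  simp [quadSeries]

theorem analyticAt_normSq {n : ℕ} (z₀ : ZSpace n) :
    AnalyticAt ℝ (fun z : ZSpace n => ((‖z‖ ^ 2 : ℝ) : ℂ)) z₀ := by
  simp_rw [normSq_eq_sum]
  refine Finset.analyticAt_fun_sum _ fun i _ => ?_
  have h1 : AnalyticAt ℝ (fun z : ZSpace n => z i) z₀ :=
    ((EuclideanSpace.proj (𝕜 := ℂ) i).restrictScalars ℝ).analyticAt z₀
  exact h1.mul ((Complex.conjCLE.toContinuousLinearMap.analyticAt _).comp h1)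

theorem subst_quadSeries {n : ℕ} {a : Fin n ⊕ Fin n → RealSeries n}
    (ha : ∀ s, constantCoeff (a s) = 0) :
    MvPowerSeries.subst a (quadSeries n) = ∑ i, a (Sum.inl i) * a (Sum.inr i) := by
  have h := MvPowerSeries.hasSubst_of_constantCoeff_zero ha
  rw [quadSeries, ← MvPowerSeries.substAlgHom_apply h, map_sum]
  simp only [map_mul, MvPowerSeries.substAlgHom_X]

/-! ### Graphs -/

theorem isBigO_graph {n : ℕ} {Φ : ZSpace n → ℂ} (h : Φ =O[𝓝 0] fun z => ‖z‖) :
    (fun z => (z, Φ z)) =O[𝓝 0] fun z => ‖z‖ :=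
  ((isBigO_refl _ _).norm_right).prod_left h

theorem tendsto_zero_of_isBigO_norm {E F : Type*} [NormedAddCommGroup E] [NormedAddCommGroup F]
    {f : E → F} (h : f =O[𝓝 0] fun z => ‖z‖) : Tendsto f (𝓝 0) (𝓝 0) :=
  h.trans_tendsto tendsto_norm_zero

theorem HasJet.isBigO_norm {E σ : Type*} [NormedAddCommGroup E] [Fintype σ] {u : E → σ → ℂ}
    (hu : IsCoord u) {N : ℕ} (hN : 1 ≤ N) {f : E → ℂ} {φ : MvPowerSeries σ ℂ}
    (hf : HasJet u N f φ) (h0 : constantCoeff φ = 0) : f =O[𝓝 0] fun x => ‖x‖ := by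
  have := hf.isBigO hu hN (fun d hd => by
    obtain rfl : d = 0 := (Finsupp.degree_eq_zero_iff d).1 (by omega)
    simpa using h0)
  simpa using this

theorem constantCoeff_graph {n : ℕ} {φ : RealSeries n} (h0 : constantCoeff φ = 0)
    (s : Fin n ⊕ Unit) :
    constantCoeff ((Sum.elim (fun i => (MvPowerSeries.X (Sum.inl i) : RealSeries n))
      (fun _ => φ)) s) = 0 := by
  rcases s with i | i
  · simp
  · simpa using h0

theorem HasJet.restrictToGraph {n N : ℕ} (hN : 1 ≤ N) {Φ : ZSpace n → ℂ} {φ : RealSeries n}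
    (h0 : constantCoeff φ = 0) (hΦ : HasJet realCoord N Φ φ) {f : Ambient n → ℂ} {F : HolSeries n}
    (hf : HasJet holCoord N f F) :
    HasJet realCoord N (fun z => f (z, Φ z)) (restrictToGraph φ F) := by
  have hO := isBigO_graph (hΦ.isBigO_norm isCoord_realCoord hN h0)
  refine HasJet.comp isCoord_realCoord (tendsto_zero_of_isBigO_norm hO) hO ?_
    (constantCoeff_graph h0) hf
  rintro (i | i)
  · exact hasJet_coord isCoord_realCoord N (Sum.inl i)
  · exact hΦ

theorem constantCoeff_restrictToGraph {n : ℕ} {φ : RealSeries n}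
    (h0 : constantCoeff φ = 0) {F : HolSeries n} (hF : constantCoeff F = 0) :
    constantCoeff (restrictToGraph φ F) = 0 :=
  MvPowerSeries.constantCoeff_subst_eq_zero
    (MvPowerSeries.hasSubst_of_constantCoeff_zero (constantCoeff_graph h0))
    (constantCoeff_graph h0) hF

theorem constantCoeff_conjSeries {n : ℕ} {φ : RealSeries n} (h : constantCoeff φ = 0) :
    constantCoeff (conjSeries φ) = 0 := by
  rw [← MvPowerSeries.coeff_zero_eq_constantCoeff_apply] at *
  rw [coeff_conjSeries, Finsupp.mapDomain_zero, h, map_zero]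

theorem constantCoeff_elim_conj {n : ℕ} {a : Fin n → RealSeries n}
    (h : ∀ i, constantCoeff (a i) = 0) (s : Fin n ⊕ Fin n) :
    constantCoeff ((Sum.elim a (fun i => conjSeries (a i))) s) = 0 := by
  rcases s with i | i
  · exact h i
  · exact constantCoeff_conjSeries (h i)

/-! ### Holomorphic equivalence implies formal equivalence -/

/-- The formal map consists of the Taylor series of the components of `H`. The mapping identity
holds between functions of `z` near `0`, hence between their jets of every order, hence between the
series. -/
theorem FormallyEquivalent.of_holomorphicallyEquivalent {n : ℕ} {M : Set (Ambient n)}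
    {E : ZSpace n → ℂ} (hE : AnalyticAt ℝ E 0) (hE3 : E =O[𝓝 0] fun z => ‖z‖ ^ 3)
    (hM : ∀ᶠ p in 𝓝 (0 : Ambient n), p ∈ M ↔ p.2 = ((‖p.1‖ ^ 2 : ℝ) : ℂ) + E p.1)
    (h : HolomorphicallyEquivalent M (quadric n)) : FormallyEquivalent M (quadric n) := by
  obtain ⟨H, hH0, hH00, hd, hd', hI⟩ := h
  set Φ : ZSpace n → ℂ := fun z => ((‖z‖ ^ 2 : ℝ) : ℂ) + E z with hΦ
  obtain ⟨φ, hφ⟩ := exists_hasExpansion_of_analyticAt ((analyticAt_normSq 0).add hE)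
  have hφ : HasExpansion Φ φ := hφ
  have hE0 : E 0 = 0 := by
    obtain ⟨C, hC⟩ := hE3.bound
    simpa using hC.self_of_nhds
  have hφ0 : constantCoeff φ = 0 := by
    rw [← (hφ.hasJet 1).apply_zero isCoord_realCoord le_rfl]
    simp [hΦ, hE0]
  obtain ⟨ψ, hψ⟩ := exists_hasExpansion_of_analyticAt (analyticAt_normSq (0 : ZSpace n))
  obtain rfl : ψ = quadSeries n :=
    HasJet.unique_of_forall separatesJets_realCoord hψ.hasJet hasJet_quadSeries
  refine ⟨φ, quadSeries n, ⟨hφ0, Φ, hφ, hM⟩, ⟨constantCoeff_quadSeries n, _, hψ,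
    Eventually.of_forall fun p => Iff.rfl⟩, ?_⟩
  have hsrc : ∀ᶠ x in 𝓝 (0 : Ambient n), x ∈ H.source := H.open_source.mem_nhds hH0
  have hdiff : ∀ᶠ x in 𝓝 (0 : Ambient n), DifferentiableAt ℂ H x := by
    filter_upwards [hsrc] with x hx using hd.differentiableAt (H.open_source.mem_nhds hx)
  have hcomp : ∀ s, ∀ᶠ x in 𝓝 (0 : Ambient n),
      DifferentiableAt ℂ (fun x => holCoord (H x) s) x := by
    intro s
    filter_upwards [hdiff] with x hx
    simpa only [holCoordCLM_apply, Function.comp_def] using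
      (holCoordCLM s).differentiableAt.comp x hx
  choose F hF using fun s => exists_series_of_eventually_differentiableAt (hcomp s)
  have hF0 : ∀ s, constantCoeff (F s) = 0 := by
    intro s
    rw [← (hF s 1).apply_zero isCoord_holCoord le_rfl, hH00, holCoord_zero]
  refine ⟨F, ⟨hF0, ?_⟩, ?_⟩
  · rw [isUnit_iff_ne_zero]
    intro hdet
    -- A kernel vector of the Jacobian would be annihilated by the derivative of `H.symm ∘ H`, which
    -- is the identity.
    obtain ⟨v, hv, hAv⟩ := Matrix.exists_mulVec_eq_zero_iff.2 hdet
    obtain ⟨L, hL⟩ := hdiff.self_of_nhds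
    set x : Ambient n := ∑ s, v s • holBasis s with hx
    have hxv : ∀ s, holCoord x s = v s := by
      rintro (i | i)
      · simp [hx, holCoord, holBasis, Prod.fst_sum, Pi.single_apply]
      · simp [hx, holCoord, holBasis, Prod.snd_sum]
    have hLx : L x = 0 := by
      rw [← sum_holCoord_smul (L x)]
      refine Finset.sum_eq_zero fun s _ => ?_
      have h1 : HasFDerivAt (fun x => holCoord (H x) s) ((holCoordCLM s).comp L) 0 := by
        simpa only [holCoordCLM_apply, Function.comp_def] using
          (holCoordCLM s).hasFDerivAt.comp (0 : Ambient n) hL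
      have h2 := congrArg (fun T : Ambient n →L[ℂ] ℂ => T x) (h1.unique (hF s 2).hasFDerivAt)
      have h3 := congrFun hAv s
      simp only [ContinuousLinearMap.comp_apply, holCoordCLM_apply, sum_apply,
        smul_apply, hxv, smul_eq_mul] at h2
      simp only [Matrix.mulVec, dotProduct, Matrix.of_apply, Pi.zero_apply] at h3
      rw [h2, h3, zero_smul]
    have ht0 : (0 : Ambient n) ∈ H.target := hH00 ▸ H.map_source hH0
    obtain ⟨L', hL'⟩ : DifferentiableAt ℂ H.symm (H 0) := by
      rw [hH00]
      exact hd'.differentiableAt (H.open_target.mem_nhds ht0)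
    have hid : HasFDerivAt (fun x => H.symm (H x)) (L'.comp L) 0 := hL'.comp 0 hL
    have hid' : HasFDerivAt (fun x => H.symm (H x)) (ContinuousLinearMap.id ℂ (Ambient n)) 0 :=
      (hasFDerivAt_id _).congr_of_eventuallyEq
        (hsrc.mono fun x hx => H.left_inv hx)
    have hx0 : x = 0 := by
      have := congrArg (fun T : Ambient n →L[ℂ] Ambient n => T x) (hid'.unique hid)
      simpa [hLx] using this
    refine hv (funext fun s => ?_)
    rw [← hxv, hx0, holCoord_zero, Pi.zero_apply]
  · have hres0 : ∀ i, constantCoeff (restrictToGraph φ (F (Sum.inl i))) = 0 := fun i =>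
      constantCoeff_restrictToGraph hφ0 (hF0 _)
    -- Order `N + 1` is used because restriction to the graph needs a jet of order at least one.
    have hjet : ∀ s N, HasJet realCoord N (fun z => holCoord (H (z, Φ z)) s)
        (restrictToGraph φ (F s)) := fun s N =>
      ((hφ.hasJet (N + 1)).restrictToGraph (Nat.le_add_left 1 N) hφ0 (hF s (N + 1))).mono
        isCoord_realCoord (Nat.le_succ N)
    rw [MapsGraph, subst_quadSeries (constantCoeff_elim_conj hres0)]
    simp only [Sum.elim_inl, Sum.elim_inr]
    refine HasJet.unique_of_forall separatesJets_realCoord (hjet (Sum.inr ())) fun N => ?_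
    have h1 : HasJet realCoord N (fun z => ∑ i, holCoord (H (z, Φ z)) (Sum.inl i) *
        starRingEnd ℂ (holCoord (H (z, Φ z)) (Sum.inl i)))
        (∑ i, restrictToGraph φ (F (Sum.inl i)) *
          conjSeries (restrictToGraph φ (F (Sum.inl i)))) :=
      HasJet.sum fun i _ => (hjet _ N).mul isCoord_realCoord (hjet _ N).conj
    refine h1.congr_eventually ?_
    have hO := isBigO_graph ((hφ.hasJet 1).isBigO_norm isCoord_realCoord le_rfl hφ0)
    have ht := tendsto_zero_of_isBigO_norm hO
    filter_upwards [ht.eventually hsrc, ht.eventually hM] with z hz1 hz2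
    have h2 : H (z, Φ z) ∈ quadric n := (hI hz1).2 (hz2.2 rfl)
    have h3 : (H (z, Φ z)).2 = _ := h2
    rw [normSq_eq_sum] at h3
    exact h3.symm

end CRSingular

namespace CRSingular

open MvPowerSeries (truncTotal coeff constantCoeff)

/-! ### Order of vanishing and truncated norms of formal power series -/

section Series

variable {σ τ : Type*}

/-- The series `f` vanishes to order `k`. -/
def VanishesTo (k : ℕ) (f : MvPowerSeries σ ℂ) : Prop :=
  ∀ e : σ →₀ ℕ, e.degree < k → coeff e f = 0

theorem VanishesTo.mono {j k : ℕ} {f : MvPowerSeries σ ℂ} (h : VanishesTo k f) (hj : j ≤ k) :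
    VanishesTo j f := fun e he => h e (he.trans_le hj)

theorem vanishesTo_zero (f : MvPowerSeries σ ℂ) : VanishesTo 0 f := fun _ he =>
  absurd he (Nat.not_lt_zero _)

theorem vanishesTo_zero_series (k : ℕ) : VanishesTo k (0 : MvPowerSeries σ ℂ) := fun _ _ => by simp

theorem VanishesTo.add {k : ℕ} {f g : MvPowerSeries σ ℂ} (hf : VanishesTo k f)
    (hg : VanishesTo k g) : VanishesTo k (f + g) := fun e he => by
  rw [map_add, hf e he, hg e he, add_zero]

theorem VanishesTo.sub {k : ℕ} {f g : MvPowerSeries σ ℂ} (hf : VanishesTo k f)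
    (hg : VanishesTo k g) : VanishesTo k (f - g) := fun e he => by
  rw [map_sub, hf e he, hg e he, sub_zero]

theorem VanishesTo.sum {ι : Type*} {s : Finset ι} {k : ℕ} {f : ι → MvPowerSeries σ ℂ}
    (h : ∀ i ∈ s, VanishesTo k (f i)) : VanishesTo k (∑ i ∈ s, f i) := fun e he => by
  rw [map_sum]
  exact Finset.sum_eq_zero fun i hi => h i hi e he

theorem VanishesTo.mul {j k : ℕ} {f g : MvPowerSeries σ ℂ} (hf : VanishesTo j f)
    (hg : VanishesTo k g) : VanishesTo (j + k) (f * g) := by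
  classical
  intro e he
  rw [MvPowerSeries.coeff_mul]
  refine Finset.sum_eq_zero fun a ha => ?_
  rw [Finset.HasAntidiagonal.mem_antidiagonal] at ha
  have h1 : a.1.degree + a.2.degree = e.degree := by rw [← ha, map_add]
  by_cases h : a.1.degree < j
  · rw [hf _ h, zero_mul]
  · rw [hg _ (by omega), mul_zero]

theorem VanishesTo.pow {k : ℕ} {f : MvPowerSeries σ ℂ} (hf : VanishesTo k f) (m : ℕ) :
    VanishesTo (m * k) (f ^ m) := by
  induction m with
  | zero => simpa using vanishesTo_zero _
  | succ m ih =>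
    rw [pow_succ, Nat.succ_mul]
    exact ih.mul hf

theorem VanishesTo.prod {ι : Type*} {s : Finset ι} {k : ι → ℕ} {f : ι → MvPowerSeries σ ℂ}
    (h : ∀ i ∈ s, VanishesTo (k i) (f i)) : VanishesTo (∑ i ∈ s, k i) (∏ i ∈ s, f i) := by
  classical
  induction s using Finset.induction_on with
  | empty => simpa using vanishesTo_zero _
  | insert i s hi ih =>
    rw [Finset.sum_insert hi, Finset.prod_insert hi]
    exact (h i (Finset.mem_insert_self i s)).mul
      (ih fun j hj => h j (Finset.mem_insert_of_mem hj))

theorem vanishesTo_one_iff {f : MvPowerSeries σ ℂ} :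
    VanishesTo 1 f ↔ constantCoeff f = 0 := by
  constructor
  · intro h
    simpa using h 0 (by simp)
  · intro h e he
    obtain rfl : e = 0 := (Finsupp.degree_eq_zero_iff e).1 (by omega)
    simpa using h

theorem vanishesTo_X (s : σ) : VanishesTo 1 (MvPowerSeries.X s : MvPowerSeries σ ℂ) :=
  vanishesTo_one_iff.2 (by simp)

theorem coeff_subst_eq_coeff_aeval [Finite σ] [Finite τ] {a : σ → MvPowerSeries τ ℂ}
    (ha : ∀ s, constantCoeff (a s) = 0) (f : MvPowerSeries σ ℂ) {K : ℕ} {e : τ →₀ ℕ}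
    (he : e.degree < K) :
    coeff e (MvPowerSeries.subst a f) = coeff e (MvPolynomial.aeval a (truncTotal K f)) := by
  rw [← MvPowerSeries.coeff_truncTotal _ he,
    MvPowerSeries.truncTotal_subst_eq_truncTotal_truncTotal_subst ha, MvPowerSeries.subst_coe,
    MvPowerSeries.coeff_truncTotal _ he]

variable [Fintype σ]

theorem aeval_truncTotal (a : σ → MvPowerSeries τ ℂ) (K : ℕ) (f : MvPowerSeries σ ℂ) :
    MvPolynomial.aeval a (truncTotal K f) =
      ∑ d ∈ (truncTotal K f).support, coeff d f • ∏ s, a s ^ d s := by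
  rw [MvPolynomial.aeval_def, MvPolynomial.eval₂_eq']
  refine Finset.sum_congr rfl fun d hd => ?_
  have hd' : d.degree < K := by
    by_contra h
    exact MvPolynomial.mem_support_iff.1 hd
      (MvPowerSeries.coeff_truncTotal_eq_zero _ (not_lt.1 h))
  rw [MvPowerSeries.coeff_truncTotal _ hd', Algebra.smul_def]

theorem degree_lt_of_mem_support_truncTotal {K : ℕ} {f : MvPowerSeries σ ℂ} {d : σ →₀ ℕ}
    (hd : d ∈ (truncTotal K f).support) : d.degree < K ∧ coeff d f ≠ 0 := by
  have hd' : d.degree < K := by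
    by_contra h
    exact MvPolynomial.mem_support_iff.1 hd
      (MvPowerSeries.coeff_truncTotal_eq_zero _ (not_lt.1 h))
  refine ⟨hd', ?_⟩
  rw [← MvPowerSeries.coeff_truncTotal f hd']
  exact MvPolynomial.mem_support_iff.1 hd

theorem prod_pow_add_single {R : Type*} [CommMonoid R] (a : σ → R) (d : σ →₀ ℕ) (s : σ) :
    ∏ t, a t ^ (d + Finsupp.single s 1 : σ →₀ ℕ) t = a s * ∏ t, a t ^ d t := by
  classical
  simp only [Finsupp.add_apply, pow_add, Finset.prod_mul_distrib]
  rw [mul_comm]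
  congr 1
  rw [Finset.prod_eq_single s]
  · simp
  · intro t _ ht
    rw [Finsupp.single_eq_of_ne ht, pow_zero]
  · simp

theorem vanishesTo_prod_pow {a : σ → MvPowerSeries τ ℂ} (ha : ∀ s, VanishesTo 1 (a s))
    (d : σ →₀ ℕ) : VanishesTo d.degree (∏ s, a s ^ d s) := by
  rw [Finsupp.degree_eq_sum]
  refine VanishesTo.prod fun s _ => ?_
  simpa using (ha s).pow (d s)

/-- Telescoping: in each term one factor of order at least `1` is replaced by a difference of order
at least `N`. -/
theorem vanishesTo_prod_pow_sub {N : ℕ} {a b : σ → MvPowerSeries τ ℂ}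
    (ha : ∀ s, VanishesTo 1 (a s)) (hb : ∀ s, VanishesTo 1 (b s))
    (hab : ∀ s, VanishesTo N (a s - b s)) (d : σ →₀ ℕ) :
    VanishesTo (N + d.degree - 1) (∏ s, a s ^ d s - ∏ s, b s ^ d s) := by
  classical
  induction hk : d.degree generalizing d with
  | zero =>
    obtain rfl := (Finsupp.degree_eq_zero_iff d).1 hk
    simpa using vanishesTo_zero_series _
  | succ k ih =>
    obtain ⟨s, hs⟩ : ∃ s, d s ≠ 0 := by
      by_contra h
      push Not at h
      have : d = 0 := Finsupp.ext h
      simp [this] at hk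
    have hd : d = (d - Finsupp.single s 1) + Finsupp.single s 1 :=
      (tsub_add_cancel_of_le (Finsupp.single_le_iff.2 (Nat.one_le_iff_ne_zero.2 hs))).symm
    set d' := d - Finsupp.single s 1 with hd'
    have hdeg : d'.degree = k := by
      have : d.degree = d'.degree + 1 := by
        conv_lhs => rw [hd]
        rw [map_add, Finsupp.degree_single]
      omega
    rw [hd, prod_pow_add_single, prod_pow_add_single]
    have h1 : a s * ∏ t, a t ^ d' t - b s * ∏ t, b t ^ d' t =
        a s * (∏ t, a t ^ d' t - ∏ t, b t ^ d' t) + (a s - b s) * ∏ t, b t ^ d' t := by ring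
    rw [h1]
    have h2 := (hab s).mul (vanishesTo_prod_pow hb d')
    rw [hdeg] at h2
    exact (((ha s).mul (ih d' hdeg)).mono (by omega)).add (h2.mono (by omega))

/-- Every monomial of `f` has degree at least `j + 1`, so telescoping gains `j` beyond the agreement
of the arguments. With `f = ε` of order three the gain is two. -/
theorem vanishesTo_subst_sub [Finite τ] {N j : ℕ} {a b : σ → MvPowerSeries τ ℂ}
    (ha : ∀ s, VanishesTo 1 (a s)) (hb : ∀ s, VanishesTo 1 (b s))
    (hab : ∀ s, VanishesTo N (a s - b s)) {f : MvPowerSeries σ ℂ} (hf : VanishesTo (j + 1) f) :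
    VanishesTo (N + j) (MvPowerSeries.subst a f - MvPowerSeries.subst b f) := by
  intro e he
  rw [map_sub, coeff_subst_eq_coeff_aeval (fun s => vanishesTo_one_iff.1 (ha s)) f he,
    coeff_subst_eq_coeff_aeval (fun s => vanishesTo_one_iff.1 (hb s)) f he, ← map_sub,
    aeval_truncTotal, aeval_truncTotal, ← Finset.sum_sub_distrib, map_sum]
  refine Finset.sum_eq_zero fun d hd => ?_
  have h1 : j + 1 ≤ d.degree := by
    by_contra h
    exact (degree_lt_of_mem_support_truncTotal hd).2 (hf d (not_le.1 h))
  rw [← smul_sub, MvPowerSeries.coeff_smul, vanishesTo_prod_pow_sub ha hb hab d e (by omega),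
    mul_zero]

omit [Fintype σ]

/-- The `ℓ¹` norm on the polydisc of radius `s` of the part of `f` supported in `S`. -/
noncomputable def partNorm (S : Finset (σ →₀ ℕ)) (s : ℝ) (f : MvPowerSeries σ ℂ) : ℝ :=
  ∑ d ∈ S, ‖coeff d f‖ * s ^ d.degree

variable {S : Finset (σ →₀ ℕ)} {s : ℝ}

theorem partNorm_nonneg (hs : 0 ≤ s) (f : MvPowerSeries σ ℂ) : 0 ≤ partNorm S s f :=
  Finset.sum_nonneg fun _ _ => by positivity

theorem partNorm_congr {f g : MvPowerSeries σ ℂ} (h : ∀ d ∈ S, coeff d f = coeff d g) :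
    partNorm S s f = partNorm S s g :=
  Finset.sum_congr rfl fun d hd => by rw [h d hd]

theorem partNorm_add_le (hs : 0 ≤ s) (f g : MvPowerSeries σ ℂ) :
    partNorm S s (f + g) ≤ partNorm S s f + partNorm S s g := by
  rw [partNorm, partNorm, partNorm, ← Finset.sum_add_distrib]
  refine Finset.sum_le_sum fun d _ => ?_
  rw [map_add, ← add_mul]
  exact mul_le_mul_of_nonneg_right (norm_add_le _ _) (by positivity)

theorem partNorm_sum_le (hs : 0 ≤ s) {ι : Type*} (t : Finset ι) (f : ι → MvPowerSeries σ ℂ) :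
    partNorm S s (∑ i ∈ t, f i) ≤ ∑ i ∈ t, partNorm S s (f i) := by
  classical
  induction t using Finset.induction_on with
  | empty => simp [partNorm]
  | insert i t hi ih =>
    rw [Finset.sum_insert hi, Finset.sum_insert hi]
    exact (partNorm_add_le hs _ _).trans (add_le_add_right ih _)

theorem partNorm_smul (c : ℂ) (f : MvPowerSeries σ ℂ) :
    partNorm S s (c • f) = ‖c‖ * partNorm S s f := by
  rw [partNorm, partNorm, Finset.mul_sum]
  refine Finset.sum_congr rfl fun d _ => ?_
  rw [MvPowerSeries.coeff_smul, norm_mul, mul_assoc]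

/-- Since `S` is a lower set, any splitting of an exponent of `S` has both parts in `S`; different
exponents have disjoint sets of splittings, so the double sum over `S × S` dominates. -/
theorem partNorm_mul_le (hS : IsLowerSet (S : Set (σ →₀ ℕ))) (hs : 0 ≤ s)
    (f g : MvPowerSeries σ ℂ) :
    partNorm S s (f * g) ≤ partNorm S s f * partNorm S s g := by
  classical
  have h1 : ∀ d ∈ S, ‖coeff d (f * g)‖ * s ^ d.degree ≤
      ∑ x ∈ Finset.HasAntidiagonal.antidiagonal d, (‖coeff x.1 f‖ * s ^ x.1.degree) *
        (‖coeff x.2 g‖ * s ^ x.2.degree) := by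
    intro d _
    rw [MvPowerSeries.coeff_mul]
    refine (mul_le_mul_of_nonneg_right (norm_sum_le _ _) (by positivity)).trans (le_of_eq ?_)
    rw [Finset.sum_mul]
    refine Finset.sum_congr rfl fun x hx => ?_
    rw [Finset.HasAntidiagonal.mem_antidiagonal] at hx
    rw [← hx, map_add, pow_add, norm_mul]; ring
  refine (Finset.sum_le_sum h1).trans ?_
  rw [partNorm, partNorm, Finset.sum_mul_sum, ← Finset.sum_product', Finset.sum_sigma']
  have hinj : Set.InjOn (fun x : Σ _ : σ →₀ ℕ, (σ →₀ ℕ) × (σ →₀ ℕ) => x.2)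
      (S.sigma fun d => Finset.HasAntidiagonal.antidiagonal d : Finset _) := by
    rintro ⟨d, x⟩ hx ⟨d', x'⟩ hx' (rfl : x = x')
    simp only [Finset.coe_sigma, Set.mem_sigma_iff, Finset.mem_coe,
      Finset.HasAntidiagonal.mem_antidiagonal] at hx hx'
    rw [← hx.2, ← hx'.2]
  rw [← Finset.sum_image (g := fun x : Σ _ : σ →₀ ℕ, (σ →₀ ℕ) × (σ →₀ ℕ) => x.2)
    (f := fun x => (‖coeff x.1 f‖ * s ^ x.1.degree) * (‖coeff x.2 g‖ * s ^ x.2.degree)) hinj]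
  refine Finset.sum_le_sum_of_subset_of_nonneg ?_ fun _ _ _ => by positivity
  intro x hx
  rw [Finset.mem_image] at hx
  obtain ⟨⟨d, y⟩, hy, rfl⟩ := hx
  rw [Finset.mem_sigma, Finset.HasAntidiagonal.mem_antidiagonal] at hy
  rw [Finset.mem_product]
  have h2 : y.1 + y.2 = d := hy.2
  exact ⟨hS (h2 ▸ le_self_add) hy.1, hS (h2 ▸ le_add_self) hy.1⟩

theorem partNorm_one_le : partNorm S s (1 : MvPowerSeries σ ℂ) ≤ 1 := by
  classical
  have h : ∀ d ∈ S, ‖coeff d (1 : MvPowerSeries σ ℂ)‖ * s ^ d.degree ≤ if d = 0 then 1 else 0 := by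
    intro d _
    rw [MvPowerSeries.coeff_one]
    split_ifs with hd
    · simp [hd]
    · simp
  refine (Finset.sum_le_sum h).trans ?_
  rw [Finset.sum_ite_eq']
  split_ifs <;> norm_num

theorem partNorm_X_le (hs : 0 ≤ s) (t : σ) :
    partNorm S s (MvPowerSeries.X t : MvPowerSeries σ ℂ) ≤ s := by
  classical
  have h : ∀ d ∈ S, ‖coeff d (MvPowerSeries.X t : MvPowerSeries σ ℂ)‖ * s ^ d.degree ≤
      if d = Finsupp.single t 1 then s else 0 := by
    intro d _
    rw [MvPowerSeries.coeff_X]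
    split_ifs with hd
    · simp [hd]
    · simp
  refine (Finset.sum_le_sum h).trans ?_
  rw [Finset.sum_ite_eq']
  split_ifs
  · exact le_rfl
  · exact hs

theorem partNorm_pow_le (hS : IsLowerSet (S : Set (σ →₀ ℕ))) (hs : 0 ≤ s)
    {f : MvPowerSeries σ ℂ} {u : ℝ} (hf : partNorm S s f ≤ u) (k : ℕ) :
    partNorm S s (f ^ k) ≤ u ^ k := by
  have hu := (partNorm_nonneg hs f).trans hf
  induction k with
  | zero => simpa using partNorm_one_le
  | succ k ih =>
    rw [pow_succ, pow_succ]
    exact (partNorm_mul_le hS hs _ _).trans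
      (mul_le_mul ih hf (partNorm_nonneg hs _) (by positivity))

theorem partNorm_prod_le (hS : IsLowerSet (S : Set (σ →₀ ℕ))) (hs : 0 ≤ s) {ι : Type*}
    (t : Finset ι) {f : ι → MvPowerSeries σ ℂ} {u : ι → ℝ}
    (hf : ∀ i ∈ t, partNorm S s (f i) ≤ u i) :
    partNorm S s (∏ i ∈ t, f i) ≤ ∏ i ∈ t, u i := by
  classical
  induction t using Finset.induction_on with
  | empty => simpa using partNorm_one_le
  | insert i t hi ih =>
    rw [Finset.prod_insert hi, Finset.prod_insert hi]
    have h1 := hf i (Finset.mem_insert_self i t)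
    exact (partNorm_mul_le hS hs _ _).trans
      (mul_le_mul h1 (ih fun j hj => hf j (Finset.mem_insert_of_mem hj))
        (partNorm_nonneg hs _) ((partNorm_nonneg hs _).trans h1))

/-- The majorant principle. The finite set `S` sees only a truncation of `f`, so submultiplicativity
bounds a finite sum of monomials and no convergence of the substitution is needed. -/
theorem partNorm_subst_le [Fintype σ] [Finite τ] {S : Finset (τ →₀ ℕ)}
    (hS : IsLowerSet (S : Set (τ →₀ ℕ))) (hs : 0 ≤ s) {a : σ → MvPowerSeries τ ℂ}
    (ha : ∀ t, constantCoeff (a t) = 0) {u : ℝ} (hu : ∀ t, partNorm S s (a t) ≤ u)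
    (hu0 : 0 ≤ u) {f : MvPowerSeries σ ℂ}
    (hf : Summable fun d : σ →₀ ℕ => ‖coeff d f‖ * u ^ d.degree) :
    partNorm S s (MvPowerSeries.subst a f) ≤ ∑' d : σ →₀ ℕ, ‖coeff d f‖ * u ^ d.degree := by
  classical
  obtain ⟨K, hK⟩ : ∃ K : ℕ, ∀ d ∈ S, d.degree < K :=
    ⟨S.sup Finsupp.degree + 1, fun d hd => Nat.lt_succ_of_le (Finset.le_sup hd)⟩
  rw [partNorm_congr fun d hd => coeff_subst_eq_coeff_aeval ha f (hK d hd), aeval_truncTotal]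
  refine (partNorm_sum_le hs _ _).trans ?_
  refine (Finset.sum_le_sum fun d _ => ?_).trans
    (hf.sum_le_tsum (truncTotal K f).support fun _ _ => by positivity)
  rw [partNorm_smul]
  refine mul_le_mul_of_nonneg_left ?_ (norm_nonneg _)
  rw [Finsupp.degree_eq_sum, ← Finset.prod_pow_eq_pow_sum]
  exact partNorm_prod_le hS hs _ fun t _ => partNorm_pow_le hS hs (hu t) _

end Series

/-! ### Conjugation as a ring homomorphism -/

section Conj

variable {n : ℕ}

theorem conjSeries_add (f g : RealSeries n) : conjSeries (f + g) = conjSeries f + conjSeries g := by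
  ext d
  simp [coeff_conjSeries]

theorem conjSeries_sub (f g : RealSeries n) : conjSeries (f - g) = conjSeries f - conjSeries g := by
  ext d
  simp [coeff_conjSeries]

theorem conjSeries_sum {ι : Type*} (s : Finset ι) (f : ι → RealSeries n) :
    conjSeries (∑ i ∈ s, f i) = ∑ i ∈ s, conjSeries (f i) := by
  ext d
  simp [coeff_conjSeries]

theorem conjSeries_conjSeries (f : RealSeries n) : conjSeries (conjSeries f) = f := by
  ext d
  rw [coeff_conjSeries, coeff_conjSeries, mapDomain_swap_swap, Complex.conj_conj]

theorem conjSeries_mul (f g : RealSeries n) : conjSeries (f * g) = conjSeries f * conjSeries g := by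
  classical
  ext d
  rw [coeff_conjSeries, MvPowerSeries.coeff_mul, MvPowerSeries.coeff_mul, map_sum]
  refine Finset.sum_nbij'
    (fun x => (Finsupp.mapDomain Sum.swap x.1, Finsupp.mapDomain Sum.swap x.2))
    (fun x => (Finsupp.mapDomain Sum.swap x.1, Finsupp.mapDomain Sum.swap x.2)) ?_ ?_ ?_ ?_ ?_
  · intro x hx
    rw [Finset.HasAntidiagonal.mem_antidiagonal] at hx ⊢
    rw [← Finsupp.mapDomain_add, hx, mapDomain_swap_swap]
  · intro x hx
    rw [Finset.HasAntidiagonal.mem_antidiagonal] at hx ⊢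
    rw [← Finsupp.mapDomain_add, hx]
  · intro x _
    simp only [mapDomain_swap_swap]
  · intro x _
    simp only [mapDomain_swap_swap]
  · intro x _
    rw [map_mul, coeff_conjSeries, coeff_conjSeries, mapDomain_swap_swap, mapDomain_swap_swap]

theorem conjSeries_X (s : Fin n ⊕ Fin n) :
    conjSeries (MvPowerSeries.X s : RealSeries n) = MvPowerSeries.X s.swap := by
  classical
  ext d
  rw [coeff_conjSeries, MvPowerSeries.coeff_X, MvPowerSeries.coeff_X]
  have : Finsupp.mapDomain Sum.swap d = Finsupp.single s 1 ↔ d = Finsupp.single s.swap 1 := by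
    constructor
    · intro h
      rw [← mapDomain_swap_swap d, h, Finsupp.mapDomain_single]
    · rintro rfl
      rw [Finsupp.mapDomain_single, Sum.swap_swap]
  simp only [this]
  split_ifs <;> simp

theorem VanishesTo.conj {k : ℕ} {f : RealSeries n} (h : VanishesTo k f) :
    VanishesTo k (conjSeries f) := fun e he => by
  rw [coeff_conjSeries, h _ (by rwa [degree_mapDomain_swap]), map_zero]

end Conj

end CRSingular

namespace CRSingular

open MvPowerSeries (truncTotal coeff constantCoeff)

/-! ### Restriction to the quadric -/

section Slice

variable {n : ℕ}

/-- The weight of a monomial in `(z, w)`, where `z` has weight one and `w` has weight two. -/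
noncomputable def hweight (d : Fin n ⊕ Unit →₀ ℕ) : ℕ := d.degree + d (Sum.inr ())

/-- The series `f(z, ⟨z, z̄⟩)`. -/
noncomputable def onQuadric (f : HolSeries n) : RealSeries n := restrictToGraph (quadSeries n) f

/-- The exponents of the restrictions of `z` and `w` to the slice `z̄ₗ = 0`, `l ≠ i`, of the
complexified quadric. -/
noncomputable def baseExp (i : Fin n) : Fin n ⊕ Unit → (Fin n ⊕ Fin n →₀ ℕ) :=
  Sum.elim (fun l => Finsupp.single (Sum.inl l) 1)
    (fun _ => Finsupp.single (Sum.inl i) 1 + Finsupp.single (Sum.inr i) 1)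

/-- The exponent of the restriction of a monomial in `(z, w)` to the slice `z̄ₗ = 0`, `l ≠ i`, of
the complexified quadric. -/
noncomputable def sliceExp (i : Fin n) (d : Fin n ⊕ Unit →₀ ℕ) : Fin n ⊕ Fin n →₀ ℕ :=
  ∑ s, d s • baseExp i s

theorem sliceExp_inl (i : Fin n) (d : Fin n ⊕ Unit →₀ ℕ) (l : Fin n) :
    sliceExp i d (Sum.inl l) = d (Sum.inl l) + if l = i then d (Sum.inr ()) else 0 := by
  classical
  simp [sliceExp, baseExp, Fintype.sum_sum_type, Finsupp.single_apply, eq_comm]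

theorem sliceExp_inr (i : Fin n) (d : Fin n ⊕ Unit →₀ ℕ) (l : Fin n) :
    sliceExp i d (Sum.inr l) = if l = i then d (Sum.inr ()) else 0 := by
  classical
  simp [sliceExp, baseExp, Fintype.sum_sum_type, Finsupp.single_apply, eq_comm]

theorem degree_sliceExp (i : Fin n) (d : Fin n ⊕ Unit →₀ ℕ) :
    (sliceExp i d).degree = hweight d := by
  rw [hweight, Finsupp.degree_eq_sum, Finsupp.degree_eq_sum, Fintype.sum_sum_type,
    Fintype.sum_sum_type]
  simp [sliceExp_inl, sliceExp_inr, Finset.sum_add_distrib, add_assoc]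

/-- The exponent of `z̄ᵢ` recovers the exponent of `w`, and then the others follow. -/
theorem sliceExp_injective (i : Fin n) : Function.Injective (sliceExp i) := by
  intro d d' h
  have hr : d (Sum.inr ()) = d' (Sum.inr ()) := by
    have := DFunLike.congr_fun h (Sum.inr i)
    simpa [sliceExp_inr] using this
  ext (l | l)
  · have := DFunLike.congr_fun h (Sum.inl l)
    simpa [sliceExp_inl, hr] using this
  · exact hr

/-- Congruence of series on the slice `z̄ₗ = 0`, `l ≠ i`. -/
def SliceEq (i : Fin n) (f g : RealSeries n) : Prop :=
  ∀ e : Fin n ⊕ Fin n →₀ ℕ, (∀ l, l ≠ i → e (Sum.inr l) = 0) → coeff e f = coeff e g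

theorem SliceEq.mul {i : Fin n} {f g f' g' : RealSeries n} (h : SliceEq i f g)
    (h' : SliceEq i f' g') : SliceEq i (f * f') (g * g') := by
  classical
  intro e he
  rw [MvPowerSeries.coeff_mul, MvPowerSeries.coeff_mul]
  refine Finset.sum_congr rfl fun x hx => ?_
  rw [Finset.HasAntidiagonal.mem_antidiagonal] at hx
  have hx' : ∀ l, l ≠ i → x.1 (Sum.inr l) = 0 ∧ x.2 (Sum.inr l) = 0 := by
    intro l hl
    have := he l hl
    rw [← hx, Finsupp.add_apply] at this
    omega
  rw [h x.1 fun l hl => (hx' l hl).1, h' x.2 fun l hl => (hx' l hl).2]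

theorem SliceEq.pow_monomial {i : Fin n} {f : RealSeries n} {b : Fin n ⊕ Fin n →₀ ℕ}
    (h : SliceEq i f (MvPowerSeries.monomial b 1)) (k : ℕ) :
    SliceEq i (f ^ k) (MvPowerSeries.monomial (k • b) 1) := by
  induction k with
  | zero =>
    intro e _
    rw [pow_zero, zero_smul]
    rfl
  | succ k ih =>
    have := ih.mul h
    rwa [MvPowerSeries.monomial_mul_monomial, one_mul, ← pow_succ, ← succ_nsmul] at this

theorem SliceEq.prod_monomial {i : Fin n} {ι : Type*} (t : Finset ι) {f : ι → RealSeries n}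
    {b : ι → (Fin n ⊕ Fin n →₀ ℕ)} (h : ∀ s, SliceEq i (f s) (MvPowerSeries.monomial (b s) 1)) :
    SliceEq i (∏ s ∈ t, f s) (MvPowerSeries.monomial (∑ s ∈ t, b s) 1) := by
  classical
  induction t using Finset.induction_on with
  | empty =>
    intro e _
    rw [Finset.prod_empty, Finset.sum_empty]
    rfl
  | insert s t hs ih =>
    have := (h s).mul ih
    rwa [MvPowerSeries.monomial_mul_monomial, one_mul, ← Finset.prod_insert hs,
      ← Finset.sum_insert hs] at this

theorem coeff_X_mul_eq {σ : Type*} [DecidableEq σ] (e : σ →₀ ℕ) (s : σ)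
    (f : MvPowerSeries σ ℂ) :
    coeff e (MvPowerSeries.X s * f) =
      if e s = 0 then 0 else coeff (e - Finsupp.single s 1) f := by
  rw [MvPowerSeries.X_def, MvPowerSeries.coeff_monomial_mul, one_mul]
  by_cases h : e s = 0
  · rw [if_pos h, if_neg]
    rw [Finsupp.single_le_iff]; omega
  · rw [if_neg h, if_pos]
    rw [Finsupp.single_le_iff]; omega

theorem sliceEq_quadSeries (i : Fin n) :
    SliceEq i (quadSeries n) (MvPowerSeries.monomial (baseExp i (Sum.inr ())) 1) := by
  classical
  intro e he
  rw [quadSeries, map_sum, Finset.sum_eq_single i]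
  · rw [MvPowerSeries.X_def, MvPowerSeries.X_def, MvPowerSeries.monomial_mul_monomial, one_mul]
    rfl
  · intro l _ hl
    rw [mul_comm, coeff_X_mul_eq, if_pos (he l hl)]
  · simp

/-- The generators substituted by `onQuadric`. -/
noncomputable def quadGen (n : ℕ) : Fin n ⊕ Unit → RealSeries n :=
  Sum.elim (fun i => MvPowerSeries.X (Sum.inl i)) (fun _ => quadSeries n)

theorem hasSubst_quadGen : MvPowerSeries.HasSubst (quadGen n) :=
  MvPowerSeries.hasSubst_of_constantCoeff_zero (constantCoeff_graph (constantCoeff_quadSeries n))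

theorem onQuadric_eq (f : HolSeries n) :
    onQuadric f = MvPowerSeries.substAlgHom (hasSubst_quadGen (n := n)) f := by
  rw [MvPowerSeries.substAlgHom_apply]; rfl

theorem onQuadric_sub (f g : HolSeries n) : onQuadric (f - g) = onQuadric f - onQuadric g := by
  rw [onQuadric_eq, onQuadric_eq, onQuadric_eq, map_sub]

theorem onQuadric_add (f g : HolSeries n) : onQuadric (f + g) = onQuadric f + onQuadric g := by
  rw [onQuadric_eq, onQuadric_eq, onQuadric_eq, map_add]

theorem onQuadric_X_inl (i : Fin n) :
    onQuadric (MvPowerSeries.X (Sum.inl i)) = MvPowerSeries.X (Sum.inl i) := by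
  rw [onQuadric_eq, MvPowerSeries.substAlgHom_X]; rfl

theorem onQuadric_X_inr (i : Unit) :
    onQuadric (MvPowerSeries.X (Sum.inr i)) = quadSeries n := by
  rw [onQuadric_eq, MvPowerSeries.substAlgHom_X]; rfl

theorem coeff_onQuadric (f : HolSeries n) (e : Fin n ⊕ Fin n →₀ ℕ) :
    coeff e (onQuadric f) =
      ∑ᶠ d : Fin n ⊕ Unit →₀ ℕ, coeff d f * coeff e (∏ s, quadGen n s ^ d s) := by
  rw [onQuadric, restrictToGraph]
  refine (MvPowerSeries.coeff_subst (hasSubst_quadGen (n := n)) f e).trans ?_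
  refine finsum_congr fun d => ?_
  rw [Finsupp.prod_fintype _ _ fun _ => pow_zero _, smul_eq_mul]

theorem coeff_prod_quadGen_of_slice {i : Fin n} {e : Fin n ⊕ Fin n →₀ ℕ}
    (he : ∀ l, l ≠ i → e (Sum.inr l) = 0) (d : Fin n ⊕ Unit →₀ ℕ) [Decidable (e = sliceExp i d)] :
    coeff e (∏ s, quadGen n s ^ d s) = if e = sliceExp i d then 1 else 0 := by
  classical
  have h : ∀ s, SliceEq i (quadGen n s ^ d s) (MvPowerSeries.monomial (d s • baseExp i s) 1) := by
    intro s
    refine SliceEq.pow_monomial ?_ _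
    rcases s with l | l
    · exact fun e _ => rfl
    · exact sliceEq_quadSeries i
  rw [SliceEq.prod_monomial Finset.univ h e he, MvPowerSeries.coeff_monomial, ← sliceExp]
  congr

/-- On the slice `w` becomes the monomial `zᵢ z̄ᵢ`, so distinct monomials in `(z, w)` restrict to
distinct monomials with coefficient one. Nothing mixes, which is why no denominators arise later. -/
theorem coeff_sliceExp_onQuadric (i : Fin n) (d : Fin n ⊕ Unit →₀ ℕ) (f : HolSeries n) :
    coeff (sliceExp i d) (onQuadric f) = coeff d f := by
  classical
  rw [coeff_onQuadric, finsum_eq_single _ d]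
  · rw [coeff_prod_quadGen_of_slice (i := i) (fun l hl => by rw [sliceExp_inr, if_neg hl]),
      if_pos rfl, mul_one]
  · intro d' hd'
    rw [coeff_prod_quadGen_of_slice (i := i) (fun l hl => by rw [sliceExp_inr, if_neg hl]),
      if_neg fun h => hd' (sliceExp_injective i h).symm, mul_zero]

theorem coeff_onQuadric_eq_zero {i : Fin n} {e : Fin n ⊕ Fin n →₀ ℕ}
    (he : ∀ l, l ≠ i → e (Sum.inr l) = 0) (h : ∀ d, e ≠ sliceExp i d) (f : HolSeries n) :
    coeff e (onQuadric f) = 0 := by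
  classical
  rw [coeff_onQuadric]
  refine finsum_eq_zero_of_forall_eq_zero fun d => ?_
  rw [coeff_prod_quadGen_of_slice he, if_neg (h d), mul_zero]

/-- The exponents of `f` have `z̄`-part dominated by their `z`-part. -/
def IsDominated (f : RealSeries n) : Prop :=
  ∀ e, coeff e f ≠ 0 → ∀ l, e (Sum.inr l) ≤ e (Sum.inl l)

theorem IsDominated.mul {f g : RealSeries n} (hf : IsDominated f) (hg : IsDominated g) :
    IsDominated (f * g) := by
  classical
  intro e he l
  rw [MvPowerSeries.coeff_mul] at he
  obtain ⟨x, hx, hx0⟩ := Finset.exists_ne_zero_of_sum_ne_zero he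
  rw [Finset.HasAntidiagonal.mem_antidiagonal] at hx
  rw [← hx]
  exact add_le_add (hf _ (left_ne_zero_of_mul hx0) l) (hg _ (right_ne_zero_of_mul hx0) l)

theorem isDominated_one : IsDominated (1 : RealSeries n) := by
  classical
  intro e he l
  rw [MvPowerSeries.coeff_one] at he
  split_ifs at he with h
  · simp [h]
  · exact absurd rfl he

theorem IsDominated.pow {f : RealSeries n} (hf : IsDominated f) (k : ℕ) :
    IsDominated (f ^ k) := by
  induction k with
  | zero => simpa using isDominated_one
  | succ k ih => rw [pow_succ]; exact ih.mul hf

theorem IsDominated.prod {ι : Type*} (t : Finset ι) {f : ι → RealSeries n}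
    (hf : ∀ s, IsDominated (f s)) : IsDominated (∏ s ∈ t, f s) := by
  classical
  induction t using Finset.induction_on with
  | empty => simpa using isDominated_one
  | insert s t hs ih => rw [Finset.prod_insert hs]; exact (hf s).mul ih

theorem isDominated_quadGen (s : Fin n ⊕ Unit) : IsDominated (quadGen n s) := by
  classical
  rcases s with i | i
  · intro e he l
    change coeff e (MvPowerSeries.X (Sum.inl i)) ≠ 0 at he
    rw [MvPowerSeries.coeff_X] at he
    split_ifs at he with h
    · simp [h]
    · exact absurd rfl he
  · intro e he l
    change coeff e (quadSeries n) ≠ 0 at he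
    rw [quadSeries, map_sum] at he
    obtain ⟨k, _, hk⟩ := Finset.exists_ne_zero_of_sum_ne_zero he
    rw [MvPowerSeries.X_def, MvPowerSeries.X_def, MvPowerSeries.monomial_mul_monomial,
      MvPowerSeries.coeff_monomial] at hk
    split_ifs at hk with h
    · rw [h]; simp [Finsupp.single_apply]
    · exact absurd rfl hk

/-- The property holds for each `zᵢ` and for `∑ zₗ z̄ₗ` and is multiplicative. It separates a
restricted series from the conjugate of one: they share only exponents with equal `z` and `z̄`
parts. -/
theorem isDominated_onQuadric (f : HolSeries n) : IsDominated (onQuadric f) := by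
  intro e he l
  rw [coeff_onQuadric] at he
  obtain ⟨d, hd⟩ : ∃ d, coeff d f * coeff e (∏ s, quadGen n s ^ d s) ≠ 0 := by
    by_contra! h
    exact he (finsum_eq_zero_of_forall_eq_zero h)
  exact IsDominated.prod _ (fun s => (isDominated_quadGen s).pow _) e (right_ne_zero_of_mul hd) l

theorem vanishesTo_quadSeries : VanishesTo 2 (quadSeries n) :=
  VanishesTo.sum fun _ _ => (vanishesTo_X _).mul (vanishesTo_X _)

theorem vanishesTo_onQuadric {k : ℕ} {f : HolSeries n}
    (h : ∀ d, hweight d < k → coeff d f = 0) : VanishesTo k (onQuadric f) := by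
  intro e he
  rw [coeff_onQuadric]
  refine finsum_eq_zero_of_forall_eq_zero fun d => ?_
  by_cases hd : hweight d < k
  · rw [h d hd, zero_mul]
  · have h1 : VanishesTo (∑ s, d s * (Sum.elim (fun _ => 1) (fun _ => 2) s : ℕ))
        (∏ s, quadGen n s ^ d s) := by
      refine VanishesTo.prod fun s _ => VanishesTo.pow ?_ _
      rcases s with l | l
      · exact vanishesTo_X _
      · exact vanishesTo_quadSeries
    have h2 : ∑ s, d s * (Sum.elim (fun _ => 1) (fun _ => 2) s : ℕ) = hweight d := by
      rw [hweight, Finsupp.degree_eq_sum, Fintype.sum_sum_type, Fintype.sum_sum_type]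
      simp; ring
    rw [h2] at h1
    rw [h1 e (by omega), mul_zero]

end Slice

/-! ### The linearised equation -/

section Linear

variable {n : ℕ}

/-- The linearisation `q - ⟨p, z⟩ - ⟨z, p⟩` on the quadric. -/
noncomputable def linPart (p : Fin n → HolSeries n) (q : HolSeries n) : RealSeries n :=
  onQuadric q - ∑ l, MvPowerSeries.X (Sum.inr l) * onQuadric (p l) -
    ∑ l, MvPowerSeries.X (Sum.inl l) * conjSeries (onQuadric (p l))

/-- The two pairings of `p` with `z` are conjugate to each other and cancel. This decouples `q`,
which can then be estimated before `p`. -/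
theorem linPart_sub_conj (p : Fin n → HolSeries n) (q : HolSeries n) :
    linPart p q - conjSeries (linPart p q) = onQuadric q - conjSeries (onQuadric q) := by
  simp only [linPart, conjSeries_sub, conjSeries_sum, conjSeries_mul, conjSeries_X,
    conjSeries_conjSeries, Sum.swap_inl, Sum.swap_inr]
  ring

theorem linPart_sub (p p' : Fin n → HolSeries n) (q q' : HolSeries n) :
    linPart (p - p') (q - q') = linPart p q - linPart p' q' := by
  simp only [linPart, Pi.sub_apply, onQuadric_sub, conjSeries_sub, mul_sub,
    Finset.sum_sub_distrib]
  ring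

/-- The normalisation of infinitesimal maps by infinitesimal automorphisms of the quadric, up to
weight `M`. -/
structure IsNormalized (M : ℕ) (p : Fin n → HolSeries n) (q : HolSeries n) : Prop where
  center : ∀ l m, 2 * m ≤ M → coeff (Finsupp.single (Sum.inr ()) m) (p l) = 0
  hermitian : ∀ i l m, 2 * m + 1 ≤ M →
    coeff (Finsupp.single (Sum.inl l) 1 + Finsupp.single (Sum.inr ()) m) (p i) =
      starRingEnd ℂ
        (coeff (Finsupp.single (Sum.inl i) 1 + Finsupp.single (Sum.inr ()) m) (p l))
  re : ∀ m, 2 * m ≤ M → (coeff (Finsupp.single (Sum.inr ()) m) q).re = 0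

variable {M : ℕ} {p : Fin n → HolSeries n} {q : HolSeries n} {R : RealSeries n}

/-- Taking the slice coefficient of the equation minus its conjugate isolates `coeff d q`, unless
`d` is a pure power of `w`. In that case the conjugate series contributes as well, but the
coefficient is purely imaginary and the two contributions add up to twice it. -/
theorem IsNormalized.norm_coeff_right_le (h : IsNormalized M p q)
    (hR : ∀ e, e.degree ≤ M → coeff e (linPart p q) = coeff e R) (i : Fin n)
    {d : Fin n ⊕ Unit →₀ ℕ} (hd : hweight d ≤ M) :
    ‖coeff d q‖ ≤ ‖coeff (sliceExp i d) R‖ +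
      ‖coeff (Finsupp.mapDomain Sum.swap (sliceExp i d)) R‖ := by
  set e := sliceExp i d with he
  have hdeg : e.degree = hweight d := degree_sliceExp i d
  have h1 := congrArg (coeff e) (linPart_sub_conj p q)
  rw [map_sub, map_sub, coeff_conjSeries, coeff_conjSeries, he, coeff_sliceExp_onQuadric, ← he,
    hR e (by omega), hR _ (by rw [degree_mapDomain_swap]; omega)] at h1
  have h2 : ‖coeff d q‖ ≤ ‖coeff d q -
      starRingEnd ℂ (coeff (Finsupp.mapDomain Sum.swap e) (onQuadric q))‖ := by
    by_cases h0 : coeff (Finsupp.mapDomain Sum.swap e) (onQuadric q) = 0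
    · rw [h0, map_zero, sub_zero]
    · have h3 := isDominated_onQuadric q _ h0
      simp only [mapDomain_swap_apply, Sum.swap_inl, Sum.swap_inr] at h3
      have h4 : ∀ l, d (Sum.inl l) = 0 := by
        intro l
        have := h3 l
        rw [he, sliceExp_inl, sliceExp_inr] at this
        omega
      -- Domination of the swapped exponent leaves only powers of `zᵢ z̄ᵢ`, which conjugation fixes.
      have h5 : Finsupp.mapDomain Sum.swap e = e := by
        ext (l | l) <;> simp [mapDomain_swap_apply, he, sliceExp_inl, sliceExp_inr, h4]
      have h6 : d = Finsupp.single (Sum.inr ()) (d (Sum.inr ())) := by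
        ext (l | l)
        · simp [h4]
        · simp
      have h7 : (coeff d q).re = 0 := by
        rw [h6]
        refine h.re _ ?_
        have : hweight d = d (Sum.inr ()) + d (Sum.inr ()) := by
          rw [hweight, Finsupp.degree_eq_sum, Fintype.sum_sum_type]
          simp [h4]
        omega
      rw [h5, he, coeff_sliceExp_onQuadric]
      have h8 : coeff d q - starRingEnd ℂ (coeff d q) = 2 * coeff d q := by
        apply Complex.ext
        · simp [h7]
        · simp; ring
      rw [h8, norm_mul]
      have := norm_nonneg (coeff d q)
      norm_num
      linarith
  rw [← h1] at h2
  refine h2.trans ((norm_sub_le _ _).trans ?_)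
  rw [RCLike.norm_conj]

/-- The slice exponent multiplied by `z̄ᵢ` singles out `coeff d (p i)` in `⟨p, z⟩`. In `⟨z, p⟩` it
meets only monomials `z w ^ m`, where the Hermitian condition returns the same coefficient with the
same sign, and powers of `w`, which the centre condition removes. So the left side carries `coeff d
(p i)` once or twice. -/
theorem IsNormalized.norm_coeff_left_le (h : IsNormalized M p q)
    (hR : ∀ e, e.degree ≤ M → coeff e (linPart p q) = coeff e R) (i : Fin n)
    {d : Fin n ⊕ Unit →₀ ℕ} (hd : hweight d + 1 ≤ M) :
    ‖coeff d (p i)‖ ≤ ‖coeff (sliceExp i d + Finsupp.single (Sum.inr i) 1) (onQuadric q)‖ +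
      ‖coeff (sliceExp i d + Finsupp.single (Sum.inr i) 1) R‖ := by
  classical
  set m := d (Sum.inr ()) with hm
  have hw : hweight d = ∑ l, d (Sum.inl l) + 2 * m := by
    rw [hweight, Finsupp.degree_eq_sum, Fintype.sum_sum_type]
    simp [← hm]; ring
  by_cases hα : ∀ l, d (Sum.inl l) = 0
  · have h6 : d = Finsupp.single (Sum.inr ()) m := by
      ext (l | l)
      · simp [hα]
      · simp [hm]
    rw [h6, h.center i m (by omega), norm_zero]
    positivity
  push Not at hα
  set e := sliceExp i d + Finsupp.single (Sum.inr i) 1 with he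
  have hel : ∀ l, e (Sum.inl l) = d (Sum.inl l) + if l = i then m else 0 := by
    intro l
    simp [he, sliceExp_inl, hm]
  have her : ∀ l, e (Sum.inr l) = if l = i then m + 1 else 0 := by
    intro l
    rw [he, Finsupp.add_apply, sliceExp_inr, Finsupp.single_apply]
    by_cases hl : l = i
    · simp [hl, hm]
    · have : i ≠ l := fun h => hl h.symm
      simp [hl, this]
  have hdege : e.degree ≤ M := by
    rw [he, map_add, degree_sliceExp, Finsupp.degree_single]; exact hd
  have h1 : coeff e (∑ l, MvPowerSeries.X (Sum.inr l) * onQuadric (p l)) = coeff d (p i) := by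
    rw [map_sum, Finset.sum_eq_single i]
    · rw [coeff_X_mul_eq, her, if_pos rfl, if_neg (Nat.succ_ne_zero _), he, add_tsub_cancel_right,
        coeff_sliceExp_onQuadric]
    · intro l _ hl
      rw [coeff_X_mul_eq, her, if_neg hl, if_pos rfl]
    · simp
  -- Division by `zₗ` and conjugation give an exponent with at most `m + 1` conjugate factors, all
  -- at `i`. Domination then leaves `zᵢ w ^ m` or `w ^ (m + 1)` in `p l`.
  have h2 : ∀ l, coeff e (MvPowerSeries.X (Sum.inl l) * conjSeries (onQuadric (p l))) =
      if d = Finsupp.single (Sum.inl l) 1 + Finsupp.single (Sum.inr ()) m then coeff d (p i)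
      else 0 := by
    intro l
    rw [coeff_X_mul_eq, coeff_conjSeries]
    set g := Finsupp.mapDomain Sum.swap (e - Finsupp.single (Sum.inl l) 1) with hg
    have hgl : ∀ k, g (Sum.inl k) = if k = i then m + 1 else 0 := by
      intro k
      rw [hg, mapDomain_swap_apply, Sum.swap_inl, Finsupp.tsub_apply, her]
      simp
    have hgr : ∀ k, g (Sum.inr k) = (d (Sum.inl k) + if k = i then m else 0) -
        if k = l then 1 else 0 := by
      intro k
      rw [hg, mapDomain_swap_apply, Sum.swap_inr, Finsupp.tsub_apply, hel, Finsupp.single_apply]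
      simp [eq_comm]
    by_cases hdl : d = Finsupp.single (Sum.inl l) 1 + Finsupp.single (Sum.inr ()) m
    · have hdk : ∀ k, d (Sum.inl k) = if k = l then 1 else 0 := by
        intro k
        rw [hdl]
        simp [Finsupp.single_apply, eq_comm]
      have hg' : g = sliceExp i (Finsupp.single (Sum.inl i) 1 + Finsupp.single (Sum.inr ()) m) := by
        ext (k | k)
        · rw [hgl, sliceExp_inl]
          by_cases hk : k = i
          · simp [hk]; ring
          · simp [hk]
        · rw [hgr, hdk, sliceExp_inr]
          by_cases hk : k = i <;> by_cases hk' : k = l <;> simp [hk, hk']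
      have hhw : 2 * m + 1 ≤ M := by
        have : ∑ k, d (Sum.inl k) = 1 := by simp [hdk]
        omega
      rw [if_pos hdl, if_neg, hg', coeff_sliceExp_onQuadric, ← h.hermitian i l m hhw, ← hdl]
      rw [hel, hdk, if_pos rfl]; omega
    · rw [if_neg hdl]
      split_ifs with h0
      · rfl
      rw [map_eq_zero]
      by_contra hne
      have hdom := isDominated_onQuadric _ _ hne
      simp only [hgl, hgr] at hdom
      rw [hel] at h0
      -- the remaining exponents are those of `w ^ (m + 1)`
      have hk0 : ∀ k, k ≠ i → k ≠ l → d (Sum.inl k) = 0 := by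
        intro k hk hk'
        have := hdom k
        simp only [hk, hk', if_false] at this
        omega
      have hdl' : ¬ ((∀ k, k ≠ l → d (Sum.inl k) = 0) ∧ d (Sum.inl l) = 1) := by
        rintro ⟨hk1, hk2⟩
        refine hdl ?_
        ext (k | k)
        · by_cases hk : k = l
          · simp [hk, hk2]
          · have : l ≠ k := fun h => hk h.symm
            simp [hk1 k hk, this]
        · simp [hm]
      have hgi : ∀ k, g (Sum.inr k) = if k = i then m + 1 else 0 := by
        intro k
        rw [hgr]
        have hdi := hdom i
        have hdl2 := hdom l
        simp only [if_true] at hdi hdl2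
        by_cases hil : i = l
        · subst hil
          simp only [if_true] at hdi h0
          by_cases hk : k = i
          · subst hk
            simp only [if_true]
            obtain ⟨k', hk'⟩ := hα
            have : k' = k := by
              by_contra hkk
              exact hk' (hk0 k' hkk hkk)
            subst this
            have h3 : d (Sum.inl k') ≠ 1 := fun h3 => hdl' ⟨fun k hk => hk0 k hk hk, h3⟩
            omega
          · simp [hk, hk0 k hk hk]
        · have hli : ¬ l = i := fun h => hil h.symm
          simp only [hil, hli, if_false] at hdi hdl2 h0
          have hl1 : d (Sum.inl l) = 1 := by omega
          have hi1 : d (Sum.inl i) ≠ 0 := by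
            intro h3
            refine hdl' ⟨fun k hk => ?_, hl1⟩
            by_cases hki : k = i
            · rw [hki, h3]
            · exact hk0 k hki hk
          by_cases hk : k = i
          · subst hk
            simp only [if_true, hil, if_false]
            omega
          · by_cases hkl : k = l
            · subst hkl
              simp [hk, hl1]
            · simp [hk, hkl, hk0 k hk hkl]
      have hg' : g = sliceExp i (Finsupp.single (Sum.inr ()) (m + 1)) := by
        ext (k | k)
        · rw [hgl, sliceExp_inl]
          simp
        · rw [hgi, sliceExp_inr]
          simp
      refine hne ?_
      rw [hg', coeff_sliceExp_onQuadric]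
      refine h.center l (m + 1) ?_
      have h3 : ∑ k, e (Sum.inl k) = (∑ k, d (Sum.inl k)) + m := by
        simp [hel, Finset.sum_add_distrib]
      have h4 : ∑ k, g (Sum.inr k) + 1 = ∑ k, e (Sum.inl k) := by
        have h5 : ∀ k, e (Sum.inl k) = g (Sum.inr k) + if k = l then 1 else 0 := by
          intro k
          rw [hgr, hel]
          by_cases hk : k = l
          · subst hk
            simp only [if_true]; omega
          · simp [hk]
        rw [Finset.sum_congr rfl fun k _ => h5 k, Finset.sum_add_distrib]
        simp
      have h6 : ∑ k, g (Sum.inr k) = m + 1 := by simp [hgi]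
      omega
  have h3 : coeff e (∑ l, MvPowerSeries.X (Sum.inl l) * conjSeries (onQuadric (p l))) = 0 ∨
      coeff e (∑ l, MvPowerSeries.X (Sum.inl l) * conjSeries (onQuadric (p l))) =
        coeff d (p i) := by
    rw [map_sum, Finset.sum_congr rfl fun l _ => h2 l]
    by_cases hex : ∃ l, d = Finsupp.single (Sum.inl l) 1 + Finsupp.single (Sum.inr ()) m
    · obtain ⟨l, hl⟩ := hex
      right
      rw [Finset.sum_eq_single l]
      · rw [if_pos hl]
      · intro k _ hk
        rw [if_neg]
        intro hk'
        have := DFunLike.congr_fun (hl.symm.trans hk') (Sum.inl l)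
        simp [hk] at this
      · simp
    · left
      push Not at hex
      exact Finset.sum_eq_zero fun l _ => if_neg (hex l)
  have h4 := hR e hdege
  rw [linPart, map_sub, map_sub, h1] at h4
  -- The contributions add without cancelling, so the bound holds with constant one in both cases.
  have h5 : ‖coeff d (p i)‖ ≤ ‖coeff e (onQuadric q) - coeff e R‖ := by
    rcases h3 with h3 | h3
    · rw [h3] at h4
      rw [← h4]
      apply le_of_eq
      congr 1; ring
    · rw [h3] at h4
      rw [← h4]
      have : coeff e (onQuadric q) - (coeff e (onQuadric q) - coeff d (p i) - coeff d (p i)) =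
          2 * coeff d (p i) := by ring
      rw [this, norm_mul]
      have := norm_nonneg (coeff d (p i))
      norm_num
      linarith
  exact h5.trans (norm_sub_le _ _)

end Linear

end CRSingular

namespace CRSingular

open MvPowerSeries (truncTotal coeff constantCoeff)

/-! ### Normalised solutions of the mapping equation -/

section NormalSolution

variable {n : ℕ}

/-- The formal map `id + p` restricted to the quadric, together with its conjugate. -/
noncomputable def perturbedGen (p : Fin n → HolSeries n) : Fin n ⊕ Fin n → RealSeries n :=
  Sum.elim (fun l => MvPowerSeries.X (Sum.inl l) + onQuadric (p l))
    (fun l => conjSeries (MvPowerSeries.X (Sum.inl l) + onQuadric (p l)))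

/-- The nonlinear part of the equation for maps from the quadric to `w = ⟨z, z̄⟩ + ε(z, z̄)`. -/
noncomputable def nonlin (ε : RealSeries n) (p : Fin n → HolSeries n) : RealSeries n :=
  ∑ l, onQuadric (p l) * conjSeries (onQuadric (p l)) +
    MvPowerSeries.subst (perturbedGen p) ε

theorem constantCoeff_onQuadric {f : HolSeries n} (h : constantCoeff f = 0) :
    constantCoeff (onQuadric f) = 0 :=
  constantCoeff_restrictToGraph (constantCoeff_quadSeries n) h

theorem constantCoeff_perturbedGen {p : Fin n → HolSeries n} (h : ∀ l, constantCoeff (p l) = 0)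
    (s : Fin n ⊕ Fin n) : constantCoeff (perturbedGen p s) = 0 :=
  constantCoeff_elim_conj (fun l => by simp [constantCoeff_onQuadric (h l)]) s

/-- Expand `⟨z + p, z + p⟩`: the term `⟨z, z⟩` cancels `w`, the cross terms belong to the
linearisation, and `⟨p, p⟩` joins `ε` on the nonlinear side. -/
theorem onQuadric_sub_subst_eq (ε : RealSeries n) {p : Fin n → HolSeries n} (q : HolSeries n)
    (hp : ∀ l, constantCoeff (p l) = 0) :
    onQuadric (MvPowerSeries.X (Sum.inr ()) + q) -
      MvPowerSeries.subst (perturbedGen p) (quadSeries n + ε) = linPart p q - nonlin ε p := by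
  have h := MvPowerSeries.hasSubst_of_constantCoeff_zero (constantCoeff_perturbedGen hp)
  rw [MvPowerSeries.subst_add h, subst_quadSeries (constantCoeff_perturbedGen hp), onQuadric_add,
    onQuadric_X_inr, nonlin, linPart, quadSeries]
  simp only [perturbedGen, Sum.elim_inl, Sum.elim_inr, conjSeries_add, conjSeries_X, Sum.swap_inl,
    add_mul, mul_add, Finset.sum_add_distrib]
  simp only [mul_comm (onQuadric _) (MvPowerSeries.X _)]
  ring

/-- Solutions up to weight `M` of the equation for formal maps `id + (p, q)` from the quadric to
`w = ⟨z, z̄⟩ + ε(z, z̄)`, normalised by the automorphisms of the quadric. -/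
structure IsNormalSolution (ε : RealSeries n) (M : ℕ) (p : Fin n → HolSeries n)
    (q : HolSeries n) : Prop where
  vanish : ∀ l d, hweight d ≤ 1 → coeff d (p l) = 0
  normalized : IsNormalized M p q
  eqn : ∀ e : Fin n ⊕ Fin n →₀ ℕ, e.degree ≤ M → coeff e (linPart p q) = coeff e (nonlin ε p)

theorem IsNormalized.mono {M N : ℕ} {p : Fin n → HolSeries n} {q : HolSeries n}
    (h : IsNormalized M p q) (hN : N ≤ M) : IsNormalized N p q where
  center l m hm := h.center l m (by omega)
  hermitian i l m hm := h.hermitian i l m (by omega)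
  re m hm := h.re m (by omega)

theorem IsNormalized.sub {M : ℕ} {p p' : Fin n → HolSeries n} {q q' : HolSeries n}
    (h : IsNormalized M p q) (h' : IsNormalized M p' q') : IsNormalized M (p - p') (q - q') where
  center l m hm := by rw [Pi.sub_apply, map_sub, h.center l m hm, h'.center l m hm, sub_zero]
  hermitian i l m hm := by
    rw [Pi.sub_apply, Pi.sub_apply, map_sub, map_sub, map_sub, h.hermitian i l m hm,
      h'.hermitian i l m hm]
  re m hm := by rw [map_sub, Complex.sub_re, h.re m hm, h'.re m hm, sub_zero]

theorem hweight_zero : hweight (0 : Fin n ⊕ Unit →₀ ℕ) = 0 := by simp [hweight]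

theorem constantCoeff_of_hweight_le {f : HolSeries n} (h : ∀ d, hweight d ≤ 1 → coeff d f = 0) :
    constantCoeff f = 0 := by
  simpa using h 0 (by rw [hweight_zero]; exact zero_le_one)

theorem vanishesTo_onQuadric_two {f : HolSeries n} (h : ∀ d, hweight d ≤ 1 → coeff d f = 0) :
    VanishesTo 2 (onQuadric f) :=
  vanishesTo_onQuadric fun d hd => h d (by omega)

/-- The equation is triangular in the weight: `⟨p, p⟩` gains two because each factor restricts to
order two, and `ε` gains two because it starts in order three. -/
theorem vanishesTo_nonlin_sub {ε : RealSeries n} (hε : VanishesTo 3 ε) {k : ℕ}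
    {p p' : Fin n → HolSeries n} (hp : ∀ l d, hweight d ≤ 1 → coeff d (p l) = 0)
    (hp' : ∀ l d, hweight d ≤ 1 → coeff d (p' l) = 0)
    (h : ∀ l d, hweight d < k → coeff d (p l) = coeff d (p' l)) :
    VanishesTo (k + 2) (nonlin ε p - nonlin ε p') := by
  have hd : ∀ l, VanishesTo k (onQuadric (p l) - onQuadric (p' l)) := fun l => by
    rw [← onQuadric_sub]
    exact vanishesTo_onQuadric fun d hd => by rw [map_sub, h l d hd, sub_self]
  have h1 : nonlin ε p - nonlin ε p' =
      ∑ l, ((onQuadric (p l) - onQuadric (p' l)) * conjSeries (onQuadric (p l)) +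
        conjSeries (onQuadric (p l) - onQuadric (p' l)) * onQuadric (p' l)) +
      (MvPowerSeries.subst (perturbedGen p) ε - MvPowerSeries.subst (perturbedGen p') ε) := by
    rw [nonlin, nonlin, add_sub_add_comm, ← Finset.sum_sub_distrib]
    congr 1
    refine Finset.sum_congr rfl fun l _ => ?_
    rw [conjSeries_sub]
    ring
  rw [h1]
  refine VanishesTo.add (VanishesTo.sum fun l _ => VanishesTo.add ?_ ?_) ?_
  · exact (hd l).mul (vanishesTo_onQuadric_two (hp l)).conj
  · exact (hd l).conj.mul (vanishesTo_onQuadric_two (hp' l))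
  · refine vanishesTo_subst_sub (fun s => vanishesTo_one_iff.2 <|
        constantCoeff_perturbedGen (fun l => constantCoeff_of_hweight_le (hp l)) s)
      (fun s => vanishesTo_one_iff.2 <|
        constantCoeff_perturbedGen (fun l => constantCoeff_of_hweight_le (hp' l)) s) ?_ hε
    rintro (l | l)
    · simpa [perturbedGen] using hd l
    · simpa [perturbedGen, conjSeries_add, conjSeries_sub] using (hd l).conj

/-- Induction on the weight. If the two `p` agree below weight `k`, the right sides agree below
degree `k + 2`; the coefficient bounds applied to the difference give agreement of the `q` below `k
+ 2` within the range `M`, and then of the `p` in weight `k`. -/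
theorem IsNormalSolution.unique (i : Fin n) {ε : RealSeries n} (hε : VanishesTo 3 ε) {M : ℕ}
    {p p' : Fin n → HolSeries n} {q q' : HolSeries n} (h : IsNormalSolution ε M p q)
    (h' : IsNormalSolution ε M p' q') :
    (∀ l d, hweight d + 1 ≤ M → coeff d (p l) = coeff d (p' l)) ∧
      ∀ d, hweight d ≤ M → coeff d q = coeff d q' := by
  have hR : ∀ e : Fin n ⊕ Fin n →₀ ℕ, e.degree ≤ M →
      coeff e (linPart (p - p') (q - q')) = coeff e (nonlin ε p - nonlin ε p') := fun e he => by
    rw [linPart_sub, map_sub, map_sub, h.eqn e he, h'.eqn e he]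
  have hnorm := h.normalized.sub h'.normalized
  have hq : ∀ k, VanishesTo k (nonlin ε p - nonlin ε p') → ∀ d, hweight d < k → hweight d ≤ M →
      coeff d (q - q') = 0 := by
    intro k hk d hd hdM
    have h1 := hnorm.norm_coeff_right_le hR i hdM
    rw [hk _ (by rwa [degree_sliceExp]), hk _ (by rwa [degree_mapDomain_swap, degree_sliceExp]),
      norm_zero, add_zero] at h1
    exact norm_le_zero_iff.1 h1
  have hp : ∀ k ≤ M, ∀ l d, hweight d < k → coeff d (p l) = coeff d (p' l) := by
    intro k
    induction k with
    | zero => intro _ _ _ hd; omega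
    | succ k ih =>
      intro hk l d hd
      have hv := vanishesTo_nonlin_sub hε h.vanish h'.vanish (ih (by omega))
      have h1 := hnorm.norm_coeff_left_le hR l (d := d) (by omega)
      have hdeg : (sliceExp l d + Finsupp.single (Sum.inr l) 1).degree < k + 2 := by
        rw [map_add, degree_sliceExp, Finsupp.degree_single]; omega
      have hz : VanishesTo (k + 2) (onQuadric (q - q')) :=
        vanishesTo_onQuadric fun d hd => hq _ hv d hd (by omega)
      rw [hv _ hdeg, hz _ hdeg, norm_zero, add_zero, Pi.sub_apply, map_sub] at h1
      exact sub_eq_zero.1 (norm_le_zero_iff.1 h1)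
  refine ⟨fun l d hd => hp M le_rfl l d (by omega), fun d hd => ?_⟩
  have hv := vanishesTo_nonlin_sub hε h.vanish h'.vanish (hp M le_rfl)
  have := hq _ hv d (by omega) hd
  rwa [map_sub, sub_eq_zero] at this

theorem IsNormalSolution.mono {ε : RealSeries n} {M N : ℕ} {p : Fin n → HolSeries n}
    {q : HolSeries n} (h : IsNormalSolution ε M p q) (hN : N ≤ M) : IsNormalSolution ε N p q where
  vanish := h.vanish
  normalized := h.normalized.mono hN
  eqn e he := h.eqn e (he.trans hN)

theorem hweight_single_inr (m : ℕ) :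
    hweight (Finsupp.single (Sum.inr ()) m : Fin n ⊕ Unit →₀ ℕ) = 2 * m := by
  simp [hweight]; ring

theorem hweight_single_inl_add (l : Fin n) (m : ℕ) :
    hweight (Finsupp.single (Sum.inl l) 1 + Finsupp.single (Sum.inr ()) m : Fin n ⊕ Unit →₀ ℕ) =
      2 * m + 1 := by
  simp [hweight]; ring

theorem IsNormalSolution.congr {ε : RealSeries n} (hε : VanishesTo 3 ε) {M : ℕ}
    {p p' : Fin n → HolSeries n} {q q' : HolSeries n} (h : IsNormalSolution ε M p q)
    (hv : ∀ l d, hweight d ≤ 1 → coeff d (p' l) = 0)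
    (hp : ∀ l d, hweight d ≤ M → coeff d (p l) = coeff d (p' l))
    (hq : ∀ d, hweight d ≤ M → coeff d q = coeff d q') : IsNormalSolution ε M p' q' where
  vanish := hv
  normalized :=
    { center := fun l m hm => by
        rw [← hp _ _ (by rwa [hweight_single_inr])]; exact h.normalized.center l m hm
      hermitian := fun i l m hm => by
        rw [← hp _ _ (by rwa [hweight_single_inl_add]), ← hp _ _ (by rwa [hweight_single_inl_add])]
        exact h.normalized.hermitian i l m hm
      re := fun m hm => by
        rw [← hq _ (by rwa [hweight_single_inr])]; exact h.normalized.re m hm }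
  eqn e he := by
    have h1 : VanishesTo (M + 1) (linPart (p - p') (q - q')) := by
      have h2 : ∀ l, VanishesTo (M + 1) (onQuadric ((p - p') l)) := fun l =>
        vanishesTo_onQuadric fun d hd => by
          rw [Pi.sub_apply, map_sub, hp l d (by omega), sub_self]
      refine ((vanishesTo_onQuadric fun d hd => ?_).sub (VanishesTo.sum fun l _ => ?_)).sub
        (VanishesTo.sum fun l _ => ?_)
      · rw [map_sub, hq d (by omega), sub_self]
      · simpa using (vanishesTo_zero _).mul (h2 l)
      · simpa using (vanishesTo_zero _).mul (h2 l).conj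
    have h3 := h1 e (by omega)
    have h4 := vanishesTo_nonlin_sub hε h.vanish hv (k := M + 1)
      (fun l d hd => hp l d (by omega)) e (by omega)
    rw [linPart_sub, map_sub, sub_eq_zero] at h3
    rw [map_sub, sub_eq_zero] at h4
    rw [← h3, ← h4, h.eqn e he]

/-- Normalised solutions of all finite orders come from one formal solution. -/
theorem exists_isNormalSolution_of_forall (i : Fin n) {ε : RealSeries n} (hε : VanishesTo 3 ε)
    (h : ∀ M, ∃ p q, IsNormalSolution ε M p q) :
    ∃ p q, ∀ M, IsNormalSolution ε M p q := by
  choose p q hpq using h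
  -- A solution of order `M` determines `q` up to weight `M` but `p` only below it, whence the shift
  -- by one for `p`.
  refine ⟨fun l d => coeff d (p (hweight d + 1) l), fun d => coeff d (q (hweight d)), fun M => ?_⟩
  refine ((hpq (M + 1)).mono (Nat.le_succ M)).congr hε ?_ ?_ ?_
  · intro l d hd
    exact (hpq _).vanish l d hd
  · intro l d hd
    exact (((hpq (M + 1)).mono (by omega : hweight d + 1 ≤ M + 1)).unique i hε
      (hpq (hweight d + 1))).1 l d le_rfl
  · intro d hd
    exact (((hpq (M + 1)).mono (by omega : hweight d ≤ M + 1)).unique i hε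
      (hpq (hweight d))).2 d le_rfl

end NormalSolution

end CRSingular

namespace CRSingular

open MvPowerSeries (truncTotal coeff constantCoeff)

/-! ### Convergence of normalised solutions -/

section Estimate

variable {n : ℕ}

/-- The exponents of total degree at most `N`. -/
noncomputable def lowDegree (σ : Type*) [Finite σ] (N : ℕ) : Finset (σ →₀ ℕ) :=
  (Finsupp.finite_of_degree_le (σ := σ) N).toFinset

theorem mem_lowDegree {σ : Type*} [Finite σ] {N : ℕ} {d : σ →₀ ℕ} :
    d ∈ lowDegree σ N ↔ d.degree ≤ N := by
  simp [lowDegree]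

/-- The exponents in `(z, w)` of weight at most `N`. -/
noncomputable def lowWeight (n N : ℕ) : Finset (Fin n ⊕ Unit →₀ ℕ) :=
  {d ∈ lowDegree (Fin n ⊕ Unit) N | hweight d ≤ N}

theorem mem_lowWeight {N : ℕ} {d : Fin n ⊕ Unit →₀ ℕ} :
    d ∈ lowWeight n N ↔ hweight d ≤ N := by
  rw [lowWeight, Finset.mem_filter, mem_lowDegree, hweight]
  omega

open Classical in
/-- The exponents in `(z, z̄)` of degree at most `N` with no variable `z̄ₗ`, `l ≠ i`, if `b`
is false and with no variable `zₗ`, `l ≠ i`, if `b` is true. -/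
noncomputable def sliceSet (b : Bool) (i : Fin n) (N : ℕ) : Finset (Fin n ⊕ Fin n →₀ ℕ) :=
  {e ∈ lowDegree (Fin n ⊕ Fin n) N |
    ∀ l, l ≠ i → e (if b then Sum.inl l else Sum.inr l) = 0}

theorem mem_sliceSet {b : Bool} {i : Fin n} {N : ℕ} {e : Fin n ⊕ Fin n →₀ ℕ} :
    e ∈ sliceSet b i N ↔
      e.degree ≤ N ∧ ∀ l, l ≠ i → e (if b then Sum.inl l else Sum.inr l) = 0 := by
  rw [sliceSet, Finset.mem_filter, mem_lowDegree]

theorem isLowerSet_sliceSet (b : Bool) (i : Fin n) (N : ℕ) :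
    IsLowerSet (sliceSet b i N : Set (Fin n ⊕ Fin n →₀ ℕ)) := by
  intro e e' hle he
  rw [Finset.mem_coe, mem_sliceSet] at he ⊢
  refine ⟨(Finsupp.degree_mono hle).trans he.1, fun l hl => ?_⟩
  exact Nat.le_zero.1 ((hle _).trans (he.2 l hl).le)

theorem swap_mem_sliceSet {b : Bool} {i : Fin n} {N : ℕ} {e : Fin n ⊕ Fin n →₀ ℕ} :
    Finsupp.mapDomain Sum.swap e ∈ sliceSet b i N ↔ e ∈ sliceSet (!b) i N := by
  rw [mem_sliceSet, mem_sliceSet, degree_mapDomain_swap]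
  cases b <;> simp [mapDomain_swap_apply]

theorem partNorm_conjSeries (b : Bool) (i : Fin n) (N : ℕ) (s : ℝ) (f : RealSeries n) :
    partNorm (sliceSet b i N) s (conjSeries f) = partNorm (sliceSet (!b) i N) s f := by
  refine Finset.sum_nbij' (Finsupp.mapDomain Sum.swap) (Finsupp.mapDomain Sum.swap) ?_ ?_ ?_ ?_ ?_
  · intro e he
    rw [swap_mem_sliceSet]; simpa using he
  · intro e he
    rwa [swap_mem_sliceSet]
  · exact fun e _ => mapDomain_swap_swap e
  · exact fun e _ => mapDomain_swap_swap e
  · intro e _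
    rw [coeff_conjSeries, RCLike.norm_conj, degree_mapDomain_swap]

/-- The partial weighted norm of a series in `(z, w)`. -/
noncomputable def weightNorm (N : ℕ) (s : ℝ) (f : HolSeries n) : ℝ :=
  ∑ d ∈ lowWeight n N, ‖coeff d f‖ * s ^ hweight d

theorem weightNorm_nonneg {s : ℝ} (hs : 0 ≤ s) (N : ℕ) (f : HolSeries n) :
    0 ≤ weightNorm N s f :=
  Finset.sum_nonneg fun _ _ => by positivity

theorem partNorm_onQuadric_false (i : Fin n) (N : ℕ) (s : ℝ) (f : HolSeries n) :
    partNorm (sliceSet false i N) s (onQuadric f) = weightNorm N s f := by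
  refine (Finset.sum_of_injOn (sliceExp i) (sliceExp_injective i).injOn ?_ ?_ ?_).symm
  · intro d hd
    rw [Finset.mem_coe, mem_lowWeight] at hd
    rw [Finset.mem_coe, mem_sliceSet, degree_sliceExp]
    exact ⟨hd, fun l hl => by simp [sliceExp_inr, hl]⟩
  · intro e he hne
    rw [mem_sliceSet] at he
    rw [coeff_onQuadric_eq_zero (i := i) (by simpa using he.2), norm_zero, zero_mul]
    rintro d rfl
    refine hne ⟨d, ?_, rfl⟩
    rw [Finset.mem_coe, mem_lowWeight, ← degree_sliceExp i]
    exact he.1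
  · intro d _
    rw [coeff_sliceExp_onQuadric, degree_sliceExp]

/-- On the conjugate slice, a dominated exponent without `zₗ` has no `z̄ₗ` either, so it already
belongs to the other slice, where the norm is the weighted norm of `f`. -/
theorem partNorm_onQuadric_le {s : ℝ} (hs : 0 ≤ s) (b : Bool) (i : Fin n) (N : ℕ)
    (f : HolSeries n) :
    partNorm (sliceSet b i N) s (onQuadric f) ≤ weightNorm N s f := by
  cases b
  · exact (partNorm_onQuadric_false i N s f).le
  rw [← partNorm_onQuadric_false i, partNorm, ← Finset.sum_filter_ne_zero]
  refine Finset.sum_le_sum_of_subset_of_nonneg ?_ fun _ _ _ => by positivity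
  intro e he
  rw [Finset.mem_filter, mem_sliceSet] at he
  have h0 : coeff e (onQuadric f) ≠ 0 := fun h => he.2 (by rw [h, norm_zero, zero_mul])
  rw [mem_sliceSet]
  refine ⟨he.1.1, fun l hl => ?_⟩
  have h1 := isDominated_onQuadric f e h0 l
  have h2 := he.1.2 l hl
  simp only [if_true] at h2
  rw [h2] at h1
  simpa using h1

theorem partNorm_conj_onQuadric_le {s : ℝ} (hs : 0 ≤ s) (b : Bool) (i : Fin n) (N : ℕ)
    (f : HolSeries n) :
    partNorm (sliceSet b i N) s (conjSeries (onQuadric f)) ≤ weightNorm N s f := by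
  rw [partNorm_conjSeries]
  exact partNorm_onQuadric_le hs _ i N f

theorem tsum_norm_coeff_mul_pow_le {σ : Type*} {ε : MvPowerSeries σ ℂ}
    (hε : VanishesTo 3 ε) {ρ u : ℝ} (hρ : 0 < ρ) (hu : 0 ≤ u) (huρ : u ≤ ρ)
    (hs : Summable fun d : σ →₀ ℕ => ‖coeff d ε‖ * ρ ^ d.degree) :
    (Summable fun d : σ →₀ ℕ => ‖coeff d ε‖ * u ^ d.degree) ∧
      ∑' d : σ →₀ ℕ, ‖coeff d ε‖ * u ^ d.degree ≤
        (u / ρ) ^ 3 * ∑' d : σ →₀ ℕ, ‖coeff d ε‖ * ρ ^ d.degree := by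
  have h1 : ∀ d : σ →₀ ℕ, ‖coeff d ε‖ * u ^ d.degree ≤
      (u / ρ) ^ 3 * (‖coeff d ε‖ * ρ ^ d.degree) := by
    intro d
    by_cases hd : d.degree < 3
    · rw [hε d hd, norm_zero, zero_mul, zero_mul, mul_zero]
    · obtain ⟨k, hk⟩ := Nat.exists_eq_add_of_le (not_lt.1 hd)
      have h2 : (u / ρ) ^ 3 * (‖coeff d ε‖ * ρ ^ d.degree) = ‖coeff d ε‖ * (u ^ 3 * ρ ^ k) := by
        rw [hk, pow_add]
        field_simp
      rw [h2, hk, pow_add]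
      gcongr
  have h3 : Summable fun d : σ →₀ ℕ => ‖coeff d ε‖ * u ^ d.degree :=
    (hs.mul_left _).of_nonneg_of_le (fun _ => by positivity) h1
  refine ⟨h3, ?_⟩
  rw [← tsum_mul_left]
  exact h3.tsum_le_tsum h1 (hs.mul_left _)

/-- The product `⟨p, p⟩` contributes `t ^ 2`. Each argument substituted into `ε` has norm at most `s
+ t`, and the order three of `ε` yields the cube of `(s + t) / ρ`. -/
theorem partNorm_nonlin_le {ε : RealSeries n} (hε : VanishesTo 3 ε) {ρ s : ℝ} (hρ : 0 < ρ)
    (hs : 0 ≤ s) (hsum : Summable fun d : Fin n ⊕ Fin n →₀ ℕ => ‖coeff d ε‖ * ρ ^ d.degree)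
    (b : Bool) (i : Fin n) (N : ℕ) {p : Fin n → HolSeries n}
    (hp : ∀ l, constantCoeff (p l) = 0) {t : ℝ} (ht : ∑ l, weightNorm N s (p l) ≤ t)
    (htρ : s + t ≤ ρ) :
    partNorm (sliceSet b i N) s (nonlin ε p) ≤
      t ^ 2 + ((s + t) / ρ) ^ 3 * ∑' d : Fin n ⊕ Fin n →₀ ℕ, ‖coeff d ε‖ * ρ ^ d.degree := by
  have hl : ∀ l, weightNorm N s (p l) ≤ t := fun l =>
    (Finset.single_le_sum (f := fun l => weightNorm N s (p l))
      (fun l _ => weightNorm_nonneg hs N (p l)) (Finset.mem_univ l)).trans ht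
  have ht0 : 0 ≤ t := (weightNorm_nonneg hs N _).trans (hl i)
  have hS := isLowerSet_sliceSet b i N
  refine (partNorm_add_le hs _ _).trans (add_le_add ?_ ?_)
  · refine (partNorm_sum_le hs _ _).trans ?_
    calc ∑ l, partNorm (sliceSet b i N) s (onQuadric (p l) * conjSeries (onQuadric (p l)))
        ≤ ∑ l, weightNorm N s (p l) * t := by
          refine Finset.sum_le_sum fun l _ => (partNorm_mul_le hS hs _ _).trans ?_
          exact mul_le_mul (partNorm_onQuadric_le hs b i N _)
            ((partNorm_conj_onQuadric_le hs b i N _).trans (hl l)) (partNorm_nonneg hs _)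
            (weightNorm_nonneg hs N _)
      _ ≤ t ^ 2 := by
          rw [← Finset.sum_mul, sq]
          exact mul_le_mul_of_nonneg_right ht ht0
  · obtain ⟨h1, h2⟩ := tsum_norm_coeff_mul_pow_le hε hρ (add_nonneg hs ht0) htρ hsum
    refine (partNorm_subst_le hS hs (constantCoeff_perturbedGen hp) ?_ (add_nonneg hs ht0)
      h1).trans h2
    rintro (l | l)
    · exact (partNorm_add_le hs _ _).trans
        (add_le_add (partNorm_X_le hs _) ((partNorm_onQuadric_le hs b i N _).trans (hl l)))
    · simp only [perturbedGen, Sum.elim_inr, conjSeries_add, conjSeries_X]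
      exact (partNorm_add_le hs _ _).trans
        (add_le_add (partNorm_X_le hs _) ((partNorm_conj_onQuadric_le hs b i N _).trans (hl l)))

/-- Terms of weight at most `N`. -/
noncomputable def weightTrunc (N : ℕ) (f : HolSeries n) : HolSeries n :=
  fun d => if hweight d ≤ N then coeff d f else 0

theorem coeff_weightTrunc (N : ℕ) (f : HolSeries n) (d : Fin n ⊕ Unit →₀ ℕ) :
    coeff d (weightTrunc N f) = if hweight d ≤ N then coeff d f else 0 := rfl

theorem weightNorm_weightTrunc {N K : ℕ} (hN : N ≤ K) (s : ℝ) (f : HolSeries n) :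
    weightNorm K s (weightTrunc N f) = weightNorm N s f := by
  symm
  refine Finset.sum_subset_zero_on_sdiff ?_ ?_ ?_
  · intro d hd
    rw [mem_lowWeight] at *
    omega
  · intro d hd
    rw [Finset.mem_sdiff, mem_lowWeight, mem_lowWeight] at hd
    rw [coeff_weightTrunc, if_neg hd.2, norm_zero, zero_mul]
  · intro d hd
    rw [mem_lowWeight] at hd
    rw [coeff_weightTrunc, if_pos hd]

variable {ε : RealSeries n} {p : Fin n → HolSeries n} {q : HolSeries n} {ρ s t : ℝ} {N : ℕ}

/-- Replacing `p` by its part of weight at most `N` does not change the nonlinear term up to degree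
`N + 2`. Control of `p` thus reaches two degrees further on the right side, and this drives the
bootstrap. -/
theorem IsNormalSolution.partNorm_nonlin_le (hε : VanishesTo 3 ε)
    (h : IsNormalSolution ε (N + 2) p q) (hρ : 0 < ρ) (hs : 0 ≤ s)
    (hsum : Summable fun d : Fin n ⊕ Fin n →₀ ℕ => ‖coeff d ε‖ * ρ ^ d.degree)
    (ht : ∑ l, weightNorm N s (p l) ≤ t) (htρ : s + t ≤ ρ) (b : Bool) (i : Fin n) :
    partNorm (sliceSet b i (N + 2)) s (nonlin ε p) ≤
      t ^ 2 + ((s + t) / ρ) ^ 3 * ∑' d : Fin n ⊕ Fin n →₀ ℕ, ‖coeff d ε‖ * ρ ^ d.degree := by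
  have hv : ∀ l d, hweight d ≤ 1 → coeff d (weightTrunc N (p l)) = 0 := by
    intro l d hd
    rw [coeff_weightTrunc, h.vanish l d hd, ite_self]
  have h1 : VanishesTo (N + 3) (nonlin ε p - nonlin ε fun l => weightTrunc N (p l)) :=
    vanishesTo_nonlin_sub (k := N + 1) hε h.vanish hv fun l d hd => by
      rw [coeff_weightTrunc, if_pos (by omega)]
  rw [partNorm_congr (g := nonlin ε fun l => weightTrunc N (p l))]
  · refine CRSingular.partNorm_nonlin_le hε hρ hs hsum b i _
      (fun l => constantCoeff_of_hweight_le (hv l)) ?_ htρ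
    simpa only [weightNorm_weightTrunc (Nat.le_add_right N 2)] using ht
  · intro e he
    rw [mem_sliceSet] at he
    have := h1 e (by omega)
    rwa [map_sub, sub_eq_zero] at this

/-- Each coefficient of `q` costs one coefficient of the right side on the slice and one on the
conjugate slice, each used once; hence the factor two. -/
theorem IsNormalSolution.weightNorm_right_le (h : IsNormalSolution ε N p q) (hs : 0 ≤ s)
    (i : Fin n) {B : ℝ} (hB : ∀ b, partNorm (sliceSet b i N) s (nonlin ε p) ≤ B) :
    weightNorm N s q ≤ 2 * B := by
  have hinj : ∀ (b : Bool) (g : (Fin n ⊕ Unit →₀ ℕ) → (Fin n ⊕ Fin n →₀ ℕ)),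
      Function.Injective g → (∀ d, (g d).degree = hweight d) →
      (∀ d, hweight d ≤ N → g d ∈ sliceSet b i N) →
      ∑ d ∈ lowWeight n N, ‖coeff (g d) (nonlin ε p)‖ * s ^ hweight d ≤ B := by
    classical
    intro b g hg hdeg hmem
    refine le_trans ?_ (hB b)
    have : ∑ d ∈ lowWeight n N, ‖coeff (g d) (nonlin ε p)‖ * s ^ hweight d =
        ∑ e ∈ (lowWeight n N).image g, ‖coeff e (nonlin ε p)‖ * s ^ e.degree := by
      rw [Finset.sum_image hg.injOn]
      exact Finset.sum_congr rfl fun d _ => by rw [hdeg]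
    rw [this]
    refine Finset.sum_le_sum_of_subset_of_nonneg ?_ fun _ _ _ => by positivity
    intro e he
    obtain ⟨d, hd, rfl⟩ := Finset.mem_image.1 he
    exact hmem d (mem_lowWeight.1 hd)
  have h1 := hinj false (sliceExp i) (sliceExp_injective i) (degree_sliceExp i) fun d hd => by
    rw [mem_sliceSet, degree_sliceExp]
    exact ⟨hd, fun l hl => by simp [sliceExp_inr, hl]⟩
  have h2 := hinj true (fun d => Finsupp.mapDomain Sum.swap (sliceExp i d))
    (fun d d' hd => sliceExp_injective i (by
      have := congrArg (Finsupp.mapDomain Sum.swap) hd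
      rwa [mapDomain_swap_swap, mapDomain_swap_swap] at this))
    (fun d => by rw [degree_mapDomain_swap, degree_sliceExp]) fun d hd => by
      rw [swap_mem_sliceSet, mem_sliceSet, degree_sliceExp]
      exact ⟨hd, fun l hl => by simp [sliceExp_inr, hl]⟩
  calc weightNorm N s q ≤ ∑ d ∈ lowWeight n N, (‖coeff (sliceExp i d) (nonlin ε p)‖ *
        s ^ hweight d + ‖coeff (Finsupp.mapDomain Sum.swap (sliceExp i d)) (nonlin ε p)‖ *
        s ^ hweight d) := by
        refine Finset.sum_le_sum fun d hd => ?_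
        rw [← add_mul]
        exact mul_le_mul_of_nonneg_right
          (h.normalized.norm_coeff_right_le h.eqn i (mem_lowWeight.1 hd)) (by positivity)
    _ ≤ 2 * B := by
        rw [Finset.sum_add_distrib]
        linarith

/-- The extra factor `z̄ᵢ` in the exponent produces the factor `s`. The constant is `2B` from `q`
plus `B` from the right side. -/
theorem IsNormalSolution.weightNorm_left_le (h : IsNormalSolution ε (N + 1) p q) (hs : 0 ≤ s)
    (i : Fin n) {B : ℝ} (hB : ∀ b, partNorm (sliceSet b i (N + 1)) s (nonlin ε p) ≤ B) :
    s * weightNorm N s (p i) ≤ 3 * B := by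
  classical
  set g : (Fin n ⊕ Unit →₀ ℕ) → (Fin n ⊕ Fin n →₀ ℕ) := fun d =>
    sliceExp i d + Finsupp.single (Sum.inr i) 1 with hg
  have hginj : Function.Injective g := fun d d' hd => sliceExp_injective i (add_right_cancel hd)
  have hdeg : ∀ d, (g d).degree = hweight d + 1 := fun d => by
    rw [hg, map_add, degree_sliceExp, Finsupp.degree_single]
  have key : ∀ f : RealSeries n, ∑ d ∈ lowWeight n N, ‖coeff (g d) f‖ * s ^ (hweight d + 1) ≤
      partNorm (sliceSet false i (N + 1)) s f := by
    intro f
    have : ∑ d ∈ lowWeight n N, ‖coeff (g d) f‖ * s ^ (hweight d + 1) =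
        ∑ e ∈ (lowWeight n N).image g, ‖coeff e f‖ * s ^ e.degree := by
      rw [Finset.sum_image hginj.injOn]
      exact Finset.sum_congr rfl fun d _ => by rw [hdeg]
    rw [this]
    refine Finset.sum_le_sum_of_subset_of_nonneg ?_ fun _ _ _ => by positivity
    intro e he
    obtain ⟨d, hd, rfl⟩ := Finset.mem_image.1 he
    rw [mem_lowWeight] at hd
    rw [mem_sliceSet, hdeg]
    exact ⟨by omega, fun l hl => by simp [hg, sliceExp_inr, hl]⟩
  calc s * weightNorm N s (p i)
      = ∑ d ∈ lowWeight n N, ‖coeff d (p i)‖ * s ^ (hweight d + 1) := by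
        rw [weightNorm, Finset.mul_sum]
        exact Finset.sum_congr rfl fun d _ => by ring
    _ ≤ ∑ d ∈ lowWeight n N, (‖coeff (g d) (onQuadric q)‖ * s ^ (hweight d + 1) +
          ‖coeff (g d) (nonlin ε p)‖ * s ^ (hweight d + 1)) := by
        refine Finset.sum_le_sum fun d hd => ?_
        rw [← add_mul]
        refine mul_le_mul_of_nonneg_right
          (h.normalized.norm_coeff_left_le h.eqn i ?_) (by positivity)
        have := mem_lowWeight.1 hd
        omega
    _ ≤ weightNorm (N + 1) s q + B := by
        rw [Finset.sum_add_distrib]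
        refine add_le_add ((key _).trans (partNorm_onQuadric_le hs _ i _ q)) ((key _).trans (hB _))
    _ ≤ 3 * B := by
        have := h.weightNorm_right_le hs i hB
        linarith

theorem summable_of_weightNorm_le (hs : 0 ≤ s) {f : HolSeries n} {C : ℝ}
    (h : ∀ N, weightNorm N s f ≤ C) :
    Summable fun d : Fin n ⊕ Unit →₀ ℕ => ‖coeff d f‖ * s ^ hweight d := by
  refine summable_of_sum_le (c := C) (fun d => by positivity) fun u => ?_
  refine le_trans ?_ (h (u.sup hweight))
  refine Finset.sum_le_sum_of_subset_of_nonneg ?_ fun _ _ _ => by positivity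
  intro d hd
  rw [mem_lowWeight]
  exact Finset.le_sup (f := hweight) hd

/-- A normalised formal solution converges if the right-hand side converges. -/
theorem exists_summable_of_isNormalSolution (i : Fin n) (hε : VanishesTo 3 ε)
    (h : ∀ M, IsNormalSolution ε M p q) (hρ : 0 < ρ)
    (hsum : Summable fun d : Fin n ⊕ Fin n →₀ ℕ => ‖coeff d ε‖ * ρ ^ d.degree) :
    ∃ s > 0, (∀ l, Summable fun d : Fin n ⊕ Unit →₀ ℕ => ‖coeff d (p l)‖ * s ^ hweight d) ∧
      Summable fun d : Fin n ⊕ Unit →₀ ℕ => ‖coeff d q‖ * s ^ hweight d := by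
  set A := ∑' d : Fin n ⊕ Fin n →₀ ℕ, ‖coeff d ε‖ * ρ ^ d.degree with hA
  have hA0 : 0 ≤ A := tsum_nonneg fun _ => by positivity
  -- The invariant of the induction is `∑ ‖p l‖ ≤ κ s`. This `κ` makes the quadratic contribution `3
  -- (n + 1) (κ s)²` equal to half of the admissible `κ s²`.
  set κ : ℝ := 1 / (6 * (n + 1)) with hκ
  have hκ0 : 0 < κ := by positivity
  have hn0 : (0 : ℝ) ≤ n := Nat.cast_nonneg n
  have hκn : 6 * (n + 1) * κ = 1 := by rw [hκ]; field_simp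
  have hκ1 : κ ≤ 1 := by nlinarith
  -- The first bound keeps `s + κ s ≤ ρ`. The second makes the cubic contribution `3 (n + 1) (2 s /
  -- ρ)³ A` at most the other half of `κ s²`; `A + 1` avoids dividing by zero.
  set s : ℝ := min (ρ / 2) (κ * ρ ^ 3 / (48 * (n + 1) * (A + 1))) with hsdef
  have hs0 : 0 < s := by
    rw [hsdef]; exact lt_min (by positivity) (by positivity)
  have hs1 : s ≤ ρ / 2 := min_le_left _ _
  have hs2 : 48 * (n + 1) * (A + 1) * s ≤ κ * ρ ^ 3 := by
    have := min_le_right (ρ / 2) (κ * ρ ^ 3 / (48 * (n + 1) * (A + 1)))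
    rw [← hsdef, le_div_iff₀ (by positivity)] at this
    linarith
  have hκs : κ * s ≤ s := by nlinarith
  have hsρ : s + κ * s ≤ ρ := by linarith
  have hB : ∀ N, ∑ l, weightNorm N s (p l) ≤ κ * s → ∀ b i,
      partNorm (sliceSet b i (N + 2)) s (nonlin ε p) ≤
        (κ * s) ^ 2 + ((s + κ * s) / ρ) ^ 3 * A :=
    fun N hN b i => (h (N + 2)).partNorm_nonlin_le hε hρ hs0.le hsum hN hsρ b i
  have hC : 3 * n * ((κ * s) ^ 2 + ((s + κ * s) / ρ) ^ 3 * A) ≤ κ * s * s := by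
    have h1 : ((s + κ * s) / ρ) ^ 3 ≤ (2 * s / ρ) ^ 3 := by
      gcongr
      linarith
    have h2 : (2 * s / ρ) ^ 3 * A * (6 * (n + 1)) ≤ κ * s ^ 2 := by
      have h3 : (2 * s / ρ) ^ 3 * A * (6 * (n + 1)) =
          (48 * (n + 1) * A * s) * s ^ 2 / ρ ^ 3 := by
        field_simp; ring
      rw [h3, div_le_iff₀ (by positivity)]
      have h4 : 48 * (n + 1) * A * s ≤ κ * ρ ^ 3 := by
        refine le_trans ?_ hs2
        gcongr
        linarith
      nlinarith [mul_le_mul_of_nonneg_right h4 (sq_nonneg s)]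
    have h5 : 6 * (n + 1) * (κ * s) ^ 2 = κ * s ^ 2 := by
      calc 6 * (n + 1) * (κ * s) ^ 2 = (6 * (n + 1) * κ) * κ * s ^ 2 := by ring
        _ = κ * s ^ 2 := by rw [hκn, one_mul]
    have h6 : (κ * s) ^ 2 + ((s + κ * s) / ρ) ^ 3 * A ≤
        (κ * s) ^ 2 + (2 * s / ρ) ^ 3 * A := by gcongr
    have h7 : 0 ≤ (κ * s) ^ 2 + (2 * s / ρ) ^ 3 * A := by positivity
    calc 3 * n * ((κ * s) ^ 2 + ((s + κ * s) / ρ) ^ 3 * A)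
        ≤ 3 * (n + 1) * ((κ * s) ^ 2 + (2 * s / ρ) ^ 3 * A) := by
          refine mul_le_mul ?_ h6 (by positivity) (by positivity)
          linarith
      _ ≤ κ * s * s := by nlinarith
  -- The bound at weight `N` controls the right side up to degree `N + 2`, which controls `p` at
  -- weight `N + 1` after division by `s`.
  have ht : ∀ N, ∑ l, weightNorm N s (p l) ≤ κ * s := by
    intro N
    induction N with
    | zero =>
      have : ∀ l, weightNorm 0 s (p l) = 0 := fun l => Finset.sum_eq_zero fun d hd => by
        rw [mem_lowWeight] at hd
        rw [(h 0).vanish l d (by omega), norm_zero, zero_mul]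
      simp only [this, Finset.sum_const_zero]
      positivity
    | succ N ih =>
      have h1 : s * ∑ l, weightNorm (N + 1) s (p l) ≤
          3 * n * ((κ * s) ^ 2 + ((s + κ * s) / ρ) ^ 3 * A) := by
        rw [Finset.mul_sum]
        calc ∑ l, s * weightNorm (N + 1) s (p l)
            ≤ ∑ _l : Fin n, 3 * ((κ * s) ^ 2 + ((s + κ * s) / ρ) ^ 3 * A) :=
              Finset.sum_le_sum fun l _ =>
                (h (N + 1 + 1)).weightNorm_left_le hs0.le l fun b => hB N ih b l
          _ = _ := by
              rw [Finset.sum_const, Finset.card_univ, Fintype.card_fin, nsmul_eq_mul]; ring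
      have h2 := h1.trans hC
      rw [mul_comm] at h2
      exact le_of_mul_le_mul_right h2 hs0
  refine ⟨s, hs0, fun l => summable_of_weightNorm_le hs0.le (C := κ * s) fun N => ?_,
    summable_of_weightNorm_le hs0.le
      (C := 2 * ((κ * s) ^ 2 + ((s + κ * s) / ρ) ^ 3 * A)) fun N => ?_⟩
  · exact (Finset.single_le_sum (f := fun l => weightNorm N s (p l))
      (fun l _ => weightNorm_nonneg hs0.le N (p l)) (Finset.mem_univ l)).trans (ht N)
  · refine le_trans ?_ ((h (N + 2)).weightNorm_right_le hs0.le i fun b => hB N (ht N) b i)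
    refine Finset.sum_le_sum_of_subset_of_nonneg ?_ fun _ _ _ => by positivity
    intro d hd
    rw [mem_lowWeight] at *
    omega

end Estimate

end CRSingular

namespace CRSingular

open MvPowerSeries (truncTotal coeff constantCoeff)

/-! ### Analytic maps from the quadric to a graph up to finite order -/

section ApproxMap

variable {n : ℕ}

/-- The point of the quadric above `z`. -/
noncomputable def quadPoint (z : ZSpace n) : Ambient n := (z, ((‖z‖ ^ 2 : ℝ) : ℂ))

/-- A germ of an analytic map sending the quadric to the graph `w = Φ(z)` up to order `N`. -/
structure IsApproxMap (Φ : ZSpace n → ℂ) (N : ℕ) (h : Ambient n → Ambient n) : Prop where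
  analyticAt : AnalyticAt ℂ h 0
  map_zero : h 0 = 0
  isBigO : (fun z => (h (quadPoint z)).2 - Φ (h (quadPoint z)).1) =O[𝓝 0] fun z => ‖z‖ ^ N

theorem isBigO_norm_sq {E : Type*} [NormedAddCommGroup E] :
    (fun z : E => ‖z‖ ^ 2) =O[𝓝 0] fun z => ‖z‖ := by
  simpa using isBigO_norm_pow_le (E := E) one_le_two

theorem isBigO_normSq : (fun z : ZSpace n => ((‖z‖ ^ 2 : ℝ) : ℂ)) =O[𝓝 0] fun z => ‖z‖ ^ 2 :=
  IsBigO.of_bound 1 (Eventually.of_forall fun z => by simp)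

theorem isBigO_quadPoint : (quadPoint (n := n)) =O[𝓝 0] fun z => ‖z‖ :=
  isBigO_graph (isBigO_normSq.trans isBigO_norm_sq)

theorem tendsto_quadPoint : Tendsto (quadPoint (n := n)) (𝓝 0) (𝓝 0) :=
  tendsto_zero_of_isBigO_norm isBigO_quadPoint

theorem _root_.AnalyticAt.isBigO_norm {E F : Type*} [NormedAddCommGroup E] [NormedSpace ℂ E]
    [NormedAddCommGroup F] [NormedSpace ℂ F] {h : E → F} (hh : AnalyticAt ℂ h 0) (h0 : h 0 = 0) :
    h =O[𝓝 0] fun x => ‖x‖ := by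
  simpa [h0] using hh.differentiableAt.hasFDerivAt.isBigO_sub.norm_right

theorem holCoord_sum_smul (v : Fin n ⊕ Unit → ℂ) (s : Fin n ⊕ Unit) :
    holCoord (∑ t, v t • holBasis t : Ambient n) s = v s := by
  rcases s with i | i
  · simp [holCoord, holBasis, Prod.fst_sum, Pi.single_apply]
  · simp [holCoord, holBasis, Prod.snd_sum]

theorem holCoord_ext {x y : Ambient n} (h : ∀ s, holCoord x s = holCoord y s) : x = y := by
  rw [← sum_holCoord_smul x, ← sum_holCoord_smul y]
  simp only [h]

theorem analyticAt_eval (p : MvPolynomial (Fin n ⊕ Unit) ℂ) (x : Ambient n) :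
    AnalyticAt ℂ (fun x => MvPolynomial.eval (holCoord x) p) x := by
  simp only [MvPolynomial.eval_eq']
  refine Finset.analyticAt_fun_sum _ fun d _ => analyticAt_const.mul ?_
  refine Finset.analyticAt_fun_prod _ fun s _ => AnalyticAt.pow ?_ _
  exact ((holCoordCLM s).analyticAt x).congr (Eventually.of_forall fun y => holCoordCLM_apply s y)

theorem eq_zero_of_isBigO_sq {E F : Type*} [NormedAddCommGroup E] [NormedSpace ℂ E]
    [NormedAddCommGroup F] [NormedSpace ℂ F] {L : E →L[ℂ] F}
    (h : (fun x => L x) =O[𝓝 0] fun x => ‖x‖ ^ 2) : L = 0 := by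
  refine L.hasFDerivAt.unique (x := 0) ?_
  rw [hasFDerivAt_iff_isLittleO_nhds_zero]
  simpa using h.trans_isLittleO (isLittleO_norm_pow_id one_lt_two)

theorem isBigO_sub_fderiv {E F : Type*} [NormedAddCommGroup E] [NormedSpace ℂ E]
    [NormedAddCommGroup F] [NormedSpace ℂ F] {h : E → F} (hh : AnalyticAt ℂ h 0) (h0 : h 0 = 0) :
    (fun x => h x - fderiv ℂ h 0 x) =O[𝓝 0] fun x => ‖x‖ ^ 2 := by
  obtain ⟨p, hp⟩ := hh
  have h1 := hp.isBigO_sub_partialSum_pow 2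
  have h2 : p 0 = 0 := by
    ext v
    rw [Subsingleton.elim v (fun _ => 0)]
    simpa [h0] using hp.coeff_zero _
  have h3 : ∀ y, p.partialSum 2 y = fderiv ℂ h 0 y := by
    intro y
    rw [hp.hasFDerivAt.fderiv, FormalMultilinearSeries.partialSum]
    simp [Finset.sum_range_succ, h2, continuousMultilinearCurryFin1_apply]
    congr 1
    ext i
    rw [Subsingleton.elim i 0]; rfl
  simpa [h3] using h1

/-- A truncation of the formal map is a locally invertible polynomial map sending the graph to the
quadric up to order `N`. Its inverse works in the other direction: the pulled-back defining function
`r` has nonzero `w`-derivative, so the distance to the graph in `w` is bounded by a multiple of `r`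
on the graph. -/
theorem exists_isApproxMap_of_mapsGraph {φ : RealSeries n} (hφ0 : constantCoeff φ = 0)
    {Φ : ZSpace n → ℂ} (hφ : HasExpansion Φ φ) (hΦ : Φ =O[𝓝 0] fun z => ‖z‖ ^ 2)
    {H : Fin n ⊕ Unit → HolSeries n} (hH : IsFormalTransformation H)
    (hmap : MapsGraph H φ (quadSeries n)) {N : ℕ} (hN : 2 ≤ N) :
    ∃ h, IsApproxMap Φ N h ∧ ∃ L : Ambient n ≃L[ℂ] Ambient n, HasFDerivAt h (L : _ →L[ℂ] _) 0 := by
  set T : Fin n ⊕ Unit → Ambient n → ℂ :=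
    fun s x => MvPolynomial.eval (holCoord x) (truncTotal N (H s)) with hT
  have hTan : ∀ s x, AnalyticAt ℂ (T s) x := fun s x => analyticAt_eval _ x
  have hTjet : ∀ s, HasJet holCoord N (T s) (H s) := fun s => by
    rw [HasJet]
    simpa only [hT, sub_self] using isBigO_zero _ _
  have hT0 : ∀ s, T s 0 = 0 := fun s => by
    rw [(hTjet s).apply_zero isCoord_holCoord (by omega), hH.1 s]
  have hTO : ∀ s, T s =O[𝓝 0] fun x => ‖x‖ := fun s => (hTan s 0).isBigO_norm (hT0 s)
  set f : Ambient n → Ambient n := fun x => ∑ s, T s x • holBasis s with hf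
  have hfT : ∀ x s, holCoord (f x) s = T s x := fun x s => holCoord_sum_smul _ s
  have hfan : AnalyticAt ℂ f 0 :=
    Finset.analyticAt_fun_sum _ fun s _ => (hTan s 0).smul analyticAt_const
  have hf0 : f 0 = 0 := by simp [hf, hT0]
  set f' := fderiv ℂ f 0 with hf'
  have hff' : HasFDerivAt f f' 0 := hfan.differentiableAt.hasFDerivAt
  have hf's : ∀ x s, holCoord (f' x) s = ∑ t, coeff (Finsupp.single t 1) (H s) * holCoord x t := by
    intro x s
    have h1 : HasFDerivAt (T s) ((holCoordCLM s).comp f') 0 := by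
      simpa only [holCoordCLM_apply, Function.comp_def, hfT] using
        (holCoordCLM s).hasFDerivAt.comp (0 : Ambient n) hff'
    have h2 := congrArg (fun T : Ambient n →L[ℂ] ℂ => T x)
      (h1.unique ((hTjet s).mono isCoord_holCoord hN).hasFDerivAt)
    simpa using h2
  have hinj : Function.Injective f' := by
    rw [injective_iff_map_eq_zero]
    intro x hx
    have h1 : (Matrix.of fun i j : Fin n ⊕ Unit => coeff (Finsupp.single j 1) (H i)).mulVec
        (holCoord x) = 0 := by
      ext s
      have := hf's x s
      rw [hx, holCoord_zero] at this
      simpa [Matrix.mulVec, dotProduct] using this.symm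
    have h2 := Matrix.eq_zero_of_mulVec_eq_zero (isUnit_iff_ne_zero.1 hH.2) h1
    exact holCoord_ext fun s => by rw [h2, holCoord_zero]; rfl
  set L : Ambient n ≃L[ℂ] Ambient n :=
    (LinearEquiv.ofInjectiveEndo (f' : Ambient n →ₗ[ℂ] Ambient n) hinj).toContinuousLinearEquiv
    with hL
  have hLf : (L : Ambient n →L[ℂ] Ambient n) = f' := by
    ext x <;> simp [hL]
  have hfL : HasStrictFDerivAt f (L : Ambient n →L[ℂ] Ambient n) 0 := by
    rw [hLf]; exact hfan.hasStrictFDerivAt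
  -- the defining function of the preimage of the quadric
  set r : Ambient n → ℂ :=
    fun x => T (Sum.inr ()) x - ∑ i, T (Sum.inl i) x * starRingEnd ℂ (T (Sum.inl i) x) with hr
  have hrΦ : (fun z => r (z, Φ z)) =O[𝓝 0] fun z => ‖z‖ ^ N := by
    have hres : ∀ s, HasJet realCoord N (fun z => T s (z, Φ z)) (restrictToGraph φ (H s)) :=
      fun s => (hφ.hasJet N).restrictToGraph (by omega) hφ0 (hTjet s)
    have h1 := (hres (Sum.inr ())).sub (HasJet.sum (s := Finset.univ) fun i _ =>
      (hres (Sum.inl i)).mul isCoord_realCoord (hres (Sum.inl i)).conj)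
    rw [MapsGraph, subst_quadSeries (constantCoeff_elim_conj fun i =>
      constantCoeff_restrictToGraph hφ0 (hH.1 _))] at hmap
    rw [hmap] at h1
    simp only [Sum.elim_inl, Sum.elim_inr, sub_self] at h1
    exact hasJet_zero_iff.1 h1
  set G' : Ambient n →L[ℂ] ℂ := fderiv ℂ (T (Sum.inr ())) 0 with hG'
  have hr' : HasStrictFDerivAt r (G'.restrictScalars ℝ) 0 := by
    have h1 : HasStrictFDerivAt (T (Sum.inr ())) (G'.restrictScalars ℝ) 0 :=
      (hTan _ 0).hasStrictFDerivAt.restrictScalars ℝ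
    have h2 : ∀ i ∈ Finset.univ, HasStrictFDerivAt
        (fun x => T (Sum.inl i) x * starRingEnd ℂ (T (Sum.inl i) x))
        (0 : Ambient n →L[ℝ] ℂ) 0 := by
      intro i _
      have h3 : HasStrictFDerivAt (T (Sum.inl i)) _ 0 :=
        (hTan (Sum.inl i) 0).hasStrictFDerivAt.restrictScalars ℝ
      have h4 := Complex.conjCLE.toContinuousLinearMap.hasStrictFDerivAt.comp (0 : Ambient n) h3
      refine (h3.mul h4).congr_fderiv ?_
      ext x <;> simp [hT0]
    refine (h1.fun_sub (HasStrictFDerivAt.fun_sum h2)).congr_fderiv ?_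
    simp
  -- Over the graph, `r` and the squared norm of the first components are `O(‖z‖ ^ 2)`, hence so is
  -- the last component, which therefore has no linear term in `z`.
  have hG'z : ∀ z, G' (z, 0) = 0 := by
    have hgr : (fun z => (z, Φ z)) =O[𝓝 0] fun z => ‖z‖ :=
      isBigO_graph (hΦ.trans isBigO_norm_sq)
    have hgt := tendsto_zero_of_isBigO_norm hgr
    have h1 : (fun z => T (Sum.inr ()) (z, Φ z)) =O[𝓝 0] fun z => ‖z‖ ^ 2 := by
      have h2 : (fun z => ∑ i, T (Sum.inl i) (z, Φ z) * starRingEnd ℂ (T (Sum.inl i) (z, Φ z)))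
          =O[𝓝 0] fun z => ‖z‖ ^ 2 := by
        refine IsBigO.fun_sum fun i _ => ?_
        have h3 : (fun z => T (Sum.inl i) (z, Φ z)) =O[𝓝 0] fun z => ‖z‖ :=
          ((hTO (Sum.inl i)).comp_tendsto hgt).trans hgr.norm_left
        have h4 : (fun z => starRingEnd ℂ (T (Sum.inl i) (z, Φ z))) =O[𝓝 0] fun z => ‖z‖ :=
          (h3.norm_left.congr_left fun z => (RCLike.norm_conj _).symm).of_norm_left
        simpa only [sq] using h3.mul h4
      refine ((hrΦ.trans (isBigO_norm_pow_le hN)).add h2).congr_left fun z => ?_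
      simp [hr]
    have h2 : (fun z => G' (z, Φ z)) =O[𝓝 0] fun z => ‖z‖ ^ 2 := by
      have h3 := ((isBigO_sub_fderiv (hTan (Sum.inr ()) 0) (hT0 _)).comp_tendsto hgt).trans
        (hgr.norm_left.pow 2)
      refine (h1.sub h3).congr_left fun z => ?_
      simp [hG']
    have h3 : (fun z : ZSpace n => (G'.comp (ContinuousLinearMap.inl ℂ (ZSpace n) ℂ)) z) =O[𝓝 0]
        fun z => ‖z‖ ^ 2 := by
      refine (h2.sub (hΦ.const_mul_left (G' (0, 1)))).congr_left fun z => ?_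
      have : ((z, Φ z) : Ambient n) = (z, 0) + Φ z • (0, 1) := by simp
      rw [this, map_add, map_smul]
      simp [mul_comm]
    intro z
    simpa using congrArg (fun T : ZSpace n →L[ℂ] ℂ => T z) (eq_zero_of_isBigO_sq h3)
  have hG'x : ∀ x : Ambient n, G' x = x.2 * G' (0, 1) := by
    intro x
    have : x = (x.1, 0) + x.2 • (0, 1) := by simp
    conv_lhs => rw [this, map_add, map_smul, hG'z, zero_add, smul_eq_mul]
  have hGw : G' (0, 1) ≠ 0 := by
    intro h0
    have h1 : ∀ x, (f' x).2 = G' x := by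
      intro x
      have h2 : HasFDerivAt (T (Sum.inr ())) ((holCoordCLM (Sum.inr ())).comp f') 0 := by
        simpa only [holCoordCLM_apply, Function.comp_def, hfT] using
          (holCoordCLM (Sum.inr ())).hasFDerivAt.comp (0 : Ambient n) hff'
      rw [hG', h2.fderiv, ContinuousLinearMap.comp_apply, holCoordCLM_apply]
      rfl
    have h2 := h1 (L.symm (0, 1))
    rw [← hLf, ContinuousLinearEquiv.coe_coe, L.apply_symm_apply, hG'x, h0, mul_zero] at h2
    exact one_ne_zero h2
  -- Strict differentiability with tolerance half the `w`-derivative; the error is absorbed for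
  -- points differing only in `w`, leaving the factor `2 / ‖G' (0, 1)‖`.
  have hest : ∀ᶠ x in 𝓝 ((0 : Ambient n), (0 : Ambient n)),
      ‖r x.1 - r x.2 - G' (x.1 - x.2)‖ ≤ ‖G' (0, 1)‖ / 2 * ‖x.1 - x.2‖ :=
    hr'.isLittleO.bound (by positivity)
  have hfc : ContDiffAt ℂ ⊤ f 0 := hfan.contDiffAt
  set k := hfc.localInverse hfL.hasFDerivAt (by simp) with hk
  have hkan : AnalyticAt ℂ k 0 := by
    rw [← hf0]
    exact (hfc.to_localInverse _ _).analyticAt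
  have hk0 : k 0 = 0 := by
    have := hfc.localInverse_apply_image hfL.hasFDerivAt (by simp)
    rwa [hf0] at this
  have hkf : ∀ᶠ y in 𝓝 (0 : Ambient n), f (k y) = y := by
    have := hfL.eventually_right_inverse
    rw [hf0] at this
    exact this
  refine ⟨k, ⟨hkan, hk0, ?_⟩, L.symm, ?_⟩
  · have hkq : (fun z => k (quadPoint z)) =O[𝓝 0] fun z => ‖z‖ :=
      ((hkan.isBigO_norm hk0).comp_tendsto tendsto_quadPoint).trans isBigO_quadPoint.norm_left
    have hkt := tendsto_zero_of_isBigO_norm hkq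
    have hkz : (fun z => (k (quadPoint z)).1) =O[𝓝 0] fun z => ‖z‖ := isBigO_fst_prod.trans hkq
    have hktz := tendsto_zero_of_isBigO_norm hkz
    have hgt := tendsto_zero_of_isBigO_norm (isBigO_graph (hΦ.trans isBigO_norm_sq))
    refine IsBigO.trans (IsBigO.of_bound (2 / ‖G' (0, 1)‖) ?_)
      ((hrΦ.comp_tendsto hktz).trans (hkz.norm_left.pow N))
    filter_upwards [(hkt.prodMk_nhds (hgt.comp hktz)).eventually hest,
      tendsto_quadPoint.eventually hkf] with z hz1 hz2
    set x := k (quadPoint z) with hx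
    have hx0 : r x = 0 := by
      have h1 : ∀ s, T s x = holCoord (quadPoint z) s := fun s => by rw [← hfT, hz2]
      simp only [hr, h1]
      rw [sub_eq_zero]
      exact normSq_eq_sum z
    have hsub : x - (x.1, Φ x.1) = (0, x.2 - Φ x.1) := by ext <;> simp
    simp only [Function.comp_apply] at hz1 ⊢
    rw [hx0, hsub, zero_sub, hG'x, Prod.norm_mk, norm_zero, max_eq_right (norm_nonneg _)] at hz1
    have h2 : ‖(x.2 - Φ x.1) * G' (0, 1)‖ ≤ ‖r (x.1, Φ x.1)‖ +
        ‖G' (0, 1)‖ / 2 * ‖x.2 - Φ x.1‖ := by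
      refine le_trans ?_ (add_le_add_right hz1 _)
      rw [← norm_neg (-r (x.1, Φ x.1) - _), ← norm_neg (r _)]
      refine le_trans (le_of_eq ?_) (norm_add_le _ _)
      congr 1; ring
    rw [norm_mul] at h2
    have h3 : 0 < ‖G' (0, 1)‖ := by positivity
    rw [div_mul_eq_mul_div, le_div_iff₀ h3]
    linarith
  · have h1 := hfL.to_localInverse.hasFDerivAt
    rw [hf0] at h1
    exact h1

end ApproxMap

end CRSingular

namespace CRSingular

open MvPowerSeries (truncTotal coeff constantCoeff)

/-! ### Germs preserving the quadric and the normalisation of the first derivative. -/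

section QuadricAut

variable {n : ℕ}

/-- Germs of analytic self-maps of the quadric. -/
structure IsQuadricMap (A : Ambient n → Ambient n) : Prop where
  analyticAt : AnalyticAt ℂ A 0
  map_zero : A 0 = 0
  mapsTo : ∀ᶠ z in 𝓝 (0 : ZSpace n), A (quadPoint z) = quadPoint (A (quadPoint z)).1

theorem IsApproxMap.comp {Φ : ZSpace n → ℂ} {N : ℕ} {h A : Ambient n → Ambient n}
    (hh : IsApproxMap Φ N h) (hA : IsQuadricMap A) : IsApproxMap Φ N (h ∘ A) where
  analyticAt := AnalyticAt.comp (by rw [hA.map_zero]; exact hh.analyticAt) hA.analyticAt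
  map_zero := by rw [Function.comp_apply, hA.map_zero, hh.map_zero]
  isBigO := by
    have h1 : (fun z => (A (quadPoint z)).1) =O[𝓝 0] fun z => ‖z‖ :=
      isBigO_fst_prod.trans (((hA.analyticAt.isBigO_norm hA.map_zero).comp_tendsto
        tendsto_quadPoint).trans isBigO_quadPoint.norm_left)
    refine IsBigO.congr' ((hh.isBigO.comp_tendsto (tendsto_zero_of_isBigO_norm h1)).trans
      (h1.norm_left.pow N)) ?_ EventuallyEq.rfl
    filter_upwards [hA.mapsTo] with z hz
    simp only [Function.comp_apply]
    rw [← hz]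

theorem exists_quadratic_part {E F : Type*} [NormedAddCommGroup E] [NormedSpace ℂ E]
    [NormedAddCommGroup F] [NormedSpace ℂ F] {h : E → F} (hh : AnalyticAt ℂ h 0) (h0 : h 0 = 0) :
    ∃ q : E → F, Continuous q ∧ (∀ (c : ℂ) x, q (c • x) = c ^ 2 • q x) ∧
      (fun x => h x - (fderiv ℂ h 0 x + q x)) =O[𝓝 0] fun x => ‖x‖ ^ 3 := by
  obtain ⟨p, hp⟩ := hh
  refine ⟨fun x => p 2 fun _ => x, (p 2).cont.comp (by fun_prop), fun c x => ?_, ?_⟩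
  · simpa using (p 2).map_smul_univ (fun _ => c) (fun _ => x)
  have h1 := hp.isBigO_sub_partialSum_pow 3
  have h2 : p 0 = 0 := by
    ext v
    rw [Subsingleton.elim v (fun _ => 0)]
    simpa [h0] using hp.coeff_zero _
  have h3 : ∀ y, p.partialSum 3 y = fderiv ℂ h 0 y + p 2 fun _ => y := by
    intro y
    rw [hp.hasFDerivAt.fderiv, FormalMultilinearSeries.partialSum]
    simp [Finset.sum_range_succ, h2, continuousMultilinearCurryFin1_apply]
    congr 1
    ext i
    rw [Subsingleton.elim i 0]; rfl
  simpa [h3] using h1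

variable {Φ : ZSpace n → ℂ} {N : ℕ} {h : Ambient n → Ambient n}

theorem IsApproxMap.isBigO_comp_quadPoint (hh : IsApproxMap Φ N h) :
    (fun z => h (quadPoint z)) =O[𝓝 0] fun z => ‖z‖ :=
  ((hh.analyticAt.isBigO_norm hh.map_zero).comp_tendsto tendsto_quadPoint).trans
    isBigO_quadPoint.norm_left

theorem isBigO_sq_of_isBigO_cube
    (hΦ : (fun z => Φ z - ((‖z‖ ^ 2 : ℝ) : ℂ)) =O[𝓝 0] fun z => ‖z‖ ^ 3) :
    Φ =O[𝓝 0] fun z => ‖z‖ ^ 2 := by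
  refine ((hΦ.trans (isBigO_norm_pow_le (by norm_num : 2 ≤ 3))).add isBigO_normSq).congr_left
    fun z => ?_
  ring

/-- On the quadric both `w` and the last component of `h` are `O(‖z‖ ^ 2)`, which excludes a linear
term in `z`. -/
theorem IsApproxMap.fderiv_snd_inl (hh : IsApproxMap Φ N h) (hN : 2 ≤ N)
    (hΦ : (fun z => Φ z - ((‖z‖ ^ 2 : ℝ) : ℂ)) =O[𝓝 0] fun z => ‖z‖ ^ 3) (z : ZSpace n) :
    (fderiv ℂ h 0 (z, 0)).2 = 0 := by
  have hq := hh.isBigO_comp_quadPoint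
  have hq1 : (fun z => (h (quadPoint z)).1) =O[𝓝 0] fun z => ‖z‖ := isBigO_fst_prod.trans hq
  have h1 : (fun z => (h (quadPoint z)).2) =O[𝓝 0] fun z => ‖z‖ ^ 2 := by
    refine ((hh.isBigO.trans (isBigO_norm_pow_le hN)).add
      (((isBigO_sq_of_isBigO_cube hΦ).comp_tendsto (tendsto_zero_of_isBigO_norm hq1)).trans
        (hq1.norm_left.pow 2))).congr_left fun z => ?_
    simp
  have h2 : (fun z => (h (quadPoint z) - fderiv ℂ h 0 (quadPoint z)).2) =O[𝓝 0]
      fun z => ‖z‖ ^ 2 :=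
    isBigO_snd_prod.trans (((isBigO_sub_fderiv hh.analyticAt hh.map_zero).comp_tendsto
      tendsto_quadPoint).trans (isBigO_quadPoint.norm_left.pow 2))
  have h3 : (fun z : ZSpace n => ((ContinuousLinearMap.snd ℂ _ _).comp
      ((fderiv ℂ h 0).comp (ContinuousLinearMap.inl ℂ (ZSpace n) ℂ))) z) =O[𝓝 0]
      fun z => ‖z‖ ^ 2 := by
    refine ((h1.sub h2).sub (isBigO_normSq.const_mul_left (fderiv ℂ h 0 (0, 1)).2)).congr_left
      fun z => ?_
    have : quadPoint z = (z, 0) + ((‖z‖ ^ 2 : ℝ) : ℂ) • ((0 : ZSpace n), (1 : ℂ)) := by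
      simp [quadPoint]
    rw [this, map_add, map_smul]
    simp [mul_comm]
  simpa using congrArg (fun T : ZSpace n →L[ℂ] ℂ => T z) (eq_zero_of_isBigO_sq h3)

theorem isBigO_normSq_sub {α F : Type*} [NormedAddCommGroup F] {l : Filter α} {u v : α → F}
    {g₁ g₂ : α → ℝ} (hu : u =O[l] g₁) (hv : v =O[l] g₁) (huv : (fun x => u x - v x) =O[l] g₂) :
    (fun x => ((‖u x‖ ^ 2 : ℝ) : ℂ) - ((‖v x‖ ^ 2 : ℝ) : ℂ)) =O[l] fun x => g₂ x * g₁ x := by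
  refine IsBigO.trans (IsBigO.of_bound 1 (Eventually.of_forall fun x => ?_))
    (huv.norm_left.mul (hu.norm_left.add hv.norm_left))
  rw [← Complex.ofReal_sub, Complex.norm_real, one_mul]
  have h1 : ‖u x‖ ^ 2 - ‖v x‖ ^ 2 = (‖u x‖ - ‖v x‖) * (‖u x‖ + ‖v x‖) := by ring
  rw [h1, norm_mul, norm_mul]
  refine mul_le_mul_of_nonneg_right ?_ (norm_nonneg _)
  rw [norm_norm, Real.norm_eq_abs]
  exact abs_norm_sub_norm_le _ _

theorem normSq_ofReal_smul (t : ℝ) (z : ZSpace n) :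
    ((‖(t : ℂ) • z‖ ^ 2 : ℝ) : ℂ) = (t : ℂ) ^ 2 * ((‖z‖ ^ 2 : ℝ) : ℂ) := by
  rw [norm_smul, mul_pow, Complex.norm_real, Real.norm_eq_abs, sq_abs]
  push_cast
  rfl

/-- Comparing terms of order `t²` along `t z` gives the claim up to a holomorphic quadratic term in
`z`. Replacing `z` by `i z` changes the sign of that term and nothing else, so averaging removes it.
-/
theorem IsApproxMap.fderiv_snd_inr_mul_normSq (hh : IsApproxMap Φ N h) (hN : 3 ≤ N)
    (hΦ : (fun z => Φ z - ((‖z‖ ^ 2 : ℝ) : ℂ)) =O[𝓝 0] fun z => ‖z‖ ^ 3) (z : ZSpace n) :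
    (fderiv ℂ h 0 (0, 1)).2 * ((‖z‖ ^ 2 : ℝ) : ℂ) =
      ((‖(fderiv ℂ h 0 (z, 0)).1‖ ^ 2 : ℝ) : ℂ) := by
  set D := fderiv ℂ h 0 with hD
  obtain ⟨q, hqc, hqs, hq⟩ := exists_quadratic_part hh.analyticAt hh.map_zero
  have hDz := hh.fderiv_snd_inl (by omega) hΦ
  have hdecomp : ∀ z : ZSpace n, quadPoint z =
      (z, 0) + ((‖z‖ ^ 2 : ℝ) : ℂ) • ((0 : ZSpace n), (1 : ℂ)) := fun z => by simp [quadPoint]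
  have key : ∀ z : ZSpace n, (D (0, 1)).2 * ((‖z‖ ^ 2 : ℝ) : ℂ) + (q (z, 0)).2 =
      ((‖(D (z, 0)).1‖ ^ 2 : ℝ) : ℂ) := by
    intro z
    have hline : Tendsto (fun t : ℝ => ((t : ℂ) • z)) (𝓝 0) (𝓝 0) := by
      have : Continuous fun t : ℝ => ((t : ℂ) • z) := by fun_prop
      simpa using this.tendsto 0
    have hlO : (fun t : ℝ => ((t : ℂ) • z)) =O[𝓝 0] fun t : ℝ => t :=
      IsBigO.of_bound ‖z‖ (Eventually.of_forall fun t => by simp [norm_smul, mul_comm])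
    have hqp := isBigO_quadPoint.comp_tendsto hline |>.trans hlO.norm_left
    have hhp := hh.isBigO_comp_quadPoint.comp_tendsto hline |>.trans hlO.norm_left
    have hPO : (fun t : ℝ => (h (quadPoint ((t : ℂ) • z))).1) =O[𝓝 0] fun t : ℝ => t :=
      isBigO_fst_prod.trans hhp
    have hPt : Tendsto (fun t : ℝ => (h (quadPoint ((t : ℂ) • z))).1) (𝓝 0) (𝓝 0) :=
      hPO.trans_tendsto tendsto_id
    have e1 : (fun t : ℝ => (h (quadPoint ((t : ℂ) • z))).2 -
        Φ (h (quadPoint ((t : ℂ) • z))).1) =O[𝓝 0] fun t : ℝ => t ^ 3 :=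
      ((hh.isBigO.trans (isBigO_norm_pow_le hN)).comp_tendsto hline).trans (hlO.norm_left.pow 3)
    have e2 : (fun t : ℝ => Φ (h (quadPoint ((t : ℂ) • z))).1 -
        ((‖(h (quadPoint ((t : ℂ) • z))).1‖ ^ 2 : ℝ) : ℂ)) =O[𝓝 0] fun t : ℝ => t ^ 3 :=
      (hΦ.comp_tendsto hPt).trans (hPO.norm_left.pow 3)
    have e3 : (fun t : ℝ => ((‖(h (quadPoint ((t : ℂ) • z))).1‖ ^ 2 : ℝ) : ℂ) -
        ((‖(t : ℂ) • (D (z, 0)).1‖ ^ 2 : ℝ) : ℂ)) =O[𝓝 0] fun t : ℝ => t ^ 2 * t := by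
      refine isBigO_normSq_sub hPO (IsBigO.of_bound ‖(D (z, 0)).1‖
        (Eventually.of_forall fun t => by simp [norm_smul, mul_comm])) ?_
      have h1 : (fun t : ℝ => (h (quadPoint ((t : ℂ) • z)) - D (quadPoint ((t : ℂ) • z))).1)
          =O[𝓝 0] fun t : ℝ => t ^ 2 :=
        isBigO_fst_prod.trans ((((isBigO_sub_fderiv hh.analyticAt hh.map_zero).comp_tendsto
          tendsto_quadPoint).comp_tendsto hline).trans (hqp.norm_left.pow 2))
      have h2 : (fun t : ℝ => (((‖(t : ℂ) • z‖ ^ 2 : ℝ) : ℂ)) • (D (0, 1)).1) =O[𝓝 0]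
          fun t : ℝ => t ^ 2 :=
        IsBigO.of_bound (‖z‖ ^ 2 * ‖(D (0, 1)).1‖) (Eventually.of_forall fun t => by
          rw [normSq_ofReal_smul]
          simp [norm_smul]
          apply le_of_eq; ring)
      refine (h1.add h2).congr_left fun t => ?_
      rw [hdecomp ((t : ℂ) • z), map_add, map_smul]
      have : (((t : ℂ) • z, (0 : ℂ)) : Ambient n) = (t : ℂ) • (z, 0) := by simp
      rw [this, map_smul]
      simp only [Prod.fst_sub, Prod.fst_add, Prod.smul_fst]
      abel
    have e4 : (fun t : ℝ => (h (quadPoint ((t : ℂ) • z)) - (D (quadPoint ((t : ℂ) • z)) +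
        q (quadPoint ((t : ℂ) • z)))).2) =O[𝓝 0] fun t : ℝ => t ^ 3 :=
      isBigO_snd_prod.trans (((hq.comp_tendsto tendsto_quadPoint).comp_tendsto hline).trans
        (hqp.norm_left.pow 3))
    have e3' : (fun t : ℝ => ((‖(h (quadPoint ((t : ℂ) • z))).1‖ ^ 2 : ℝ) : ℂ) -
        ((‖(t : ℂ) • (D (z, 0)).1‖ ^ 2 : ℝ) : ℂ)) =O[𝓝 0] fun t : ℝ => t ^ 3 :=
      e3.congr_right fun t => by ring
    have e5 := ((e1.add e2).add e3').sub e4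
    have e6 : (fun t : ℝ => ((t : ℂ) ^ 2) * ((D (0, 1)).2 * ((‖z‖ ^ 2 : ℝ) : ℂ) +
        (q (z, (t : ℂ) * ((‖z‖ ^ 2 : ℝ) : ℂ))).2 - ((‖(D (z, 0)).1‖ ^ 2 : ℝ) : ℂ))) =O[𝓝 0]
        fun t : ℝ => t ^ 3 := by
      refine e5.congr_left fun t => ?_
      have h1 : quadPoint ((t : ℂ) • z) = (t : ℂ) • (z, (t : ℂ) * ((‖z‖ ^ 2 : ℝ) : ℂ)) := by
        rw [quadPoint, normSq_ofReal_smul, Prod.smul_mk, smul_eq_mul]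
        congr 1
        ring
      have h2 : (D (quadPoint ((t : ℂ) • z))).2 =
          (t : ℂ) ^ 2 * ((‖z‖ ^ 2 : ℝ) : ℂ) * (D (0, 1)).2 := by
        rw [hdecomp ((t : ℂ) • z), map_add, Prod.snd_add, hDz, map_smul, normSq_ofReal_smul]
        simp
      have h3 : (q (quadPoint ((t : ℂ) • z))).2 =
          (t : ℂ) ^ 2 * (q (z, (t : ℂ) * ((‖z‖ ^ 2 : ℝ) : ℂ))).2 := by
        rw [h1, hqs]; simp
      simp only [Prod.snd_sub, Prod.snd_add]
      rw [h2, h3, normSq_ofReal_smul]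
      ring
    have e7 : Tendsto (fun t : ℝ => (D (0, 1)).2 * ((‖z‖ ^ 2 : ℝ) : ℂ) +
        (q (z, (t : ℂ) * ((‖z‖ ^ 2 : ℝ) : ℂ))).2 - ((‖(D (z, 0)).1‖ ^ 2 : ℝ) : ℂ))
        (𝓝[≠] 0) (𝓝 0) := by
      have h1 : (fun t : ℝ => (D (0, 1)).2 * ((‖z‖ ^ 2 : ℝ) : ℂ) +
          (q (z, (t : ℂ) * ((‖z‖ ^ 2 : ℝ) : ℂ))).2 - ((‖(D (z, 0)).1‖ ^ 2 : ℝ) : ℂ))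
          =O[𝓝[≠] 0] fun t : ℝ => t := by
        have h2 := (IsBigO.of_bound (f := fun t : ℝ => ((t : ℂ) ^ 2)⁻¹)
          (g := fun t : ℝ => (t ^ 2)⁻¹) 1 (Eventually.of_forall fun t => by simp)).mul
          (e6.mono (nhdsWithin_le_nhds (s := {0}ᶜ)))
        refine IsBigO.trans (h2.congr' ?_ EventuallyEq.rfl) (IsBigO.of_bound 1 ?_)
        · filter_upwards [self_mem_nhdsWithin] with t ht
          have : (t : ℂ) ≠ 0 := Complex.ofReal_ne_zero.2 ht
          field_simp
        · filter_upwards [self_mem_nhdsWithin] with t ht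
          have : t ≠ 0 := ht
          apply le_of_eq
          rw [one_mul]
          congr 1
          field_simp
      exact h1.trans_tendsto (tendsto_id.mono_left nhdsWithin_le_nhds)
    have e8 : Tendsto (fun t : ℝ => (D (0, 1)).2 * ((‖z‖ ^ 2 : ℝ) : ℂ) +
        (q (z, (t : ℂ) * ((‖z‖ ^ 2 : ℝ) : ℂ))).2 - ((‖(D (z, 0)).1‖ ^ 2 : ℝ) : ℂ))
        (𝓝[≠] 0) (𝓝 ((D (0, 1)).2 * ((‖z‖ ^ 2 : ℝ) : ℂ) + (q (z, 0)).2 -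
          ((‖(D (z, 0)).1‖ ^ 2 : ℝ) : ℂ))) := by
      have : Continuous fun t : ℝ => (D (0, 1)).2 * ((‖z‖ ^ 2 : ℝ) : ℂ) +
        (q (z, (t : ℂ) * ((‖z‖ ^ 2 : ℝ) : ℂ))).2 - ((‖(D (z, 0)).1‖ ^ 2 : ℝ) : ℂ) := by fun_prop
      simpa using (this.tendsto 0).mono_left nhdsWithin_le_nhds
    exact sub_eq_zero.1 (tendsto_nhds_unique e8 e7)
  have k1 := key z
  have k2 := key (Complex.I • z)
  have h1 : ((Complex.I • z, (0 : ℂ)) : Ambient n) = Complex.I • (z, 0) := by simp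
  rw [h1, hqs, map_smul] at k2
  simp only [norm_smul, Complex.norm_I, one_mul, Prod.smul_fst, Prod.smul_snd, Complex.I_sq,
    smul_eq_mul] at k2
  linear_combination (1 / 2 : ℂ) * k1 + (1 / 2 : ℂ) * k2

/-- An approximate map is tangent to the identity up to the direction of `w`. -/
def IsTangential (h : Ambient n → Ambient n) : Prop :=
  ∃ b : ZSpace n, ∀ x : Ambient n, fderiv ℂ h 0 x = (x.1 + x.2 • b, x.2)

/-- The second-order comparison says `c |z|² = |B z|²` for the `z`-block `B` and the `w`-entry `c`
of the derivative. Hence `(B⁻¹, c⁻¹)` preserves the quadric, and precomposing with it makes both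
diagonal blocks trivial. -/
theorem IsApproxMap.exists_isTangential (i : Fin n) (hh : IsApproxMap Φ N h) (hN : 3 ≤ N)
    (hΦ : (fun z => Φ z - ((‖z‖ ^ 2 : ℝ) : ℂ)) =O[𝓝 0] fun z => ‖z‖ ^ 3)
    {L : Ambient n ≃L[ℂ] Ambient n} (hL : HasFDerivAt h (L : Ambient n →L[ℂ] Ambient n) 0) :
    ∃ h', IsApproxMap Φ N h' ∧ IsTangential h' := by
  have hz := hh.fderiv_snd_inl (by omega) hΦ
  have hsq := hh.fderiv_snd_inr_mul_normSq hN hΦ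
  simp only [hL.fderiv, ContinuousLinearEquiv.coe_coe] at hz hsq
  set c := (L (0, 1)).2 with hc
  set B : ZSpace n →L[ℂ] ZSpace n := (ContinuousLinearMap.fst ℂ _ _).comp
    ((L : Ambient n →L[ℂ] Ambient n).comp (ContinuousLinearMap.inl ℂ (ZSpace n) ℂ)) with hB
  have hBz : ∀ z, L (z, 0) = (B z, 0) := fun z => by
    ext1
    · simp [hB]
    · exact hz z
  have hinj : Function.Injective B := by
    rw [injective_iff_map_eq_zero]
    intro z h0
    have h1 : L (z, 0) = 0 := by rw [hBz, h0]; rfl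
    simpa using (L.map_eq_zero_iff.1 h1)
  set B' : ZSpace n ≃L[ℂ] ZSpace n :=
    (LinearEquiv.ofInjectiveEndo (B : ZSpace n →ₗ[ℂ] ZSpace n) hinj).toContinuousLinearEquiv
    with hB'
  have hB'z : ∀ z, B' z = B z := fun z => by simp [hB']
  have hc0 : c ≠ 0 := by
    intro h0
    have h1 := hsq (EuclideanSpace.single i 1)
    rw [h0, zero_mul, hBz] at h1
    have h2 : B (EuclideanSpace.single i 1) = 0 := by
      simpa using h1.symm
    rw [← _root_.map_zero B] at h2
    have h3 := congrArg (fun v : ZSpace n => v i) (hinj h2)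
    simp at h3
  set A : Ambient n →L[ℂ] Ambient n :=
    (B'.symm : ZSpace n →L[ℂ] ZSpace n).prodMap (c⁻¹ • ContinuousLinearMap.id ℂ ℂ) with hA
  have hAx : ∀ x : Ambient n, A x = (B'.symm x.1, c⁻¹ * x.2) := fun x =>
    Prod.ext (by simp [hA]) (by simp [hA])
  have hAq : IsQuadricMap A := by
    refine ⟨A.analyticAt 0, _root_.map_zero A, Eventually.of_forall fun z => ?_⟩
    rw [hAx]
    have h1 := hsq (B'.symm z)
    rw [hBz, ← hB'z, B'.apply_symm_apply] at h1
    simp only [quadPoint]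
    rw [← h1, inv_mul_cancel_left₀ hc0]
  refine ⟨h ∘ A, hh.comp hAq, c⁻¹ • (L (0, 1)).1, fun x => ?_⟩
  have h1 : HasFDerivAt (h ∘ A) ((L : Ambient n →L[ℂ] Ambient n).comp A) 0 :=
    HasFDerivAt.comp (0 : Ambient n) (by rw [_root_.map_zero]; exact hL) A.hasFDerivAt
  rw [h1.fderiv, ContinuousLinearMap.comp_apply, hAx, ContinuousLinearEquiv.coe_coe]
  have h2 : ((B'.symm x.1, c⁻¹ * x.2) : Ambient n) = (B'.symm x.1, 0) + (c⁻¹ * x.2) • (0, 1) := by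
    simp
  rw [h2, map_add, map_smul, hBz, ← hB'z, B'.apply_symm_apply]
  ext1
  · simp [smul_smul, mul_comm]
  · simp only [Prod.snd_add, Prod.smul_snd, zero_add, ← hc, smul_eq_mul]
    field_simp

end QuadricAut

end CRSingular

namespace CRSingular

open MvPowerSeries (truncTotal coeff constantCoeff)

/-! ### Normalisation by automorphisms of the quadric -/

/-- An analytic function that is `o(t ^ m)` is divisible by `t ^ (m + 1)`, and `c` is the quotient
at `0`. The normalisations below remove such a coefficient one order at a time. -/
theorem exists_isLittleO_sub_smul {F : Type*} [NormedAddCommGroup F] [NormedSpace ℝ F]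
    {f : ℝ → F} (hf : AnalyticAt ℝ f 0) {m : ℕ} (h : f =o[𝓝 0] fun t => t ^ m) :
    ∃ c, (fun t => f t - t ^ (m + 1) • c) =o[𝓝 0] fun t => t ^ (m + 1) := by
  have key : ∀ k ≤ m + 1, ∃ g : ℝ → F, AnalyticAt ℝ g 0 ∧ ∀ᶠ t in 𝓝 0, f t = t ^ k • g t := by
    intro k
    induction k with
    | zero => exact fun _ => ⟨f, hf, by simp⟩
    | succ k ih =>
      intro hk
      obtain ⟨g, hg, hfg⟩ := ih (by omega)
      have hg0 : g 0 = 0 := by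
        have h1 : (fun t => t ^ k • g t) =o[𝓝[≠] 0] fun t : ℝ => t ^ k := by
          refine ((h.congr' hfg EventuallyEq.rfl).mono nhdsWithin_le_nhds).trans_isBigO ?_
          have := (isBigO_norm_pow_le (E := ℝ) (by omega : k ≤ m)).mono
            (nhdsWithin_le_nhds (s := {(0 : ℝ)}ᶜ))
          refine IsBigO.of_norm_left (IsBigO.of_norm_right ?_)
          simpa only [norm_pow] using this
        have h2 : g =o[𝓝[≠] 0] fun _ : ℝ => (1 : ℝ) := by
          have h3 := (isBigO_refl (fun t : ℝ => (t ^ k)⁻¹) (𝓝[≠] 0)).smul_isLittleO h1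
          refine h3.congr' ?_ ?_
          · filter_upwards [self_mem_nhdsWithin] with t ht
            have : t ^ k ≠ 0 := pow_ne_zero _ ht
            rw [smul_smul, inv_mul_cancel₀ this, one_smul]
          · filter_upwards [self_mem_nhdsWithin] with t ht
            have : t ^ k ≠ 0 := pow_ne_zero _ ht
            rw [smul_eq_mul, inv_mul_cancel₀ this]
        rw [isLittleO_one_iff] at h2
        exact tendsto_nhds_unique (hg.continuousAt.tendsto.mono_left nhdsWithin_le_nhds) h2
      have h1 : ((1 : ℕ) : ℕ∞) ≤ analyticOrderAt g 0 := by
        rw [Nat.cast_one, Order.one_le_iff_ne_zero]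
        exact hg.analyticOrderAt_ne_zero.2 hg0
      obtain ⟨g', hg', hgg'⟩ := (natCast_le_analyticOrderAt hg).1 h1
      refine ⟨g', hg', ?_⟩
      filter_upwards [hfg, hgg'] with t h1 h2
      rw [h1, h2, smul_smul, sub_zero, pow_one, pow_succ]
  obtain ⟨g, hg, hfg⟩ := key (m + 1) le_rfl
  refine ⟨g 0, ?_⟩
  have h1 : (fun t => g t - g 0) =o[𝓝 0] fun _ : ℝ => (1 : ℝ) := by
    rw [isLittleO_one_iff]
    simpa using hg.continuousAt.tendsto.sub_const (g 0)
  refine ((isBigO_refl (fun t : ℝ => t ^ (m + 1)) (𝓝 0)).smul_isLittleO h1).congr' ?_ ?_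
  · filter_upwards [hfg] with t ht
    rw [ht, smul_sub]
  · filter_upwards with t
    rw [smul_eq_mul, mul_one]

theorem isLittleO_pow_mono {F : Type*} [NormedAddCommGroup F] {f : ℝ → F} {j k : ℕ} (hj : j ≤ k)
    (h : f =o[𝓝 0] fun t => t ^ k) : f =o[𝓝 0] fun t => t ^ j := by
  refine h.trans_isBigO (IsBigO.of_norm_left (IsBigO.of_norm_right ?_))
  simpa only [norm_pow] using isBigO_norm_pow_le (E := ℝ) hj

section Normalise

variable {n : ℕ}

/-- The endomorphism `∂P / ∂z (0, w)` of a map `h = (P, Q)`. -/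
noncomputable def zDeriv (h : Ambient n → Ambient n) (w : ℂ) : ZSpace n →L[ℂ] ZSpace n :=
  (ContinuousLinearMap.fst ℂ (ZSpace n) ℂ).comp
    ((fderiv ℂ h (0, w)).comp (ContinuousLinearMap.inl ℂ (ZSpace n) ℂ))

theorem zDeriv_apply (h : Ambient n → Ambient n) (w : ℂ) (v : ZSpace n) :
    zDeriv h w v = (fderiv ℂ h (0, w) (v, 0)).1 := rfl

theorem tendsto_axis : Tendsto (fun w : ℂ => ((0 : ZSpace n), w)) (𝓝 0) (𝓝 0) := by
  have : Continuous fun w : ℂ => ((0 : ZSpace n), w) := by fun_prop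
  exact this.tendsto 0

theorem analyticAt_axis (w : ℂ) : AnalyticAt ℂ (fun w : ℂ => ((0 : ZSpace n), w)) w :=
  analyticAt_const.prod analyticAt_id

theorem analyticAt_ofReal (t : ℝ) : AnalyticAt ℝ (fun t : ℝ => (t : ℂ)) t :=
  Complex.ofRealCLM.analyticAt t

theorem tendsto_ofReal : Tendsto (fun t : ℝ => (t : ℂ)) (𝓝 0) (𝓝 0) := by
  simpa using Complex.continuous_ofReal.tendsto 0

theorem analyticAt_zDeriv {h : Ambient n → Ambient n} (hh : AnalyticAt ℂ h 0) :
    AnalyticAt ℂ (zDeriv h) 0 := by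
  have h1 : AnalyticAt ℂ (fun w : ℂ => fderiv ℂ h ((0 : ZSpace n), w)) 0 :=
    hh.fderiv.comp_of_eq (analyticAt_axis 0) rfl
  exact (((ContinuousLinearMap.compL ℂ (ZSpace n) (Ambient n) (ZSpace n)
    (ContinuousLinearMap.fst ℂ (ZSpace n) ℂ)).analyticAt _).comp
    (((ContinuousLinearMap.compL ℂ (ZSpace n) (Ambient n) (Ambient n)).flip
      (ContinuousLinearMap.inl ℂ (ZSpace n) ℂ)).analyticAt _)).comp h1

theorem IsTangential.zDeriv_zero {h : Ambient n → Ambient n} (hh : IsTangential h) :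
    zDeriv h 0 = 1 := by
  obtain ⟨b, hb⟩ := hh
  ext1 v
  rw [zDeriv_apply]
  have := hb (v, 0)
  rw [show ((0 : ZSpace n), (0 : ℂ)) = 0 from rfl, this]
  simp

theorem IsTangential.comp {h A : Ambient n → Ambient n} (hh : IsTangential h)
    (hA : IsTangential A) (ha : AnalyticAt ℂ h 0) (hAa : AnalyticAt ℂ A 0) (hA0 : A 0 = 0) :
    IsTangential (h ∘ A) := by
  obtain ⟨b, hb⟩ := hh
  obtain ⟨b', hb'⟩ := hA
  refine ⟨b' + b, fun x => ?_⟩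
  have h1 : HasFDerivAt (h ∘ A) ((fderiv ℂ h 0).comp (fderiv ℂ A 0)) 0 :=
    HasFDerivAt.comp (0 : Ambient n) (by rw [hA0]; exact ha.differentiableAt.hasFDerivAt)
      hAa.differentiableAt.hasFDerivAt
  rw [h1.fderiv, ContinuousLinearMap.comp_apply, hb', hb]
  ext1
  · simp only [smul_add]
    abel
  · rfl

/-- The map `(z, w) ↦ (T(w) z, g(w))`. -/
noncomputable def fiberMap (T : ℂ → ZSpace n →L[ℂ] ZSpace n) (g : ℂ → ℂ) (x : Ambient n) : Ambient n :=
  (T x.2 x.1, g x.2)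

section FiberMap

variable {T : ℂ → ZSpace n →L[ℂ] ZSpace n} {g : ℂ → ℂ}

theorem fiberMap_axis (w : ℂ) : fiberMap T g (0, w) = (0, g w) := by
  rw [fiberMap, map_zero]

theorem analyticAt_fiberMap (hT : AnalyticAt ℂ T 0) (hg : AnalyticAt ℂ g 0) :
    AnalyticAt ℂ (fiberMap T g) 0 := by
  have h1 : AnalyticAt ℂ (fun x : Ambient n => T x.2) 0 :=
    hT.comp_of_eq analyticAt_snd rfl
  have h2 : AnalyticAt ℂ (fun x : Ambient n => g x.2) 0 :=
    hg.comp_of_eq analyticAt_snd rfl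
  have h3 : ContDiffAt ℂ ⊤ (fun x : Ambient n => T x.2 x.1) 0 :=
    h1.contDiffAt.clm_apply contDiffAt_fst
  exact h3.analyticAt.prod h2

theorem hasFDerivAt_fiberMap {w : ℂ} (hT : DifferentiableAt ℂ T w)
    (hg : DifferentiableAt ℂ g w) :
    HasFDerivAt (fiberMap T g)
      (((T w).comp (ContinuousLinearMap.fst ℂ (ZSpace n) ℂ)).prod
        ((fderiv ℂ g w).comp (ContinuousLinearMap.snd ℂ (ZSpace n) ℂ))) (0, w) := by
  have h1 : HasFDerivAt (fun x : Ambient n => T x.2)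
      ((fderiv ℂ T w).comp (ContinuousLinearMap.snd ℂ (ZSpace n) ℂ)) ((0 : ZSpace n), w) :=
    HasFDerivAt.comp (g := T) ((0 : ZSpace n), w) hT.hasFDerivAt hasFDerivAt_snd
  have h2 : HasFDerivAt (fun x : Ambient n => g x.2)
      ((fderiv ℂ g w).comp (ContinuousLinearMap.snd ℂ (ZSpace n) ℂ)) ((0 : ZSpace n), w) :=
    HasFDerivAt.comp (g := g) ((0 : ZSpace n), w) hg.hasFDerivAt hasFDerivAt_snd
  refine HasFDerivAt.prodMk ?_ h2
  refine (h1.clm_apply hasFDerivAt_fst).congr_fderiv ?_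
  ext x <;> simp

theorem isTangential_fiberMap (hT : DifferentiableAt ℂ T 0) (hT0 : T 0 = 1)
    (hg : HasDerivAt g 1 0) : IsTangential (fiberMap T g) := by
  refine ⟨0, fun x => ?_⟩
  have h1 := (hasFDerivAt_fiberMap hT hg.differentiableAt).fderiv
  rw [show ((0 : ZSpace n), (0 : ℂ)) = 0 from rfl] at h1
  rw [h1, hg.hasFDerivAt.fderiv, hT0]
  simp

theorem isQuadricMap_fiberMap (hT : AnalyticAt ℂ T 0) (hg : AnalyticAt ℂ g 0) (hg0 : g 0 = 0)
    (h : ∀ (t : ℝ) (z : ZSpace n), ‖z‖ ^ 2 = t → ((‖T t z‖ ^ 2 : ℝ) : ℂ) = g t) :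
    IsQuadricMap (fiberMap T g) where
  analyticAt := analyticAt_fiberMap hT hg
  map_zero := by
    rw [show (0 : Ambient n) = (0, 0) from rfl, fiberMap_axis, hg0]
  mapsTo := Eventually.of_forall fun z => by
    simp only [fiberMap, quadPoint]
    rw [h _ _ rfl]

theorem zDeriv_comp_fiberMap {h : Ambient n → Ambient n} (hh : AnalyticAt ℂ h 0)
    (hT : AnalyticAt ℂ T 0) (hg : AnalyticAt ℂ g 0) (hg0 : g 0 = 0) :
    ∀ᶠ w in 𝓝 0, zDeriv (h ∘ fiberMap T g) w = (zDeriv h (g w)).comp (T w) := by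
  have hgt : Tendsto (fun w => ((0 : ZSpace n), g w)) (𝓝 0) (𝓝 0) := by
    refine tendsto_axis.comp ?_
    simpa [hg0] using hg.continuousAt.tendsto
  filter_upwards [hT.eventually_analyticAt, hg.eventually_analyticAt,
    hgt.eventually hh.eventually_analyticAt] with w hTw hgw hhw
  have h1 : HasFDerivAt (h ∘ fiberMap T g) _ ((0 : ZSpace n), w) :=
    HasFDerivAt.comp _ (by rw [fiberMap_axis]; exact hhw.differentiableAt.hasFDerivAt)
      (hasFDerivAt_fiberMap hTw.differentiableAt hgw.differentiableAt)
  ext1 v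
  rw [zDeriv_apply, h1.fderiv]
  simp [zDeriv_apply]

end FiberMap

end Normalise

end CRSingular

namespace CRSingular

open MvPowerSeries (truncTotal coeff constantCoeff)

/-! ### Möbius automorphisms and the centre curve. -/

section Mobius

variable {n : ℕ}

/-- The denominator of `mobiusMap`. -/
noncomputable def mobiusDenom (m : ℕ) (a : ZSpace n) (x : Ambient n) : ℂ :=
  1 + ((‖a‖ ^ 2 : ℝ) : ℂ) * x.2 ^ (2 * m + 1) + 2 * innerSL ℂ a x.1 * x.2 ^ m

/-- Automorphisms of the quadric which act on each ball `|z|² < w` by a Möbius transformation. -/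
noncomputable def mobiusMap (m : ℕ) (a : ZSpace n) (x : Ambient n) : Ambient n :=
  ((mobiusDenom m a x)⁻¹ •
    ((2 * x.2 ^ (m + 1) + 2 * innerSL ℂ a x.1 * x.2 ^ (2 * m + 1)) • a +
      (1 - ((‖a‖ ^ 2 : ℝ) : ℂ) * x.2 ^ (2 * m + 1)) • x.1), x.2)

theorem mobiusDenom_zero (m : ℕ) (a : ZSpace n) : mobiusDenom m a 0 = 1 := by
  simp [mobiusDenom]

theorem contDiff_mobiusDenom (m : ℕ) (a : ZSpace n) : ContDiff ℂ ⊤ (mobiusDenom m a) := by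
  unfold mobiusDenom
  fun_prop

theorem analyticAt_mobiusMap (m : ℕ) (a : ZSpace n) : AnalyticAt ℂ (mobiusMap m a) 0 := by
  refine ContDiffAt.analyticAt (𝕜 := ℂ) ?_
  have h1 : ContDiffAt ℂ ⊤ (fun x => (mobiusDenom m a x)⁻¹) 0 :=
    (contDiff_mobiusDenom m a).contDiffAt.inv (by simp [mobiusDenom_zero])
  refine ContDiffAt.prodMk (ContDiffAt.smul h1 ?_) contDiffAt_snd
  fun_prop

/-- For real `w = r`, put `u = r ^ m`, `α = ‖a‖²` and `⟨a, z⟩ = x + i y`. Both sides become the same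
polynomial in `α, r, u, x, y`. -/
theorem normSq_mobius (m : ℕ) (a : ZSpace n) (z : ZSpace n) (r : ℝ) (hr : ‖z‖ ^ 2 = r) :
    ‖((2 * (r : ℂ) ^ (m + 1) + 2 * innerSL ℂ a z * (r : ℂ) ^ (2 * m + 1)) • a +
      (1 - ((‖a‖ ^ 2 : ℝ) : ℂ) * (r : ℂ) ^ (2 * m + 1)) • z)‖ ^ 2 =
      r * ‖mobiusDenom m a (z, (r : ℂ))‖ ^ 2 := by
  set α := ‖a‖ ^ 2 with hα
  set u := r ^ m with hu
  set x := (innerSL ℂ a z).re with hx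
  set y := (innerSL ℂ a z).im with hy
  have hs : innerSL ℂ a z = ⟨x, y⟩ := rfl
  have hA : 2 * (r : ℂ) ^ (m + 1) + 2 * innerSL ℂ a z * (r : ℂ) ^ (2 * m + 1) =
      ⟨2 * r * u + 2 * x * r * u ^ 2, 2 * y * r * u ^ 2⟩ := by
    have h1 : (r : ℂ) ^ (2 * m + 1) = ((r * u ^ 2 : ℝ) : ℂ) := by
      rw [hu]; push_cast; ring
    have h2 : (r : ℂ) ^ (m + 1) = ((r * u : ℝ) : ℂ) := by
      rw [hu]; push_cast; ring
    rw [h1, h2, hs]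
    apply Complex.ext
    · simp only [Complex.add_re, Complex.mul_re, Complex.re_ofNat, Complex.im_ofNat,
        Complex.ofReal_re, Complex.ofReal_im, Complex.mul_im]
      ring
    · simp only [Complex.add_im, Complex.mul_re, Complex.re_ofNat, Complex.im_ofNat,
        Complex.ofReal_re, Complex.ofReal_im, Complex.mul_im]
      ring
  have hB : 1 - ((α : ℝ) : ℂ) * (r : ℂ) ^ (2 * m + 1) = ((1 - α * r * u ^ 2 : ℝ) : ℂ) := by
    rw [hu]; push_cast; ring
  have hD : mobiusDenom m a (z, (r : ℂ)) =
      ⟨1 + α * r * u ^ 2 + 2 * x * u, 2 * y * u⟩ := by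
    have h1 : (r : ℂ) ^ (2 * m + 1) = ((r * u ^ 2 : ℝ) : ℂ) := by
      rw [hu]; push_cast; ring
    have h2 : (r : ℂ) ^ m = ((u : ℝ) : ℂ) := by
      rw [hu]; push_cast; ring
    rw [mobiusDenom]
    simp only
    rw [h1, h2, hs]
    apply Complex.ext
    · simp only [Complex.add_re, Complex.mul_re, Complex.re_ofNat, Complex.im_ofNat,
        Complex.ofReal_re, Complex.ofReal_im, Complex.mul_im, Complex.one_re]
      ring
    · simp only [Complex.add_im, Complex.mul_re, Complex.re_ofNat, Complex.im_ofNat,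
        Complex.ofReal_re, Complex.ofReal_im, Complex.mul_im, Complex.one_im]
      ring
  have hn : ∀ p q : ℝ, ‖(⟨p, q⟩ : ℂ)‖ ^ 2 = p ^ 2 + q ^ 2 := fun p q => by
    rw [Complex.sq_norm, Complex.normSq_mk]; ring
  rw [hA, hB, hD, norm_add_sq (𝕜 := ℂ), norm_smul, norm_smul, mul_pow, mul_pow,
    hn (2 * r * u + 2 * x * r * u ^ 2) (2 * y * r * u ^ 2),
    hn (1 + α * r * u ^ 2 + 2 * x * u) (2 * y * u),
    Complex.norm_real, Real.norm_eq_abs, sq_abs, hr, ← hα, inner_smul_left, inner_smul_right]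
  have hin : inner ℂ a z = (⟨x, y⟩ : ℂ) := rfl
  have hre : RCLike.re ((starRingEnd ℂ) (⟨2 * r * u + 2 * x * r * u ^ 2, 2 * y * r * u ^ 2⟩ : ℂ) *
      (((1 - α * r * u ^ 2 : ℝ) : ℂ) * inner ℂ a z)) =
      (1 - α * r * u ^ 2) * ((2 * r * u + 2 * x * r * u ^ 2) * x + 2 * y * r * u ^ 2 * y) := by
    rw [hin]
    simp only [RCLike.re_to_complex, Complex.mul_re, Complex.mul_im, Complex.conj_re,
      Complex.conj_im, Complex.ofReal_re, Complex.ofReal_im]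
    ring
  rw [hre]
  ring

theorem isQuadricMap_mobiusMap (m : ℕ) (a : ZSpace n) : IsQuadricMap (mobiusMap m a) where
  analyticAt := analyticAt_mobiusMap m a
  map_zero := by
    ext1
    · simp [mobiusMap]
    · rfl
  mapsTo := by
    have h1 : ∀ᶠ x in 𝓝 (0 : Ambient n), mobiusDenom m a x ≠ 0 :=
      (contDiff_mobiusDenom m a).continuous.continuousAt.eventually_ne (by simp [mobiusDenom_zero])
    filter_upwards [tendsto_quadPoint.eventually h1] with z hz
    refine Prod.ext rfl ?_
    have h2 := normSq_mobius m a z (‖z‖ ^ 2) rfl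
    have h3 : ‖mobiusDenom m a (quadPoint z)‖ ≠ 0 := norm_ne_zero_iff.2 hz
    simp only [mobiusMap, quadPoint] at *
    rw [norm_smul, mul_pow, h2, norm_inv, inv_pow]
    congr 1
    field_simp

theorem mobiusMap_axis (m : ℕ) (a : ZSpace n) (w : ℂ) :
    mobiusMap m a (0, w) =
      ((2 * w ^ (m + 1) * (1 + ((‖a‖ ^ 2 : ℝ) : ℂ) * w ^ (2 * m + 1))⁻¹) • a, w) := by
  simp [mobiusMap, mobiusDenom, smul_smul, mul_comm]

theorem isTangential_mobiusMap (m : ℕ) (a : ZSpace n) : IsTangential (mobiusMap m a) := by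
  set A := mobiusMap m a with hA
  have hd : HasFDerivAt A (fderiv ℂ A 0) 0 :=
    (analyticAt_mobiusMap m a).differentiableAt.hasFDerivAt
  refine ⟨(fderiv ℂ A 0 (0, 1)).1, fun x => ?_⟩
  have hsnd : ∀ x, (fderiv ℂ A 0 x).2 = x.2 := by
    intro x
    have h1 : HasFDerivAt (fun x => (A x).2)
        ((ContinuousLinearMap.snd ℂ (ZSpace n) ℂ).comp (fderiv ℂ A 0)) 0 := hd.snd
    have h2 : HasFDerivAt (fun x => (A x).2) (ContinuousLinearMap.snd ℂ (ZSpace n) ℂ) 0 :=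
      hasFDerivAt_snd
    exact congrArg (fun T : Ambient n →L[ℂ] ℂ => T x) (h1.unique h2)
  have hfst : ∀ z, (fderiv ℂ A 0 (z, 0)).1 = z := by
    intro z
    have h1 : HasDerivAt (fun s : ℂ => (s • z, (0 : ℂ))) ((z, (0 : ℂ)) : Ambient n) 0 := by
      have : HasDerivAt (fun s : ℂ => s • z) z 0 := by
        simpa using (hasDerivAt_id (0 : ℂ)).smul_const z
      exact this.prodMk (hasDerivAt_const _ _)
    have h2 : HasDerivAt (fun s : ℂ => (A (s • z, 0)).1) (fderiv ℂ A 0 (z, 0)).1 0 := by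
      have := HasFDerivAt.comp_hasDerivAt (0 : ℂ) (l := fun x => (A x).1)
        (f := fun s : ℂ => ((s • z, (0 : ℂ)) : Ambient n))
        (by rw [zero_smul]; exact hd.fst) h1
      exact this
    -- The power `0 ^ m` equals one when `m = 0`; the leading factor `s` makes the derivative at `0`
    -- the same in all cases.
    have h3 : ∀ s : ℂ, (A (s • z, 0)).1 =
        (s * (1 + 2 * (s * innerSL ℂ a z) * 0 ^ m)⁻¹) • z := by
      intro s
      simp only [hA, mobiusMap, mobiusDenom, map_smul, smul_eq_mul]
      simp [smul_smul, mul_comm]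
    have h4 : HasDerivAt (fun s : ℂ => (1 + 2 * (s * innerSL ℂ a z) * 0 ^ m)⁻¹)
        (-((2 * innerSL ℂ a z * 0 ^ m)) / (1 + 2 * (0 * innerSL ℂ a z) * 0 ^ m) ^ 2) 0 := by
      refine HasDerivAt.fun_inv ?_ (by simp)
      have := ((((hasDerivAt_id (0 : ℂ)).mul_const (innerSL ℂ a z)).const_mul 2).mul_const
        ((0 : ℂ) ^ m)).const_add 1
      simpa using this
    have h5 : HasDerivAt (fun s : ℂ => (A (s • z, 0)).1) z 0 := by
      simp only [h3]
      have := ((hasDerivAt_id (0 : ℂ)).fun_mul h4).smul_const z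
      simpa using this
    exact h2.unique h5
  have hx : x = (x.1, 0) + x.2 • ((0 : ZSpace n), (1 : ℂ)) := by simp
  refine Prod.ext ?_ (hsnd x)
  conv_lhs => rw [hx, map_add, map_smul]
  simp [hfst]

variable {Φ : ZSpace n → ℂ} {N : ℕ}

/-- Approximate maps whose center curve vanishes to high order. -/
theorem exists_isLittleO_center {h : Ambient n → Ambient n} (hh : IsApproxMap Φ N h)
    (ht : IsTangential h) (K : ℕ) :
    ∃ h', IsApproxMap Φ N h' ∧ IsTangential h' ∧
      (fun t : ℝ => (h' (0, (t : ℂ))).1) =o[𝓝 0] fun t => t ^ K := by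
  have hax : ∀ {h : Ambient n → Ambient n}, AnalyticAt ℂ h 0 →
      AnalyticAt ℝ (fun t : ℝ => (h (0, (t : ℂ))).1) 0 := by
    intro h hh
    have h1 : AnalyticAt ℂ (fun w : ℂ => (h (0, w)).1) 0 :=
      analyticAt_fst.comp (hh.comp_of_eq (analyticAt_axis 0) rfl)
    exact (h1.restrictScalars (𝕜 := ℝ)).comp_of_eq (analyticAt_ofReal 0) Complex.ofReal_zero
  induction K with
  | zero =>
    refine ⟨h, hh, ht, ?_⟩
    simp only [pow_zero]
    rw [isLittleO_one_iff]
    have := (hax hh.analyticAt).continuousAt.tendsto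
    rwa [Complex.ofReal_zero, show ((0 : ZSpace n), (0 : ℂ)) = 0 from rfl, hh.map_zero] at this
  | succ m ih =>
    obtain ⟨h, hh, ht, ho⟩ := ih
    obtain ⟨c, hc⟩ := exists_isLittleO_sub_smul (hax hh.analyticAt) ho
    -- The Möbius map moves `(0, t)` by `2 t ^ (m + 1) a` to leading order, and `h` has
    -- `z`-derivative one in `z` at `0`; this choice cancels `t ^ (m + 1) c`.
    set a : ZSpace n := (-(1 / 2) : ℂ) • c with ha
    set A := mobiusMap m a with hA
    have hAq := isQuadricMap_mobiusMap m a
    refine ⟨h ∘ A, hh.comp hAq, ht.comp (isTangential_mobiusMap m a) hh.analyticAt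
      hAq.analyticAt hAq.map_zero, ?_⟩
    obtain ⟨b, hb⟩ := ht
    set τ : ℝ → ℝ := fun t => ‖a‖ ^ 2 * t ^ (2 * m + 1) with hτ
    have hτ0 : Tendsto τ (𝓝 0) (𝓝 0) := by
      have : Continuous τ := by fun_prop
      simpa [hτ] using this.tendsto 0
    set β : ℝ → ZSpace n := fun t => (-(t ^ (m + 1) * (1 + τ t)⁻¹)) • c with hβ
    have hAt : ∀ t : ℝ, A (0, (t : ℂ)) = (β t, (t : ℂ)) := by
      intro t
      simp only [hA, mobiusMap_axis, hβ, hτ]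
      congr 1
      rw [← Complex.coe_smul]
      nth_rw 2 [ha]
      rw [smul_smul]
      push_cast
      congr 1
      ring
    have hβO : β =O[𝓝 0] fun t => t ^ (m + 1) := by
      have h1 : (fun t => (1 + τ t)⁻¹) =O[𝓝 0] fun _ => (1 : ℝ) := by
        have : Tendsto (fun t => (1 + τ t)⁻¹) (𝓝 0) (𝓝 (1 + 0)⁻¹) :=
          (hτ0.const_add 1).inv₀ (by norm_num)
        exact this.isBigO_one ℝ
      have h2 := ((isBigO_refl (fun t : ℝ => t ^ (m + 1)) (𝓝 0)).mul h1).neg_left.smul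
        (isBigO_const_const c (one_ne_zero (α := ℝ)) (𝓝 0))
      exact (h2.congr_left fun t => rfl).congr_right fun t => by simp
    have hs := hh.analyticAt.hasStrictFDerivAt.isLittleO
    have htend : Tendsto (fun t : ℝ => (((β t, (t : ℂ)) : Ambient n), ((0 : ZSpace n), (t : ℂ))))
        (𝓝 0) (𝓝 (0, 0)) := by
      have hβt : Tendsto β (𝓝 0) (𝓝 0) := hβO.trans_tendsto (by
        have : Continuous fun t : ℝ => t ^ (m + 1) := by fun_prop
        simpa using this.tendsto 0)
      exact (hβt.prodMk_nhds tendsto_ofReal).prodMk_nhds (tendsto_axis.comp tendsto_ofReal)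
    -- Strict differentiability is needed because both points move with `t`.
    have h1 : (fun t : ℝ => (h (β t, (t : ℂ)) - h (0, (t : ℂ)) - (β t, 0)).1) =o[𝓝 0]
        fun t => t ^ (m + 1) := by
      have h2 : ((fun p : Ambient n × Ambient n => p.1 - p.2) ∘
          fun t : ℝ => ((β t, (t : ℂ)), ((0 : ZSpace n), (t : ℂ)))) =O[𝓝 0]
          fun t => t ^ (m + 1) :=
        IsBigO.of_norm_left (hβO.norm_left.congr_left fun t => by simp)
      have h2 := (hs.comp_tendsto htend).trans_isBigO h2
      have h3 : (fun t : ℝ => (h (β t, (t : ℂ)) - h (0, (t : ℂ)) - (β t, 0) : Ambient n))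
          =o[𝓝 0] fun t => t ^ (m + 1) := by
        refine h2.congr_left fun t => ?_
        simp only [Function.comp_apply]
        rw [hb]
        simp
      exact IsBigO.trans_isLittleO (IsBigO.of_bound 1 (Eventually.of_forall fun t => by
        rw [one_mul]; exact norm_fst_le _)) h3
    have h3 : (fun t : ℝ => t ^ (m + 1) • (c - (1 + τ t)⁻¹ • c)) =o[𝓝 0]
        fun t => t ^ (m + 1) := by
      have h4 : (fun t : ℝ => c - (1 + τ t)⁻¹ • c) =o[𝓝 0] fun _ => (1 : ℝ) := by
        rw [isLittleO_one_iff]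
        have : Tendsto (fun t => c - (1 + τ t)⁻¹ • c) (𝓝 0) (𝓝 (c - (1 + 0 : ℝ)⁻¹ • c)) :=
          (((hτ0.const_add 1).inv₀ (by norm_num)).smul_const c).const_sub c
        simpa using this
      simpa using (isBigO_refl (fun t : ℝ => t ^ (m + 1)) (𝓝 0)).smul_isLittleO h4
    refine ((h1.add hc).add h3).congr_left fun t => ?_
    simp only [Function.comp_apply]
    rw [hAt, hβ, Prod.fst_sub, Prod.fst_sub]
    simp only [smul_sub, neg_smul, mul_smul]
    abel

end Mobius

end CRSingular

namespace CRSingular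

open MvPowerSeries (truncTotal coeff constantCoeff)

/-! ### Self-adjointness to finite order and unitary exponentials. -/

section StarAlgebra

variable {A : Type*} [NormedRing A]

/-- A family of elements which is self-adjoint up to terms that are `o(t ^ m)`. -/
def IsHermitianTo [StarRing A] (D : ℝ → A) (m : ℕ) : Prop :=
  (fun t => D t - star (D t)) =o[𝓝 0] fun t => t ^ m

theorem analyticAt_exp_pow_smul [NormedAlgebra ℂ A] [CompleteSpace A] (k : ℕ) (B : A) (w : ℂ) :
    AnalyticAt ℂ (fun w : ℂ => NormedSpace.exp (w ^ k • B)) w :=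
  (NormedSpace.exp_analytic (𝕂 := ℂ) _).comp ((analyticAt_id.pow k).smul analyticAt_const)

theorem exp_zero_pow_smul [NormedAlgebra ℂ A] {k : ℕ} (hk : k ≠ 0) (B : A) :
    NormedSpace.exp ((0 : ℂ) ^ k • B) = 1 := by
  rw [zero_pow hk, zero_smul, NormedSpace.exp_zero]

theorem star_real_smul [NormedAlgebra ℂ A] [StarRing A] [StarModule ℂ A] (r : ℝ) (T : A) :
    star (r • T) = r • star T := by
  rw [← Complex.coe_smul, star_smul, ← Complex.coe_smul]
  simp

theorem analyticAt_star [NormedAlgebra ℂ A] [StarRing A] [StarModule ℂ A] [CStarRing A]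
    {f : ℝ → A} (hf : AnalyticAt ℝ f 0) : AnalyticAt ℝ (fun t => star (f t)) 0 :=
  (((starL' ℝ : A ≃L[ℝ] A) : A →L[ℝ] A).analyticAt _).comp hf

variable [StarRing A] [CStarRing A]

theorem isLittleO_star {f : ℝ → A} {g : ℝ → ℝ} (h : f =o[𝓝 0] g) :
    (fun t => star (f t)) =o[𝓝 0] g :=
  (h.norm_left.congr_left fun t => (norm_star (f t)).symm).of_norm_left

theorem isHermitianTo_zero {D : ℝ → A} (h1 : Tendsto D (𝓝 0) (𝓝 1)) :
    IsHermitianTo D 0 := by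
  simp only [IsHermitianTo, pow_zero]
  rw [isLittleO_one_iff]
  simpa using h1.sub (h1.star)

variable [NormedAlgebra ℂ A] [CompleteSpace A] [StarModule ℂ A]

theorem exp_ofReal_pow_smul_mem_unitary {B : A} (hB : star B = -B) (k : ℕ) (t : ℝ) :
    NormedSpace.exp ((t : ℂ) ^ k • B) ∈ unitary A := by
  have h1 : (t : ℂ) ^ k • B ∈ skewAdjoint A := by
    rw [skewAdjoint.mem_iff, star_smul, hB, smul_neg]
    simp
  let _ : NormedAlgebra ℚ A := NormedAlgebra.restrictScalars ℚ ℂ _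
  exact NormedSpace.exp_mem_unitary_of_mem_skewAdjoint h1

theorem IsHermitianTo.congr {A : Type*} [NormedRing A] [StarRing A] {D D' : ℝ → A} {m : ℕ}
    (h : IsHermitianTo D m) (hD : D =ᶠ[𝓝 0] D') : IsHermitianTo D' m :=
  IsLittleO.congr' h (hD.mono fun t ht => by simp only [ht]) EventuallyEq.rfl

theorem IsHermitianTo.ofReal_smul_comp {A : Type*} [NormedRing A] [StarRing A]
    [NormedAlgebra ℂ A] [StarModule ℂ A] {D : ℝ → A} {m : ℕ} (h : IsHermitianTo D m)
    {u g : ℝ → ℝ} (hu : u =O[𝓝 0] fun _ => (1 : ℝ)) (hg : g =O[𝓝 0] fun t => t) :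
    IsHermitianTo (fun t => (u t : ℂ) • D (g t)) m := by
  have hgt : Tendsto g (𝓝 0) (𝓝 0) := hg.trans_tendsto tendsto_id
  have h2 := hu.smul_isLittleO ((h.comp_tendsto hgt).trans_isBigO (hg.pow m))
  refine h2.congr (fun t => ?_) (fun t => by simp)
  simp only [Function.comp_apply, Complex.coe_smul, star_real_smul, smul_sub]

/-- As `D` tends to `1`, multiplication by `exp(t ^ (m + 1) B)` with `B` skew changes `D - D*` by `2
t ^ (m + 1) B` to leading order, enough to cancel the first surviving coefficient. -/
theorem IsHermitianTo.exists_mul_exp {D : ℝ → A} {m : ℕ} (h : IsHermitianTo D m)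
    (hDan : AnalyticAt ℝ D 0) (h1 : Tendsto D (𝓝 0) (𝓝 1)) :
    ∃ B : A, star B = -B ∧
      IsHermitianTo (fun t => D t * NormedSpace.exp ((t : ℂ) ^ (m + 1) • B)) (m + 1) := by
  obtain ⟨C, hC⟩ := exists_isLittleO_sub_smul (hDan.sub (analyticAt_star hDan)) h
  -- The leading coefficient `C` of a skew family is skew, so this amounts to `-C / 2`;
  -- antisymmetrising makes skewness immediate.
  set B : A := (-(1 / 4) : ℝ) • (C - star C) with hB
  have hBs : star B = -B := by
    rw [hB, star_real_smul, star_sub, star_star, ← smul_neg, neg_sub]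
  refine ⟨B, hBs, ?_⟩
  set X : ℝ → A := fun t => t ^ (m + 1) • B with hX
  have hXs : ∀ t, star (X t) = -X t := fun t => by
    rw [hX]; simp only [star_real_smul, hBs, smul_neg]
  have hXO : X =O[𝓝 0] fun t => t ^ (m + 1) := by
    refine IsBigO.of_bound ‖B‖ (Eventually.of_forall fun t => ?_)
    rw [hX, norm_smul, mul_comm]
  have hXt : Tendsto X (𝓝 0) (𝓝 0) := hXO.trans_tendsto (by
    have : Continuous fun t : ℝ => t ^ (m + 1) := by fun_prop
    simpa using this.tendsto 0)
  set Y : ℝ → A := fun t => NormedSpace.exp (X t) - 1 - X t with hY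
  have hYo : Y =o[𝓝 0] fun t => t ^ (m + 1) := by
    have h1 := (hasFDerivAt_exp_zero (𝕂 := ℂ) (𝔸 := A)).isLittleO
    refine ((h1.comp_tendsto hXt).congr_left fun t => ?_).trans_isBigO
      (hXO.congr_left fun t => ?_)
    · simp [hY, NormedSpace.exp_zero]
    · simp
  have hD : ∀ t, D t * NormedSpace.exp ((t : ℂ) ^ (m + 1) • B) = D t * (1 + X t + Y t) := by
    intro t
    have h4 : X t = (t : ℂ) ^ (m + 1) • B := by
      rw [hX]; simp only [← Complex.coe_smul, Complex.ofReal_pow]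
    rw [← h4]
    simp only [hY]
    congr 1
    abel
  have h1' : (fun t => D t - 1) =o[𝓝 0] fun _ => (1 : ℝ) := by
    rw [isLittleO_one_iff]
    simpa using h1.sub_const 1
  have hD1 : D =O[𝓝 0] fun _ => (1 : ℝ) := h1.isBigO_one ℝ
  have e1 : (fun t : ℝ => D t - star (D t) + (2 : ℝ) • X t) =o[𝓝 0] fun t => t ^ (m + 1) := by
    refine ((hC.sub (isLittleO_star hC)).const_smul_left (1 / 2 : ℝ)).congr_left fun t => ?_
    simp only [hX, hB, Pi.smul_apply, Pi.sub_apply, star_sub, star_star, star_real_smul]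
    module
  have e2 : (fun t : ℝ => (D t - 1) * X t) =o[𝓝 0] fun t => t ^ (m + 1) := by
    simpa using h1'.mul_isBigO hXO
  have e3 : (fun t : ℝ => D t * Y t) =o[𝓝 0] fun t => t ^ (m + 1) := by
    simpa using hD1.mul_isLittleO hYo
  refine IsLittleO.congr_left ((e1.add (e2.sub (isLittleO_star e2))).add
      (e3.sub (isLittleO_star e3))) fun t => ?_
  simp only [hD]
  simp only [star_mul, star_add, star_sub, star_one, hXs]
  rw [two_smul]
  noncomm_ring

end StarAlgebra

section InnerProduct

variable {V : Type*} [NormedAddCommGroup V] [InnerProductSpace ℂ V] [CompleteSpace V]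

theorem norm_exp_ofReal_pow_smul {B : V →L[ℂ] V} (hB : star B = -B) (k : ℕ) (t : ℝ) (z : V) :
    ‖NormedSpace.exp ((t : ℂ) ^ k • B) z‖ = ‖z‖ :=
  ContinuousLinearMap.norm_map_of_mem_unitary (exp_ofReal_pow_smul_mem_unitary hB k t) z

theorem IsHermitianTo.inner_sub_inner {D : ℝ → V →L[ℂ] V} {m : ℕ} (h : IsHermitianTo D m)
    (x y : V) :
    (fun t => inner ℂ x (D t y) - inner ℂ (D t x) y) =o[𝓝 0] fun t : ℝ => t ^ m := by
  refine IsBigO.trans_isLittleO (IsBigO.of_bound (‖x‖ * ‖y‖) (Eventually.of_forall fun t => ?_)) h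
  have h1 : inner ℂ x (D t y) - inner ℂ (D t x) y = inner ℂ x ((D t - star (D t)) y) := by
    rw [sub_apply, inner_sub_right, ContinuousLinearMap.star_eq_adjoint,
      ContinuousLinearMap.adjoint_inner_right]
  rw [h1]
  calc _ ≤ ‖x‖ * ‖(D t - star (D t)) y‖ := norm_inner_le_norm _ _
    _ ≤ ‖x‖ * (‖D t - star (D t)‖ * ‖y‖) := by gcongr; exact ContinuousLinearMap.le_opNorm _ _
    _ = _ := by ring

end InnerProduct

/-! ### Rotations and dilations of the quadric. -/

section Unitary

variable {n : ℕ} {Φ : ZSpace n → ℂ} {N : ℕ}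

/-- The map `(z, w) ↦ (exp(w ^ k B) z, w)`. -/
noncomputable def rotationMap (k : ℕ) (B : ZSpace n →L[ℂ] ZSpace n) :
    Ambient n → Ambient n :=
  fiberMap (fun w => NormedSpace.exp (w ^ k • B)) id

theorem isQuadricMap_rotationMap (k : ℕ) {B : ZSpace n →L[ℂ] ZSpace n} (hB : star B = -B) :
    IsQuadricMap (rotationMap k B) := by
  refine isQuadricMap_fiberMap (analyticAt_exp_pow_smul k B 0) analyticAt_id rfl fun t z hz => ?_
  rw [norm_exp_ofReal_pow_smul hB, hz, id]

theorem isTangential_rotationMap {k : ℕ} (hk : k ≠ 0) (B : ZSpace n →L[ℂ] ZSpace n) :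
    IsTangential (rotationMap k B) :=
  isTangential_fiberMap (analyticAt_exp_pow_smul k B 0).differentiableAt
    (exp_zero_pow_smul hk B) (hasDerivAt_id 0)

theorem analyticAt_zDeriv_ofReal {h : Ambient n → Ambient n} (hh : AnalyticAt ℂ h 0) :
    AnalyticAt ℝ (fun t : ℝ => zDeriv h t) 0 :=
  ((analyticAt_zDeriv hh).restrictScalars (𝕜 := ℝ)).comp_of_eq (analyticAt_ofReal 0)
    Complex.ofReal_zero

theorem IsTangential.tendsto_zDeriv {h : Ambient n → Ambient n} (ht : IsTangential h)
    (hh : AnalyticAt ℂ h 0) : Tendsto (fun t : ℝ => zDeriv h t) (𝓝 0) (𝓝 1) := by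
  have := (analyticAt_zDeriv_ofReal hh).continuousAt.tendsto
  rwa [Complex.ofReal_zero, ht.zDeriv_zero] at this

/-- Rotations fix the axis `z = 0` pointwise, so the centre curve is unchanged, while the derivative
in `z` along it is multiplied on the right by the exponential. -/
theorem exists_isHermitianTo {K : ℕ} {h : Ambient n → Ambient n} (hh : IsApproxMap Φ N h)
    (ht : IsTangential h) (hc : (fun t : ℝ => (h (0, (t : ℂ))).1) =o[𝓝 0] fun t => t ^ K) (m : ℕ) :
    ∃ h', IsApproxMap Φ N h' ∧ IsTangential h' ∧
      (fun t : ℝ => (h' (0, (t : ℂ))).1) =o[𝓝 0] (fun t => t ^ K) ∧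
      IsHermitianTo (fun t : ℝ => zDeriv h' t) m := by
  induction m with
  | zero => exact ⟨h, hh, ht, hc, isHermitianTo_zero (ht.tendsto_zDeriv hh.analyticAt)⟩
  | succ m ih =>
    obtain ⟨h, hh, ht, hc, hF⟩ := ih
    obtain ⟨B, hBs, hB⟩ := hF.exists_mul_exp (analyticAt_zDeriv_ofReal hh.analyticAt)
      (ht.tendsto_zDeriv hh.analyticAt)
    have hAq := isQuadricMap_rotationMap (m + 1) hBs
    refine ⟨h ∘ rotationMap (m + 1) B, hh.comp hAq,
      ht.comp (isTangential_rotationMap (Nat.succ_ne_zero m) B) hh.analyticAt hAq.analyticAt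
        hAq.map_zero, ?_, hB.congr ?_⟩
    · simpa only [Function.comp_apply, rotationMap, fiberMap_axis, id] using hc
    · have h1 := tendsto_ofReal.eventually (zDeriv_comp_fiberMap hh.analyticAt
        (analyticAt_exp_pow_smul (m + 1) B 0) analyticAt_id rfl)
      filter_upwards [h1] with t h2
      rw [rotationMap, h2]
      rfl

theorem hasDerivAt_dilation {m : ℕ} (hm : m ≠ 0) (c : ℂ) :
    HasDerivAt (fun w : ℂ => (1 + c * w ^ m) ^ 2 * w) 1 0 := by
  have h1 : HasDerivAt (fun w : ℂ => (1 + c * w ^ m) ^ 2) _ 0 :=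
    (((hasDerivAt_pow m (0 : ℂ)).const_mul c).const_add 1).fun_pow 2
  refine (h1.fun_mul (hasDerivAt_id (0 : ℂ))).congr_deriv ?_
  simp [hm]

/-- The map `(z, w) ↦ ((1 + c w ^ m) z, (1 + c w ^ m)² w)`. -/
noncomputable def dilationMap (m : ℕ) (c : ℂ) : Ambient n → Ambient n :=
  fiberMap (fun w => (1 + c * w ^ m) • 1) fun w => (1 + c * w ^ m) ^ 2 * w

theorem analyticAt_dilation_left (m : ℕ) (c : ℂ) :
    AnalyticAt ℂ (fun w : ℂ => (1 + c * w ^ m) • (1 : ZSpace n →L[ℂ] ZSpace n)) 0 := by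
  refine ContDiffAt.analyticAt (𝕜 := ℂ) ?_
  fun_prop

theorem analyticAt_dilation_right (m : ℕ) (c : ℂ) :
    AnalyticAt ℂ (fun w : ℂ => (1 + c * w ^ m) ^ 2 * w) 0 := by
  refine ContDiffAt.analyticAt (𝕜 := ℂ) ?_
  fun_prop

theorem isQuadricMap_dilationMap (m : ℕ) (c : ℝ) :
    IsQuadricMap (dilationMap (n := n) m c) := by
  refine isQuadricMap_fiberMap (analyticAt_dilation_left m c) (analyticAt_dilation_right m c)
    (by simp) fun t z hz => ?_
  have h1 : (1 + (c : ℂ) * (t : ℂ) ^ m) = ((1 + c * t ^ m : ℝ) : ℂ) := by push_cast; ring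
  rw [h1, smul_apply, normSq_ofReal_smul, one_apply_eq_self, hz]

theorem isTangential_dilationMap {m : ℕ} (hm : m ≠ 0) (c : ℂ) :
    IsTangential (dilationMap (n := n) m c) :=
  isTangential_fiberMap (analyticAt_dilation_left m c).differentiableAt
    (by simp [hm]) (hasDerivAt_dilation hm c)

/-- Analytic maps from the quadric to a graph up to order `N`, normalised up to order `K`. -/
structure IsNormalMap (Φ : ZSpace n → ℂ) (N K : ℕ) (h : Ambient n → Ambient n) : Prop where
  isApproxMap : IsApproxMap Φ N h
  isTangential : IsTangential h
  center : (fun t : ℝ => (h (0, (t : ℂ))).1) =o[𝓝 0] fun t => t ^ K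
  hermitian : IsHermitianTo (fun t : ℝ => zDeriv h t) K
  re : (fun t : ℝ => (h (0, (t : ℂ))).2.re - t) =o[𝓝 0] fun t => t ^ K

/-- Real dilations reparametrise the axis and multiply the `z`-derivative by a real scalar, so the
centre and Hermitian conditions survive while the real part is corrected one order at a time. -/
theorem exists_isLittleO_re {K : ℕ} {h : Ambient n → Ambient n} (hh : IsApproxMap Φ N h)
    (ht : IsTangential h) (hc : (fun t : ℝ => (h (0, (t : ℂ))).1) =o[𝓝 0] fun t => t ^ K)
    (hF : IsHermitianTo (fun t : ℝ => zDeriv h t) K) (m : ℕ) :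
    ∃ h', IsApproxMap Φ N h' ∧ IsTangential h' ∧
      (fun t : ℝ => (h' (0, (t : ℂ))).1) =o[𝓝 0] (fun t => t ^ K) ∧
      IsHermitianTo (fun t : ℝ => zDeriv h' t) K ∧
      (fun t : ℝ => (h' (0, (t : ℂ))).2.re - t) =o[𝓝 0] fun t => t ^ (m + 1) := by
  have han : ∀ {h : Ambient n → Ambient n}, AnalyticAt ℂ h 0 →
      AnalyticAt ℝ (fun t : ℝ => (h (0, (t : ℂ))).2.re - t) 0 := by
    intro h hh
    have h1 : AnalyticAt ℂ (fun w : ℂ => (h (0, w)).2) 0 :=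
      analyticAt_snd.comp (hh.comp_of_eq (analyticAt_axis 0) rfl)
    have h2 : AnalyticAt ℝ (fun t : ℝ => (h (0, (t : ℂ))).2) 0 :=
      (h1.restrictScalars (𝕜 := ℝ)).comp_of_eq (analyticAt_ofReal 0) Complex.ofReal_zero
    exact ((Complex.reCLM.analyticAt _).comp h2).sub analyticAt_id
  induction m with
  | zero =>
    refine ⟨h, hh, ht, hc, hF, ?_⟩
    obtain ⟨b, hb⟩ := ht
    have h1 := (isBigO_sub_fderiv hh.analyticAt hh.map_zero).comp_tendsto
      (tendsto_axis.comp tendsto_ofReal)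
    have h2 : (fun t : ℝ => (h (0, (t : ℂ))).2.re - t) =O[𝓝 0] fun t : ℝ => t ^ 2 := by
      refine IsBigO.trans (IsBigO.of_bound 1 (Eventually.of_forall fun t => ?_))
        (h1.congr_right fun t => ?_)
      · rw [one_mul]
        refine le_trans ?_ (norm_snd_le _)
        simp only [Function.comp_apply, hb, Prod.snd_sub]
        refine le_trans (le_of_eq ?_) (Complex.abs_re_le_norm _)
        simp
      · simp
    refine h2.trans_isLittleO ?_
    simpa using isLittleO_pow_pow (𝕜 := ℝ) (one_lt_two)
  | succ m ih =>
    obtain ⟨h, hh, ht, hc, hF, hr⟩ := ih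
    obtain ⟨r, hr'⟩ := exists_isLittleO_sub_smul (han hh.analyticAt) hr
    -- The dilation sends `t` to `t + 2 c t ^ (m + 2) + …` on the axis, so `2 c = -r` cancels the
    -- leading error.
    set c : ℝ := -(r / 2) with hcdef
    have hAq := isQuadricMap_dilationMap (n := n) (m + 1) c
    set g : ℝ → ℝ := fun t => (1 + c * t ^ (m + 1)) ^ 2 * t with hg
    have hgc : ∀ t : ℝ, (1 + (c : ℂ) * (t : ℂ) ^ (m + 1)) ^ 2 * (t : ℂ) = ((g t : ℝ) : ℂ) := by
      intro t; rw [hg]; push_cast; ring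
    have hu : Tendsto (fun t : ℝ => 1 + c * t ^ (m + 1)) (𝓝 0) (𝓝 1) := by
      have : Continuous fun t : ℝ => 1 + c * t ^ (m + 1) := by fun_prop
      simpa using this.tendsto 0
    have hgO : g =O[𝓝 0] fun t => t := by
      simpa using ((hu.pow 2).isBigO_one ℝ).mul (isBigO_refl (fun t : ℝ => t) (𝓝 0))
    have hgt : Tendsto g (𝓝 0) (𝓝 0) := hgO.trans_tendsto tendsto_id
    have hax : ∀ t : ℝ, dilationMap (n := n) (m + 1) c (0, (t : ℂ)) = (0, ((g t : ℝ) : ℂ)) := by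
      intro t
      rw [dilationMap, fiberMap_axis, hgc]
    refine ⟨h ∘ dilationMap (m + 1) c, hh.comp hAq,
      ht.comp (isTangential_dilationMap (Nat.succ_ne_zero m) c) hh.analyticAt hAq.analyticAt
        hAq.map_zero, ?_, ?_, ?_⟩
    · simp only [Function.comp_apply, hax]
      exact (hc.comp_tendsto hgt).trans_isBigO (hgO.pow K)
    · have h1 := tendsto_ofReal.eventually (zDeriv_comp_fiberMap hh.analyticAt
        (analyticAt_dilation_left (m + 1) c) (analyticAt_dilation_right (m + 1) c) (by simp))
      refine (hF.ofReal_smul_comp (hu.isBigO_one ℝ) hgO).congr ?_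
      filter_upwards [h1] with t ht
      rw [dilationMap, ht, hgc]
      ext1 v
      simp
    · simp only [Function.comp_apply, hax]
      have hgm : (fun t => g t ^ (m + 2) - t ^ (m + 2)) =o[𝓝 0] fun t => t ^ (m + 2) := by
        have h1 : (fun t : ℝ => ((1 + c * t ^ (m + 1)) ^ 2) ^ (m + 2) - 1) =o[𝓝 0]
            fun _ => (1 : ℝ) := by
          rw [isLittleO_one_iff]
          simpa using ((hu.pow 2).pow (m + 2)).sub_const 1
        refine (h1.mul_isBigO (isBigO_refl (fun t : ℝ => t ^ (m + 2)) (𝓝 0))).congr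
          (fun t => ?_) (fun t => one_mul _)
        have h2 : g t ^ (m + 2) = ((1 + c * t ^ (m + 1)) ^ 2) ^ (m + 2) * t ^ (m + 2) := by
          rw [hg, mul_pow]
        rw [h2]; ring
      have e1 : (fun t => (h (0, ((g t : ℝ) : ℂ))).2.re - g t - g t ^ (m + 2) • r) =o[𝓝 0]
          fun t => t ^ (m + 2) :=
        (hr'.comp_tendsto hgt).trans_isBigO (hgO.pow (m + 2))
      have e2 : (fun t : ℝ => c ^ 2 * t ^ (m + 1) * t ^ (m + 2)) =o[𝓝 0]
          fun t => t ^ (m + 2) := by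
        have h1 : (fun t : ℝ => c ^ 2 * t ^ (m + 1)) =o[𝓝 0] fun _ => (1 : ℝ) := by
          rw [isLittleO_one_iff]
          have : Continuous fun t : ℝ => c ^ 2 * t ^ (m + 1) := by fun_prop
          simpa using this.tendsto 0
        simpa using h1.mul_isBigO (isBigO_refl (fun t : ℝ => t ^ (m + 2)) (𝓝 0))
      refine ((e1.add (hgm.const_mul_left r)).add e2).congr_left fun t => ?_
      have : g t = t + 2 * c * t ^ (m + 2) + c ^ 2 * t ^ (m + 1) * t ^ (m + 2) := by
        rw [hg]; ring
      rw [smul_eq_mul]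
      linear_combination (-1 : ℝ) * this + 2 * t ^ (m + 2) * hcdef

/-- The order is chosen so that each family of automorphisms preserves what has been achieved:
rotations keep the centre condition, dilations keep the centre and Hermitian conditions. -/
theorem exists_isNormalMap {h : Ambient n → Ambient n} (hh : IsApproxMap Φ N h)
    (ht : IsTangential h) (K : ℕ) : ∃ h', IsNormalMap Φ N K h' := by
  obtain ⟨h, hh, ht, hc⟩ := exists_isLittleO_center hh ht K
  obtain ⟨h, hh, ht, hc, hF⟩ := exists_isHermitianTo hh ht hc K
  obtain ⟨h, hh, ht, hc, hF, hr⟩ := exists_isLittleO_re hh ht hc hF K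
  exact ⟨h, hh, ht, hc, hF, isLittleO_pow_mono (Nat.le_succ K) hr⟩

end Unitary

end CRSingular

namespace CRSingular

open MvPowerSeries (truncTotal coeff constantCoeff)

/-! ### From normalised maps to normalised formal solutions -/

section Extraction

theorem isBigO_sum_sub_sum_range {δ : Type*} [DecidableEq δ] {F : Finset δ} {k N : ℕ}
    {ι : ℕ → δ} (hι : Function.Injective ι) (hιF : ∀ m < k, ι m ∈ F) {g : δ → ℝ → ℂ}
    (hg : ∀ d ∈ F, (∀ m < k, ι m ≠ d) → g d =O[𝓝 0] fun t => t ^ N) :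
    (fun t => ∑ d ∈ F, g d t - ∑ m ∈ Finset.range k, g (ι m) t) =O[𝓝 0] fun t => t ^ N := by
  have hsub : (Finset.range k).image ι ⊆ F := by
    intro d hd
    obtain ⟨m, hm, rfl⟩ := Finset.mem_image.1 hd
    exact hιF m (Finset.mem_range.1 hm)
  have h : ∀ t, ∑ d ∈ F, g d t - ∑ m ∈ Finset.range k, g (ι m) t =
      ∑ d ∈ F \ (Finset.range k).image ι, g d t := by
    intro t
    rw [← Finset.sum_sdiff hsub, Finset.sum_image hι.injOn, add_sub_cancel_right]
  simp only [h]
  refine IsBigO.fun_sum fun d hd => ?_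
  rw [Finset.mem_sdiff, Finset.mem_image] at hd
  exact hg d hd.1 fun m hm he => hd.2 ⟨m, Finset.mem_range.2 hm, he⟩

theorem isBigO_pow_pow {j N : ℕ} (hN : N ≤ j) :
    (fun t : ℝ => t ^ j) =O[𝓝 0] fun t => t ^ N :=
  IsBigO.of_norm_left (IsBigO.of_norm_right (by
    simpa only [norm_pow] using isBigO_norm_pow_le (E := ℝ) hN))

theorem isBigO_mul_pow {j N : ℕ} (hN : N ≤ j) (c : ℂ) :
    (fun t : ℝ => c * (t : ℂ) ^ j) =O[𝓝 0] fun t => t ^ N := by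
  refine IsBigO.const_mul_left ?_ c
  refine IsBigO.of_norm_left (IsBigO.of_norm_right ?_)
  simpa only [norm_pow, Complex.norm_real] using isBigO_norm_pow_le (E := ℝ) hN

theorem eq_zero_of_isBigO_mul_pow {c : ℂ} {j : ℕ}
    (h : (fun t : ℝ => c * (t : ℂ) ^ j) =O[𝓝 0] fun t => t ^ (j + 1)) : c = 0 := by
  obtain ⟨C, hC⟩ := h.bound
  have h1 : ∀ᶠ t in 𝓝[>] (0 : ℝ), ‖c‖ ≤ C * t := by
    filter_upwards [nhdsWithin_le_nhds hC, self_mem_nhdsWithin] with t ht ht0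
    have ht0 : 0 < t := ht0
    rw [norm_mul, norm_pow, norm_pow, Complex.norm_real, Real.norm_of_nonneg ht0.le, pow_succ,
      mul_comm (t ^ j), ← mul_assoc] at ht
    exact le_of_mul_le_mul_right ht (pow_pos ht0 j)
  have h2 : Tendsto (fun t : ℝ => C * t) (𝓝[>] 0) (𝓝 0) := by
    have : Continuous fun t : ℝ => C * t := by fun_prop
    simpa using (this.tendsto 0).mono_left nhdsWithin_le_nhds
  exact norm_le_zero_iff.1 (ge_of_tendsto h2 h1)

theorem eq_zero_of_isBigO_sum {k j : ℕ} {a : ℕ → ℂ}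
    (h : (fun t : ℝ => ∑ m ∈ Finset.range k, a m * (t : ℂ) ^ (j + m)) =O[𝓝 0]
      fun t => t ^ (j + k)) : ∀ m < k, a m = 0 := by
  intro m
  induction m using Nat.strong_induction_on with
  | _ m ih =>
    intro hm
    refine eq_zero_of_isBigO_mul_pow (j := j + m) ?_
    have h1 : (fun t : ℝ => ∑ m' ∈ (Finset.range k).erase m, a m' * (t : ℂ) ^ (j + m')) =O[𝓝 0]
        fun t => t ^ (j + m + 1) := by
      refine IsBigO.fun_sum fun m' hm' => ?_
      rw [Finset.mem_erase, Finset.mem_range] at hm'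
      rcases lt_or_gt_of_ne hm'.1 with h2 | h2
      · simp only [ih m' h2 hm'.2, zero_mul]
        exact isBigO_zero _ _
      · exact isBigO_mul_pow (by omega) _
    have h2 := h.trans (isBigO_pow_pow (by omega : j + m + 1 ≤ j + k))
    refine (h2.sub h1).congr_left fun t => ?_
    rw [← Finset.add_sum_erase _ _ (Finset.mem_range.2 hm), add_sub_cancel_right]

/-- The derivative is Lipschitz near `x₀`, so the constant is uniform in the base point, which later
moves along the axis. -/
theorem exists_isBigO_taylor_two {E F : Type*} [NormedAddCommGroup E] [NormedSpace ℂ E]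
    [NormedAddCommGroup F] [NormedSpace ℂ F] [CompleteSpace F] {h : E → F} {x₀ : E}
    (hh : AnalyticAt ℂ h x₀) :
    ∃ C : ℝ, ∃ r > 0, ∀ x ∈ Metric.ball x₀ r, ∀ y ∈ Metric.ball x₀ r,
      ‖h y - h x - fderiv ℂ h x (y - x)‖ ≤ C * ‖y - x‖ ^ 2 := by
  obtain ⟨K, t, ht, hK⟩ := (hh.fderiv.contDiffAt (n := 1)).exists_lipschitzOnWith
  obtain ⟨r, hr, hrt⟩ := Metric.eventually_nhds_iff_ball.1
    ((eventually_mem_set.2 ht).and hh.eventually_analyticAt)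
  refine ⟨K, r, hr, fun x hx y hy => ?_⟩
  let _ : NormedSpace ℝ E := NormedSpace.restrictScalars ℝ ℂ E
  have hseg : segment ℝ x y ⊆ Metric.ball x₀ r := (convex_ball x₀ r).segment_subset hx hy
  have := (convex_segment x y).norm_image_sub_le_of_norm_fderiv_le' (𝕜 := ℂ) (f := h)
    (φ := fderiv ℂ h x) (C := K * ‖y - x‖) (fun z hz => (hrt z (hseg hz)).2.differentiableAt)
    (fun z hz => ?_) (left_mem_segment ℝ x y) (right_mem_segment ℝ x y)
  · linarith
  · have h1 := hK.norm_sub_le (hrt z (hseg hz)).1 (hrt x hx).1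
    refine h1.trans ?_
    gcongr
    rw [← dist_eq_norm, dist_comm z x, ← dist_eq_norm, dist_comm y x]
    have := dist_add_dist_of_mem_segment hz
    linarith [dist_nonneg (x := z) (y := y)]

variable {n : ℕ}

/-- The curve `t ↦ (t ^ k eₗ, t)`. -/
noncomputable def testCurve (k : ℕ) (l : Fin n) (t : ℝ) : Ambient n :=
  (EuclideanSpace.single l ((t : ℂ) ^ k), (t : ℂ))

theorem isBigO_axis : (fun t : ℝ => ((0 : ZSpace n), (t : ℂ))) =O[𝓝 0] fun t => t :=
  IsBigO.of_bound 1 (Eventually.of_forall fun t => by simp)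

theorem isBigO_testCurve {k : ℕ} (hk : 1 ≤ k) (l : Fin n) :
    testCurve k l =O[𝓝 0] fun t => t := by
  refine IsBigO.prod_left ?_ (IsBigO.of_bound 1 (Eventually.of_forall fun t => by simp))
  refine IsBigO.of_norm_left (IsBigO.of_norm_right ?_)
  simpa using isBigO_norm_pow_le (E := ℝ) hk

theorem HasJet.isBigO_comp_curve {f : Ambient n → ℂ} {φ : HolSeries n} {N : ℕ}
    (hf : HasJet holCoord N f φ) {γ : ℝ → Ambient n} (hγ : γ =O[𝓝 0] fun t => t) :
    (fun t => f (γ t) - ∑ d ∈ (Finsupp.finite_of_degree_lt (σ := Fin n ⊕ Unit) N).toFinset,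
      coeff d φ * ∏ s, holCoord (γ t) s ^ d s) =O[𝓝 0] fun t => t ^ N := by
  refine ((IsBigO.comp_tendsto hf (hγ.trans_tendsto tendsto_id)).trans
    (hγ.norm_left.pow N)).congr_left fun t => ?_
  simp only [Function.comp_apply, eval_truncTotal]

theorem isBigO_axis_sub_sum {f : Ambient n → ℂ} {φ : HolSeries n} {N : ℕ}
    (hf : HasJet holCoord N f φ) :
    (fun t : ℝ => f (0, (t : ℂ)) - ∑ m ∈ Finset.range N,
      coeff (Finsupp.single (Sum.inr ()) m) φ * (t : ℂ) ^ m) =O[𝓝 0] fun t => t ^ N := by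
  classical
  have h1 := hf.isBigO_comp_curve isBigO_axis
  have h2 := isBigO_sum_sub_sum_range (k := N) (N := N)
    (F := (Finsupp.finite_of_degree_lt (σ := Fin n ⊕ Unit) N).toFinset)
    (ι := fun m => Finsupp.single (Sum.inr ()) m)
    (g := fun d t => coeff d φ * ∏ s, holCoord ((0 : ZSpace n), (t : ℂ)) s ^ d s)
    (Finsupp.single_injective _) (fun m hm => by simpa using hm) (fun d hd hne => by
      have : ∃ l, d (Sum.inl l) ≠ 0 := by
        by_contra! h0
        rw [Set.Finite.mem_toFinset, Set.mem_ofPred_eq, Finsupp.degree_eq_sum,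
          Fintype.sum_sum_type] at hd
        refine hne (d (Sum.inr ())) (by simpa [h0] using hd) ?_
        ext (l | l)
        · simp [h0]
        · simp
      obtain ⟨l, hl⟩ := this
      refine (isBigO_zero _ _).congr_left fun t => ?_
      rw [Finset.prod_eq_zero (Finset.mem_univ (Sum.inl l)), mul_zero]
      simp [holCoord, hl])
  refine (h1.add h2).congr_left fun t => ?_
  have h3 : ∀ m, ∏ s, holCoord ((0 : ZSpace n), (t : ℂ)) s ^
      (Finsupp.single (Sum.inr ()) m : Fin n ⊕ Unit →₀ ℕ) s = (t : ℂ) ^ m := by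
    intro m
    simp [Fintype.prod_sum_type, holCoord]
  simp only [h3]
  ring

/-- Subtracting the axis value removes pure powers of `w`; other variables `zⱼ` vanish on the curve;
`zₗ²` or `zₗ w ^ k` already has order `2 k`. Only `zₗ w ^ m` with `m < k` remains. -/
theorem isBigO_testCurve_sub_sum {f : Ambient n → ℂ} {φ : HolSeries n} {k : ℕ} (hk : 1 ≤ k)
    (l : Fin n) (hf : HasJet holCoord (2 * k) f φ) :
    (fun t : ℝ => f (testCurve k l t) - f (0, (t : ℂ)) - ∑ m ∈ Finset.range k,
      coeff (Finsupp.single (Sum.inl l) 1 + Finsupp.single (Sum.inr ()) m) φ * (t : ℂ) ^ (k + m))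
      =O[𝓝 0] fun t => t ^ (2 * k) := by
  classical
  set F := (Finsupp.finite_of_degree_lt (σ := Fin n ⊕ Unit) (2 * k)).toFinset
  have h1 := (hf.isBigO_comp_curve (isBigO_testCurve hk l)).sub (hf.isBigO_comp_curve isBigO_axis)
  have hz : ∀ (t : ℝ) (j : Fin n), holCoord ((0 : ZSpace n), (t : ℂ)) (Sum.inl j) = 0 := by
    intro t j; simp [holCoord]
  have hl : ∀ t : ℝ, holCoord (testCurve k l t) (Sum.inl l) = (t : ℂ) ^ k := by
    intro t; simp [holCoord, testCurve]
  have hw : ∀ t : ℝ, holCoord (testCurve k l t) (Sum.inr ()) = (t : ℂ) := by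
    intro t; simp [holCoord, testCurve]
  have hj : ∀ (t : ℝ) (j : Fin n), j ≠ l → holCoord (testCurve k l t) (Sum.inl j) = 0 := by
    intro t j hj; simp [holCoord, testCurve, hj]
  have hpl : ∀ (t : ℝ) (d : Fin n ⊕ Unit →₀ ℕ), (∀ j, j ≠ l → d (Sum.inl j) = 0) →
      ∏ s, holCoord (testCurve k l t) s ^ d s = (t : ℂ) ^ (k * d (Sum.inl l) + d (Sum.inr ())) := by
    intro t d hd
    rw [Fintype.prod_sum_type, Finset.prod_eq_single l (fun j _ hj' => by rw [hd j hj', pow_zero])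
      (by simp)]
    simp [hl, hw, pow_add, pow_mul]
  have hp0 : ∀ (t : ℝ) (d : Fin n ⊕ Unit →₀ ℕ) (j : Fin n), d (Sum.inl j) ≠ 0 →
      ∏ s, holCoord ((0 : ZSpace n), (t : ℂ)) s ^ d s = 0 := by
    intro t d j hd
    rw [Finset.prod_eq_zero (Finset.mem_univ (Sum.inl j))]
    rw [hz, zero_pow hd]
  set ι : ℕ → Fin n ⊕ Unit →₀ ℕ := fun m => Finsupp.single (Sum.inl l) 1 +
    Finsupp.single (Sum.inr ()) m with hι
  have hιl : ∀ m, ι m (Sum.inl l) = 1 := by intro m; simp [hι]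
  have hιw : ∀ m, ι m (Sum.inr ()) = m := by intro m; simp [hι]
  have hιj : ∀ m j, j ≠ l → ι m (Sum.inl j) = 0 := by intro m j hj; simp [hι, hj.symm]
  have h2 := isBigO_sum_sub_sum_range (k := k) (N := 2 * k) (F := F) (ι := ι)
    (g := fun d t => coeff d φ * (∏ s, holCoord (testCurve k l t) s ^ d s -
      ∏ s, holCoord ((0 : ZSpace n), (t : ℂ)) s ^ d s))
    (fun m m' h => by rw [← hιw m, h, hιw]) (fun m hm => by simp [F, hι]; omega)
    (fun d hd hne => by
      by_cases h0 : ∀ j, j ≠ l → d (Sum.inl j) = 0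
      · rcases Nat.eq_zero_or_pos (d (Sum.inl l)) with h3 | h3
        · refine (isBigO_zero _ _).congr_left fun t => ?_
          have : ∀ j, d (Sum.inl j) = 0 := fun j => by
            by_cases hjl : j = l
            · rw [hjl, h3]
            · exact h0 j hjl
          simp only [Fintype.prod_sum_type, this, pow_zero, Finset.prod_const_one]
          simp [testCurve, holCoord]
        · refine (isBigO_mul_pow (j := k * d (Sum.inl l) + d (Sum.inr ())) ?_
            (coeff d φ)).congr_left fun t => ?_
          · rcases Nat.lt_or_ge (d (Sum.inl l)) 2 with h4 | h4
            · have h5 : d (Sum.inl l) = 1 := by omega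
              have h6 : k ≤ d (Sum.inr ()) := by
                by_contra! h6
                refine hne _ h6 ?_
                ext (j | j)
                · by_cases hjl : j = l
                  · rw [hjl, hιl, h5]
                  · rw [hιj _ _ hjl, h0 j hjl]
                · exact hιw _
              rw [h5]; omega
            · calc 2 * k = k * 2 := mul_comm _ _
                _ ≤ k * d (Sum.inl l) := by gcongr
                _ ≤ _ := Nat.le_add_right _ _
          · rw [hpl t d h0, hp0 t d l h3.ne', sub_zero]
      · push Not at h0
        obtain ⟨j, hjl, hdj⟩ := h0
        refine (isBigO_zero _ _).congr_left fun t => ?_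
        rw [hp0 t d j hdj, Finset.prod_eq_zero (Finset.mem_univ (Sum.inl j)), sub_zero, mul_zero]
        rw [hj t j hjl, zero_pow hdj])
  refine (h1.add h2).congr_left fun t => ?_
  have h3 : ∀ m, coeff (ι m) φ * (∏ s, holCoord (testCurve k l t) s ^ ι m s -
      ∏ s, holCoord ((0 : ZSpace n), (t : ℂ)) s ^ ι m s) = coeff (ι m) φ * (t : ℂ) ^ (k + m) := by
    intro m
    rw [hpl t _ (hιj m), hp0 t _ l (by rw [hιl]; exact one_ne_zero), hιl, hιw, mul_one, sub_zero]
  simp only [h3, mul_sub, Finset.sum_sub_distrib]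
  ring

end Extraction

end CRSingular

namespace CRSingular

open MvPowerSeries (truncTotal coeff constantCoeff)

/-! ### Reading a normalised formal solution off a normalised map. -/

section Conversion

variable {n : ℕ} {Φ : ZSpace n → ℂ}

theorem coeff_single_of_hasFDerivAt {f : Ambient n → ℂ} {φ : HolSeries n}
    (hf : HasJet holCoord 2 f φ) {L : Ambient n →L[ℂ] ℂ} (hL : HasFDerivAt f L 0)
    (s : Fin n ⊕ Unit) : coeff (Finsupp.single s 1) φ = L (holBasis s) := by
  classical
  rw [hL.unique hf.hasFDerivAt]
  have h : ∀ t, holCoord (holBasis s : Ambient n) t = if s = t then 1 else 0 := by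
    intro t
    have := holCoord_sum_smul (n := n) (fun t => if s = t then 1 else 0) t
    simpa using this
  rw [sum_apply, Finset.sum_eq_single s]
  · simp [h]
  · intro t _ ht
    simp [h, ht.symm]
  · simp

theorem IsNormalMap.exists_hasJet {N K : ℕ} {h : Ambient n → Ambient n} (hh : IsNormalMap Φ N K h)
    (s : Fin n ⊕ Unit) : ∃ φ : HolSeries n, ∀ N, HasJet holCoord N (fun x => holCoord (h x) s) φ := by
  refine exists_series_of_eventually_differentiableAt ?_
  filter_upwards [hh.isApproxMap.analyticAt.eventually_analyticAt] with x hx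
  simp only [← holCoordCLM_apply]
  exact (holCoordCLM s).differentiableAt.comp x hx.differentiableAt

/-- The increment of `h` from the axis to the test curve is computed twice: by the derivative at the
moving axis point, with error `O(t ^ (2 k))`, and by the Taylor series at `0`. Comparison identifies
the coefficients of `z w ^ m` with those of `zDeriv`. -/
theorem isBigO_hermitian {h : Ambient n → Ambient n} (hh : AnalyticAt ℂ h 0) {k : ℕ} (hk : 1 ≤ k)
    (i l : Fin n) {φ : HolSeries n}
    (hφ : HasJet holCoord (2 * k) (fun x => holCoord (h x) (Sum.inl i)) φ) :
    (fun t : ℝ => (t : ℂ) ^ k * zDeriv h t (EuclideanSpace.single l 1) i -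
      ∑ m ∈ Finset.range k, coeff (Finsupp.single (Sum.inl l) 1 + Finsupp.single (Sum.inr ()) m) φ *
        (t : ℂ) ^ (k + m)) =O[𝓝 0] fun t => t ^ (2 * k) := by
  obtain ⟨C, r, hr, hC⟩ := exists_isBigO_taylor_two hh
  have h1 : (fun t : ℝ => h (testCurve k l t) - h (0, (t : ℂ)) -
      fderiv ℂ h (0, (t : ℂ)) (EuclideanSpace.single l ((t : ℂ) ^ k), 0)) =O[𝓝 0]
      fun t => t ^ (2 * k) := by
    refine IsBigO.of_bound C ?_
    filter_upwards [(isBigO_testCurve hk l).trans_tendsto tendsto_id (Metric.ball_mem_nhds _ hr),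
      (isBigO_axis (n := n)).trans_tendsto tendsto_id (Metric.ball_mem_nhds _ hr)] with t ht1 ht2
    have h2 : testCurve k l t - (0, (t : ℂ)) = (EuclideanSpace.single l ((t : ℂ) ^ k), 0) := by
      simp [testCurve]
    have := hC _ ht2 _ ht1
    rw [h2] at this
    refine this.trans (le_of_eq ?_)
    rw [Prod.norm_mk, PiLp.norm_single, norm_zero, max_eq_left (norm_nonneg _)]
    rw [norm_pow, norm_pow, Complex.norm_real, ← pow_mul, mul_comm k 2]
  have h3 : (fun t : ℝ => holCoord (h (testCurve k l t)) (Sum.inl i) -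
      holCoord (h (0, (t : ℂ))) (Sum.inl i) - (t : ℂ) ^ k *
        zDeriv h t (EuclideanSpace.single l 1) i) =O[𝓝 0] fun t => t ^ (2 * k) := by
    refine (((holCoordCLM (Sum.inl i)).isBigO_comp _ _).trans h1).congr_left fun t => ?_
    have h4 : ((EuclideanSpace.single l ((t : ℂ) ^ k), 0) : Ambient n) =
        (t : ℂ) ^ k • (EuclideanSpace.single l 1, 0) := by
      ext1
      · ext j
        simp
      · simp
    rw [h4, map_smul, map_sub, map_sub, map_smul]
    simp [holCoord, zDeriv_apply]
  refine ((isBigO_testCurve_sub_sum hk l hφ).sub h3).congr_left fun t => ?_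
  ring

theorem hasJet_sub_comp_quadPoint {ε : RealSeries n} {p : Fin n → HolSeries n} {q : HolSeries n}
    (hp : ∀ l, constantCoeff (p l) = 0) (hΦ : HasExpansion Φ (quadSeries n + ε))
    {h : Ambient n → Ambient n} (hhO : h =O[𝓝 0] fun x => ‖x‖) {N : ℕ} (hN : 1 ≤ N)
    (hP : ∀ l, HasJet holCoord N (fun x => holCoord (h x) (Sum.inl l))
      (MvPowerSeries.X (Sum.inl l) + p l))
    (hQ : HasJet holCoord N (fun x => holCoord (h x) (Sum.inr ()))
      (MvPowerSeries.X (Sum.inr ()) + q)) :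
    HasJet realCoord N (fun z => (h (quadPoint z)).2 - Φ (h (quadPoint z)).1)
      (linPart p q - nonlin ε p) := by
  have hgen : ∀ l, MvPowerSeries.X (Sum.inl l) + onQuadric (p l) =
      onQuadric (MvPowerSeries.X (Sum.inl l) + p l) := fun l => by
    rw [onQuadric_add, onQuadric_X_inl]
  have hj : ∀ l, HasJet realCoord N (fun z => holCoord (h (quadPoint z)) (Sum.inl l))
      (MvPowerSeries.X (Sum.inl l) + onQuadric (p l)) := fun l => by
    rw [hgen]
    exact (hasJet_quadSeries N).restrictToGraph hN (constantCoeff_quadSeries n) (hP l)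
  have hjQ := (hasJet_quadSeries N).restrictToGraph hN (constantCoeff_quadSeries n) hQ
  have hO : (fun z => (h (quadPoint z)).1) =O[𝓝 0] fun z => ‖z‖ :=
    isBigO_fst_prod'.trans ((hhO.comp_tendsto tendsto_quadPoint).trans isBigO_quadPoint.norm_left)
  have h1 : HasJet realCoord N (fun z => Φ (h (quadPoint z)).1)
      (MvPowerSeries.subst (perturbedGen p) (quadSeries n + ε)) := by
    refine HasJet.comp isCoord_realCoord (tendsto_zero_of_isBigO_norm hO) hO ?_
      (constantCoeff_perturbedGen hp) (hΦ.hasJet N)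
    rintro (l | l)
    · exact hj l
    · exact (hj l).conj
  rw [← onQuadric_sub_subst_eq ε q hp]
  exact hjQ.sub h1

/-- The asymptotic conditions along the axis become conditions on the Taylor coefficients of `h -
id`, and the approximate mapping property becomes the equation by uniqueness of jets in `(z, z̄)`.
-/
theorem IsNormalMap.exists_isNormalSolution {ε : RealSeries n} {M : ℕ}
    (hΦ : HasExpansion Φ (quadSeries n + ε)) {h : Ambient n → Ambient n}
    (hh : IsNormalMap Φ (M + 1) (M + 1) h) : ∃ p q, IsNormalSolution ε M p q := by
  classical
  choose S hS using hh.exists_hasJet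
  have hS0 : ∀ s, constantCoeff (S s) = 0 := fun s => by
    rw [← (hS s 1).apply_zero isCoord_holCoord le_rfl, hh.isApproxMap.map_zero]
    rcases s with j | j <;> rfl
  obtain ⟨b, hb⟩ := hh.isTangential
  have hlin : ∀ s t, coeff (Finsupp.single t 1) (S s) =
      holCoord (fderiv ℂ h 0 (holBasis t)) s := by
    intro s t
    have h1 : HasFDerivAt (fun x => holCoord (h x) s) ((holCoordCLM s).comp (fderiv ℂ h 0)) 0 := by
      simpa only [Function.comp_def, holCoordCLM_apply] using
        (holCoordCLM s).hasFDerivAt.comp (0 : Ambient n)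
          hh.isApproxMap.analyticAt.differentiableAt.hasFDerivAt
    rw [coeff_single_of_hasFDerivAt (hS s 2) h1 t, ContinuousLinearMap.comp_apply,
      holCoordCLM_apply]
  set p : Fin n → HolSeries n := fun l => S (Sum.inl l) - MvPowerSeries.X (Sum.inl l) with hp
  set q : HolSeries n := S (Sum.inr ()) - MvPowerSeries.X (Sum.inr ()) with hq
  have hvan : ∀ l d, hweight d ≤ 1 → coeff d (p l) = 0 := by
    intro l d hd
    rw [hweight] at hd
    have hw : d (Sum.inr ()) = 0 := by
      have := Finsupp.le_degree (Sum.inr ()) d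
      omega
    rcases Nat.eq_zero_or_pos d.degree with h0 | h0
    · rw [(Finsupp.degree_eq_zero_iff d).1 h0]
      simp [hp, hS0]
    · have h1 : d.degree = 1 := by omega
      obtain ⟨s, rfl⟩ := (Finsupp.sum_eq_one_iff d).1 h1
      rcases s with j | j
      · rw [hp]
        simp only [map_sub, hlin, hb, MvPowerSeries.coeff_X]
        simp [holCoord, holBasis, Finsupp.single_left_inj, eq_comm]
      · simp at hw
  have hp0 : ∀ l, constantCoeff (p l) = 0 := fun l => by simp [hp, hS0]
  refine ⟨p, q, hvan, ⟨?_, ?_, ?_⟩, ?_⟩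
  · intro l m hm
    have h1 := isBigO_axis_sub_sum (hS (Sum.inl l) (M + 1))
    have h2 : (fun t : ℝ => holCoord (h (0, (t : ℂ))) (Sum.inl l)) =O[𝓝 0]
        fun t => t ^ (M + 1) := by
      refine IsBigO.trans (IsBigO.of_bound 1 (Eventually.of_forall fun t => ?_)) hh.center.isBigO
      rw [one_mul]
      exact PiLp.norm_apply_le _ l
    have h3 := eq_zero_of_isBigO_sum (k := M + 1) (j := 0)
      (a := fun m => coeff (Finsupp.single (Sum.inr ()) m) (S (Sum.inl l)))
      ((h2.sub h1).congr (fun t => by simp) (fun t => by simp)) m (by omega)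
    have h4 : (Finsupp.single (Sum.inr ()) m : Fin n ⊕ Unit →₀ ℕ) ≠ Finsupp.single (Sum.inl l) 1 :=
      fun h => by simpa using DFunLike.congr_fun h (Sum.inl l)
    rw [hp, map_sub, h3, MvPowerSeries.coeff_X, if_neg h4, sub_zero]
  · intro i l m hm
    have hM : 1 ≤ M + 1 := by omega
    have h1 := isBigO_hermitian hh.isApproxMap.analyticAt hM i l
      (hS (Sum.inl i) _)
    have h2 := isBigO_hermitian hh.isApproxMap.analyticAt hM l i
      (hS (Sum.inl l) _)
    have h3 := hh.hermitian.inner_sub_inner (EuclideanSpace.single i 1) (EuclideanSpace.single l 1)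
    have h3' : (fun t : ℝ => (t : ℂ) ^ (M + 1) * (zDeriv h t (EuclideanSpace.single l 1) i -
        starRingEnd ℂ (zDeriv h t (EuclideanSpace.single i 1) l))) =O[𝓝 0]
        fun t => t ^ (2 * (M + 1)) := by
      have := (isBigO_mul_pow (le_refl (M + 1)) 1).mul h3.isBigO
      refine this.congr (fun t => ?_) (fun t => by ring)
      simp [EuclideanSpace.inner_single_left, EuclideanSpace.inner_single_right]
    have h2' : (fun t : ℝ => starRingEnd ℂ ((t : ℂ) ^ (M + 1) *
        zDeriv h t (EuclideanSpace.single i 1) l -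
        ∑ m ∈ Finset.range (M + 1), coeff (Finsupp.single (Sum.inl i) 1 +
          Finsupp.single (Sum.inr ()) m) (S (Sum.inl l)) * (t : ℂ) ^ (M + 1 + m))) =O[𝓝 0]
        fun t => t ^ (2 * (M + 1)) :=
      (h2.norm_left.congr_left fun t => (RCLike.norm_conj _).symm).of_norm_left
    have h4 := eq_zero_of_isBigO_sum (k := M + 1) (j := M + 1)
      (a := fun m => coeff (Finsupp.single (Sum.inl l) 1 + Finsupp.single (Sum.inr ()) m)
        (S (Sum.inl i)) - starRingEnd ℂ (coeff (Finsupp.single (Sum.inl i) 1 +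
          Finsupp.single (Sum.inr ()) m) (S (Sum.inl l))))
      (((h3'.sub h1).add h2').congr (fun t => by
        simp only [sub_mul, Finset.sum_sub_distrib, map_sub, map_mul, map_pow, map_sum,
          Complex.conj_ofReal]
        ring) (fun t => by ring)) m (by omega)
    -- The identity map contributes a Kronecker delta, which is Hermitian, so subtracting it does
    -- not disturb the condition.
    have h5 : starRingEnd ℂ (coeff (Finsupp.single (Sum.inl i) 1 + Finsupp.single (Sum.inr ()) m)
        (MvPowerSeries.X (Sum.inl l) : HolSeries n)) =
        coeff (Finsupp.single (Sum.inl l) 1 + Finsupp.single (Sum.inr ()) m)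
        (MvPowerSeries.X (Sum.inl i) : HolSeries n) := by
      have h6 : ∀ a b : Fin n, (Finsupp.single (Sum.inl a) 1 + Finsupp.single (Sum.inr ()) m :
          Fin n ⊕ Unit →₀ ℕ) = Finsupp.single (Sum.inl b) 1 ↔ a = b ∧ m = 0 := by
        intro a b
        constructor
        · intro h
          have h7 := DFunLike.congr_fun h (Sum.inr ())
          have h8 := DFunLike.congr_fun h (Sum.inl b)
          simp only [Finsupp.add_apply, Finsupp.single_apply] at h7 h8
          simp at h7 h8
          exact ⟨h8, h7⟩
        · rintro ⟨rfl, rfl⟩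
          simp
      rw [MvPowerSeries.coeff_X, MvPowerSeries.coeff_X]
      simp only [h6, eq_comm (a := i)]
      split_ifs <;> simp
    simp only [hp, map_sub]
    rw [h5, sub_eq_zero.1 h4]
  · intro m hm
    have h1 := isBigO_axis_sub_sum ((hS (Sum.inr ()) (M + 1)).sub
      (hasJet_coord isCoord_holCoord (M + 1) (Sum.inr ())))
    have h1' := (Complex.reCLM.isBigO_comp _ _).trans h1
    have h3 := eq_zero_of_isBigO_sum (k := M + 1) (j := 0)
      (a := fun m => ((coeff (Finsupp.single (Sum.inr ()) m) q).re : ℂ))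
      (((Complex.ofRealCLM.isBigO_comp _ _).trans (hh.re.isBigO.sub h1')).congr (fun t => by
        simp [holCoord, ← Complex.ofReal_pow, hq]) (fun t => by simp)) m (by omega)
    exact_mod_cast h3
  · have hX : ∀ s, MvPowerSeries.X s + (S s - MvPowerSeries.X s) = S s := fun s =>
      add_sub_cancel _ _
    have h2 := (hasJet_sub_comp_quadPoint (p := p) (q := q) hp0 hΦ
      (hh.isApproxMap.analyticAt.isBigO_norm hh.isApproxMap.map_zero) (N := M + 1) (by omega)
      (fun l => by rw [hp, hX]; exact hS _ _) (by rw [hq, hX]; exact hS _ _)).congr_fun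
      (g := fun _ => 0) (hh.isApproxMap.isBigO.congr_left fun z => by simp)
    intro e he
    have := separatesJets_realCoord _ _ h2 e (by omega)
    rwa [map_sub, sub_eq_zero] at this

end Conversion

end CRSingular

namespace CRSingular

open MvPowerSeries (truncTotal coeff constantCoeff)

/-! ### Existence of normalised solutions -/

section FormalToNormal

variable {n : ℕ} {Φ : ZSpace n → ℂ}

theorem HasExpansion.isBigO_sub_normSq {ε : RealSeries n} (hε : VanishesTo 3 ε)
    (hΦ : HasExpansion Φ (quadSeries n + ε)) :
    (fun z => Φ z - ((‖z‖ ^ 2 : ℝ) : ℂ)) =O[𝓝 0] fun z => ‖z‖ ^ 3 :=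
  ((hΦ.hasJet 3).sub (hasJet_quadSeries 3)).isBigO isCoord_realCoord le_rfl fun d hd => by
    rw [add_sub_cancel_left, hε d hd]

theorem HasExpansion.isBigO_sq {ε : RealSeries n} (hε : VanishesTo 3 ε)
    (hΦ : HasExpansion Φ (quadSeries n + ε)) : Φ =O[𝓝 0] fun z => ‖z‖ ^ 2 :=
  (((hΦ.isBigO_sub_normSq hε).trans (isBigO_norm_pow_le (by norm_num))).add
    isBigO_normSq).congr_left fun z => by ring

theorem exists_isNormalSolution_of_mapsGraph (i : Fin n) {ε : RealSeries n} (hε : VanishesTo 3 ε)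
    (hΦ : HasExpansion Φ (quadSeries n + ε)) {H : Fin n ⊕ Unit → HolSeries n}
    (hH : IsFormalTransformation H) (hmap : MapsGraph H (quadSeries n + ε) (quadSeries n))
    (M : ℕ) : ∃ p q, IsNormalSolution ε M p q := by
  have h0 : constantCoeff (quadSeries n + ε) = 0 := by
    have := hε 0 (by simp)
    rw [map_add, constantCoeff_quadSeries, zero_add]
    simpa using this
  -- Order at least three is required to normalise the derivative; the surplus is discarded at the
  -- end.
  obtain ⟨h, hh, L, hL⟩ := exists_isApproxMap_of_mapsGraph h0 hΦ (hΦ.isBigO_sq hε) hH hmap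
    (N := M + 3) (by omega)
  obtain ⟨h, hh, ht⟩ := hh.exists_isTangential i (by omega) (hΦ.isBigO_sub_normSq hε) hL
  obtain ⟨h, hh⟩ := exists_isNormalMap hh ht (M + 3)
  obtain ⟨p, q, hpq⟩ := hh.exists_isNormalSolution (M := M + 2) hΦ
  exact ⟨p, q, hpq.mono (by omega)⟩

end FormalToNormal

/-! ### Sums of convergent series -/

section Sum

variable {n : ℕ}

theorem norm_prod_holCoord_le (d : Fin n ⊕ Unit →₀ ℕ) (x : Ambient n) :
    ‖∏ s, holCoord x s ^ d s‖ ≤ ‖x‖ ^ d.degree := by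
  rw [norm_prod, Finsupp.degree_eq_sum, ← Finset.prod_pow_eq_pow_sum]
  refine Finset.prod_le_prod (fun _ _ => norm_nonneg _) fun s _ => ?_
  rw [norm_pow]
  exact pow_le_pow_left₀ (norm_nonneg _) (norm_holCoord_le x s) _

theorem contDiff_prod_holCoord (d : Fin n ⊕ Unit →₀ ℕ) :
    ContDiff ℂ ⊤ fun x : Ambient n => ∏ s, holCoord x s ^ d s := by
  simp only [← holCoordCLM_apply]
  fun_prop

/-- On the ball of radius `ρ / 2` the Cauchy estimate bounds the derivative of each term by its
majorant at `ρ` divided by `ρ / 2`, so the series may be differentiated termwise. -/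
theorem exists_contDiffAt_hasSum {f : HolSeries n} {ρ : ℝ} (hρ : 0 < ρ)
    (hs : Summable fun d => ‖coeff d f‖ * ρ ^ d.degree) :
    ∃ F : Ambient n → ℂ, ContDiffAt ℂ 1 F 0 ∧
      ∀ᶠ x in 𝓝 0, HasSum (fun d => coeff d f * ∏ s, holCoord x s ^ d s) (F x) := by
  set g : (Fin n ⊕ Unit →₀ ℕ) → Ambient n → ℂ :=
    fun d x => coeff d f * ∏ s, holCoord x s ^ d s with hg
  have hgc : ∀ d, ContDiff ℂ ⊤ (g d) := fun d => contDiff_const.mul (contDiff_prod_holCoord d)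
  have hgd : ∀ d x, DifferentiableAt ℂ (g d) x := fun d x =>
    (hgc d).contDiffAt.differentiableAt (by simp)
  have hgb : ∀ d x, ‖x‖ ≤ ρ → ‖g d x‖ ≤ ‖coeff d f‖ * ρ ^ d.degree := by
    intro d x hx
    rw [hg, norm_mul]
    gcongr
    exact (norm_prod_holCoord_le d x).trans (pow_le_pow_left₀ (norm_nonneg _) hx _)
  set B := Metric.ball (0 : Ambient n) (ρ / 2)
  have hBmem : B ∈ 𝓝 (0 : Ambient n) := Metric.ball_mem_nhds _ (by positivity)
  have hsum : ∀ x ∈ B, Summable fun d => g d x := fun x hx =>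
    hs.of_norm_bounded fun d => hgb d x (by
      have := mem_ball_zero_iff.1 hx; linarith)
  set u : (Fin n ⊕ Unit →₀ ℕ) → ℝ := fun d => ‖coeff d f‖ * ρ ^ d.degree / (ρ / 2)
  have hu : Summable u := hs.div_const _
  have hd : ∀ d, ∀ x ∈ B, ‖fderiv ℂ (g d) x‖ ≤ u d := by
    intro d x hx
    refine norm_fderiv_le_of_forall_ball (by positivity) (fun y _ => hgd d y) fun y hy => hgb d y ?_
    rw [mem_closedBall_iff_norm] at hy
    have h1 := mem_ball_zero_iff.1 hx
    have h2 := norm_add_le (y - x) x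
    rw [sub_add_cancel] at h2
    linarith
  refine ⟨fun x => ∑' d, g d x, ?_, ?_⟩
  · rw [contDiffAt_one_iff]
    refine ⟨fun x => ∑' d, fderiv ℂ (g d) x, B, hBmem, ?_, fun x hx => ?_⟩
    · exact continuousOn_tsum (fun d => ((hgc d).continuous_fderiv (by simp)).continuousOn) hu hd
    · let _ : NormedSpace ℝ (Ambient n) := NormedSpace.restrictScalars ℝ ℂ _
      exact hasFDerivAt_tsum_of_isPreconnected hu Metric.isOpen_ball
        (convex_ball (0 : Ambient n) _).isPreconnected (fun d x _ => (hgd d x).hasFDerivAt) hd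
        (mem_of_mem_nhds hBmem) (hsum 0 (mem_of_mem_nhds hBmem)) hx
  · filter_upwards [hBmem] with x hx
    exact (hsum x hx).hasSum

theorem summable_degree_of_summable_hweight {f : HolSeries n} {s : ℝ} (hs : 0 < s)
    (h : Summable fun d => ‖coeff d f‖ * s ^ hweight d) :
    ∃ ρ : ℝ, 0 < ρ ∧ Summable fun d => ‖coeff d f‖ * ρ ^ d.degree := by
  -- Each `z` carries a factor `s` in the weighted sum and each `w` a factor `s ^ 2`, so the radius
  -- must lie below both.
  refine ⟨min s (s ^ 2), by positivity, h.of_nonneg_of_le (fun d => by positivity) fun d => ?_⟩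
  gcongr
  have h1 : d.degree = ∑ l, d (Sum.inl l) + d (Sum.inr ()) := by
    rw [Finsupp.degree_eq_sum, Fintype.sum_sum_type]
    simp
  have h2 : hweight d = ∑ l, d (Sum.inl l) + 2 * d (Sum.inr ()) := by
    rw [hweight, h1]; ring
  rw [h1, h2, pow_add, pow_add, pow_mul]
  gcongr
  · exact min_le_left _ _
  · exact min_le_right _ _

end Sum

end CRSingular

namespace CRSingular

open MvPowerSeries (truncTotal coeff constantCoeff)

/-! ### The map defined by a convergent normalised solution -/

section Identity

theorem eventually_eq_zero_of_isBigO_pow {F : Type*} [NormedAddCommGroup F]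
    [NormedSpace ℝ F] {f : ℝ → F} (hf : AnalyticAt ℝ f 0)
    (h : ∀ N : ℕ, f =O[𝓝 0] fun t => t ^ N) : ∀ᶠ t in 𝓝 0, f t = 0 := by
  by_contra hne
  obtain ⟨m, g, hg, hg0, hfg⟩ := hf.exists_eventuallyEq_pow_smul_nonzero_iff.2 hne
  obtain ⟨C, hC⟩ := (h (m + 1)).bound
  refine hg0 (norm_le_zero_iff.1 ?_)
  have h1 : ∀ᶠ t in 𝓝[≠] (0 : ℝ), ‖g t‖ ≤ C * ‖t‖ := by
    filter_upwards [nhdsWithin_le_nhds hC, nhdsWithin_le_nhds hfg, self_mem_nhdsWithin]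
      with t ht1 ht2 ht0
    rw [ht2, norm_smul, sub_zero, norm_pow, norm_pow, pow_succ, mul_comm, mul_comm (‖t‖ ^ m),
      ← mul_assoc] at ht1
    exact le_of_mul_le_mul_right ht1 (pow_pos (norm_pos_iff.2 ht0) m)
  have h2 : Tendsto (fun t : ℝ => C * ‖t‖) (𝓝[≠] 0) (𝓝 0) := by
    have : Continuous fun t : ℝ => C * ‖t‖ := by fun_prop
    simpa using (this.tendsto 0).mono_left nhdsWithin_le_nhds
  exact le_of_tendsto_of_tendsto
    (hg.continuousAt.norm.tendsto.mono_left nhdsWithin_le_nhds) h2 h1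

variable {n : ℕ} {Φ : ZSpace n → ℂ}

/-- The map is the sum of `id + (p, q)`. The vanishing of `p` in weight one and the centre condition
for `w ^ 1` give the first block of the derivative; the condition on the real part of `q` gives the
other entry. -/
theorem exists_map_of_isNormalSolution (i : Fin n) {ε : RealSeries n} (hε : VanishesTo 3 ε)
    (hΦ : HasExpansion Φ (quadSeries n + ε)) {p : Fin n → HolSeries n} {q : HolSeries n}
    (hpq : ∀ M, IsNormalSolution ε M p q) {ρ : ℝ} (hρ : 0 < ρ)
    (hsum : Summable fun d => ‖coeff d ε‖ * ρ ^ d.degree) :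
    ∃ h : Ambient n → Ambient n, ContDiffAt ℂ 1 h 0 ∧ h 0 = 0 ∧
      (∀ x, (fderiv ℂ h 0 x).1 = x.1) ∧ (fderiv ℂ h 0 (0, 1)).2.re = 1 ∧
      ∀ N, (fun z => (h (quadPoint z)).2 - Φ (h (quadPoint z)).1) =O[𝓝 0] fun z => ‖z‖ ^ N := by
  classical
  obtain ⟨s, hs, hsp, hsq⟩ := exists_summable_of_isNormalSolution i hε hpq hρ hsum
  set T : Fin n ⊕ Unit → HolSeries n := Sum.elim p fun _ => q with hT
  have hTs : ∀ t, Summable fun d => ‖coeff d (T t)‖ * s ^ hweight d := by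
    rintro (l | l)
    · exact hsp l
    · exact hsq
  have hF : ∀ t, ∃ F : Ambient n → ℂ, ContDiffAt ℂ 1 F 0 ∧ ∀ N, HasJet holCoord N F (T t) := by
    intro t
    obtain ⟨r, hr, hrs⟩ := summable_degree_of_summable_hweight hs (hTs t)
    obtain ⟨F, hF, hFs⟩ := exists_contDiffAt_hasSum hr hrs
    exact ⟨F, hF, hasJet_of_hasSum norm_holCoord_le hr hrs hFs⟩
  choose F hFc hFj using hF
  set h : Ambient n → Ambient n := fun x => ∑ t, (holCoord x t + F t x) • holBasis t with hh
  have hcoord : ∀ x t, holCoord (h x) t = holCoord x t + F t x := fun x t => by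
    rw [hh]
    exact holCoord_sum_smul _ _
  have hj : ∀ t N, HasJet holCoord N (fun x => holCoord (h x) t) (MvPowerSeries.X t + T t) := by
    intro t N
    simp only [hcoord]
    exact (hasJet_coord isCoord_holCoord N t).add (hFj t N)
  have hc : ContDiffAt ℂ 1 h 0 := by
    refine ContDiffAt.sum fun t _ => ContDiffAt.smul (ContDiffAt.add ?_ (hFc t)) contDiffAt_const
    simp only [← holCoordCLM_apply]
    exact (holCoordCLM t).contDiff.contDiffAt
  have hd := hc.differentiableAt one_ne_zero
  have hp0 : ∀ l, constantCoeff (p l) = 0 := fun l =>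
    constantCoeff_of_hweight_le ((hpq 0).vanish l)
  -- In degree zero every other term of the equation vanishes.
  have hq0 : constantCoeff q = 0 := by
    have h1 := (hpq 0).eqn 0 le_rfl
    have h2 : constantCoeff (onQuadric q) = constantCoeff q := by
      have := coeff_sliceExp_onQuadric i 0 q
      rw [show sliceExp i 0 = 0 by simp [sliceExp]] at this
      simpa using this
    have h3 : constantCoeff (MvPowerSeries.subst (perturbedGen p) ε) = 0 :=
      MvPowerSeries.constantCoeff_subst_eq_zero
        (MvPowerSeries.hasSubst_of_constantCoeff_zero (constantCoeff_perturbedGen hp0))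
        (constantCoeff_perturbedGen hp0) (by simpa using hε 0 (by simp))
    simpa [linPart, nonlin, h2, h3, constantCoeff_onQuadric (hp0 _)] using h1
  have hT0 : ∀ t, constantCoeff (T t) = 0 := by
    rintro (l | l)
    · exact hp0 l
    · exact hq0
  have h0 : h 0 = 0 := by
    refine holCoord_ext fun t => ?_
    rw [(hj t 1).apply_zero isCoord_holCoord le_rfl, holCoord_zero]
    simp [hT0]
  have hder : ∀ t, (holCoordCLM t).comp (fderiv ℂ h 0) =
      ∑ s, coeff (Finsupp.single s 1) (MvPowerSeries.X t + T t) • holCoordCLM s := by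
    intro t
    refine HasFDerivAt.unique ?_ (hj t 2).hasFDerivAt
    simpa only [Function.comp_def, holCoordCLM_apply] using
      (holCoordCLM t).hasFDerivAt.comp (0 : Ambient n) hd.hasFDerivAt
  have hder' : ∀ t x, holCoord (fderiv ℂ h 0 x) t =
      ∑ s, coeff (Finsupp.single s 1) (MvPowerSeries.X t + T t) * holCoord x s := by
    intro t x
    have := congrArg (fun L : Ambient n →L[ℂ] ℂ => L x) (hder t)
    simpa only [ContinuousLinearMap.comp_apply, holCoordCLM_apply, sum_apply,
      smul_apply, smul_eq_mul] using this
  refine ⟨h, hc, h0, fun x => ?_, ?_, fun N => ?_⟩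
  · ext l
    have h1 : ∀ s, coeff (Finsupp.single s 1) (MvPowerSeries.X (Sum.inl l) + T (Sum.inl l)) =
        if s = Sum.inl l then 1 else 0 := by
      intro s
      have h2 : coeff (Finsupp.single s 1) (p l) = 0 := by
        rcases s with j | j
        · exact (hpq 0).vanish l _ (by simp [hweight])
        · exact (hpq 2).normalized.center l 1 le_rfl
      rw [map_add, hT, Sum.elim_inl, h2, add_zero, MvPowerSeries.coeff_X]
      simp [Finsupp.single_left_inj]
    have h3 := hder' (Sum.inl l) x
    simp only [h1, ite_mul, one_mul, zero_mul, Finset.sum_ite_eq', Finset.mem_univ, if_true] at h3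
    exact h3
  · have h3 := hder' (Sum.inr ()) (0, 1)
    have h4 := (hpq 2).normalized.re 1 le_rfl
    have h5 : ∀ x : Ambient n, x.2 = holCoord x (Sum.inr ()) := fun x => rfl
    rw [h5, h3]
    simp [Fintype.sum_sum_type, holCoord, hT, h4]
  · have h1 := hasJet_sub_comp_quadPoint hp0 hΦ (h := h) (q := q) (N := N + 1)
      (by simpa [h0] using hd.hasFDerivAt.isBigO_sub.norm_right) (by omega)
      (fun l => hj (Sum.inl l) (N + 1)) (hj (Sum.inr ()) (N + 1))
    refine h1.isBigO isCoord_realCoord (Nat.le_succ N) fun d hd => ?_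
    rw [map_sub, (hpq N).eqn d (by omega), sub_self]

end Identity

end CRSingular

namespace CRSingular

open MvPowerSeries (truncTotal coeff constantCoeff)

/-! ### Formal equivalence implies holomorphic equivalence -/

section Equivalence

variable {n : ℕ} {Φ : ZSpace n → ℂ} {h : Ambient n → Ambient n}

/-- For fixed `z`, the holomorphic disc `ζ ↦ (ζ z, ζ² |z|²)` lies over the quadric at real `ζ`. The
defect is analytic in real `t` on `[0, 1]` and flat at `0`, so it vanishes up to `t = 1`. -/
theorem eventually_graph_of_isBigO (hc : ContDiffAt ℂ 1 h 0) (h0 : h 0 = 0)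
    (hΦ : AnalyticAt ℝ Φ 0)
    (hO : ∀ N, (fun z => (h (quadPoint z)).2 - Φ (h (quadPoint z)).1) =O[𝓝 0] fun z => ‖z‖ ^ N) :
    ∀ᶠ z in 𝓝 0, (h (quadPoint z)).2 = Φ (h (quadPoint z)).1 := by
  have hgood : ∀ᶠ x in 𝓝 (0 : Ambient n), DifferentiableAt ℂ h x ∧ AnalyticAt ℝ Φ (h x).1 := by
    refine ((hc.eventually (by simp)).mono fun x hx => hx.differentiableAt one_ne_zero).and ?_
    have h1 : Tendsto (fun x => (h x).1) (𝓝 0) (𝓝 0) := by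
      have := continuous_fst.continuousAt.tendsto.comp hc.continuousAt.tendsto
      rwa [h0] at this
    exact h1.eventually hΦ.eventually_analyticAt
  obtain ⟨r, hr, hrg⟩ := Metric.eventually_nhds_iff_ball.1 hgood
  -- This sends the disc of radius two, which contains `[0, 1]`, into the good ball.
  have hsmall : ∀ᶠ z in 𝓝 (0 : ZSpace n), 2 * ‖z‖ < r ∧ 4 * ‖z‖ ^ 2 < r := by
    have h1 : Continuous fun z : ZSpace n => 2 * ‖z‖ := by fun_prop
    have h2 : Continuous fun z : ZSpace n => 4 * ‖z‖ ^ 2 := by fun_prop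
    exact ((h1.tendsto 0).eventually_lt_const (by simpa using hr)).and
      ((h2.tendsto 0).eventually_lt_const (by simpa using hr))
  filter_upwards [hsmall] with z hz
  set γ : ℂ → Ambient n := fun ζ => (ζ • z, ζ ^ 2 * ((‖z‖ ^ 2 : ℝ) : ℂ)) with hγ
  have hγr : ∀ t : ℝ, γ t = quadPoint ((t : ℂ) • z) := by
    intro t
    rw [hγ, quadPoint, normSq_ofReal_smul]
  have hγd : Differentiable ℂ γ := by fun_prop
  have hγb : ∀ ζ ∈ Metric.ball (0 : ℂ) 2, γ ζ ∈ Metric.ball (0 : Ambient n) r := by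
    intro ζ hζ
    have hζ := (mem_ball_zero_iff.1 hζ).le
    rw [mem_ball_zero_iff, hγ, Prod.norm_mk, max_lt_iff, norm_smul, norm_mul, norm_pow,
      Complex.norm_real, Real.norm_of_nonneg (by positivity)]
    refine ⟨lt_of_le_of_lt ?_ hz.1, lt_of_le_of_lt ?_ hz.2⟩
    · gcongr
    · gcongr
      nlinarith [norm_nonneg ζ]
  have hhγ : AnalyticOnNhd ℂ (fun ζ => h (γ ζ)) (Metric.ball 0 2) := by
    have : DifferentiableOn ℂ (fun ζ => h (γ ζ)) (Metric.ball 0 2) := fun ζ hζ =>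
      ((hrg _ (hγb ζ hζ)).1.comp ζ (hγd ζ)).differentiableWithinAt
    exact fun ζ hζ => this.analyticAt (Metric.isOpen_ball.mem_nhds hζ)
  set f : ℝ → ℂ := fun t => (h (γ t)).2 - Φ (h (γ t)).1 with hf
  have hmem : ∀ t ∈ Set.Icc (0 : ℝ) 1, (t : ℂ) ∈ Metric.ball (0 : ℂ) 2 := fun t ht => by
    rw [mem_ball_zero_iff, Complex.norm_real, Real.norm_of_nonneg ht.1]
    linarith [ht.2]
  have hfa : AnalyticOnNhd ℝ f (Set.Icc 0 1) := by
    intro t ht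
    have h1 : AnalyticAt ℝ (fun t : ℝ => h (γ t)) t :=
      ((hhγ _ (hmem t ht)).restrictScalars (𝕜 := ℝ)).comp (analyticAt_ofReal t)
    have h2 : AnalyticAt ℝ (fun t : ℝ => Φ (h (γ t)).1) t :=
      AnalyticAt.comp (g := Φ) (f := fun t : ℝ => (h (γ t)).1) (hrg _ (hγb _ (hmem t ht))).2
        (analyticAt_fst.comp h1)
    exact (analyticAt_snd.comp h1).sub h2
  have hf0 : f =ᶠ[𝓝 0] 0 := by
    refine eventually_eq_zero_of_isBigO_pow (hfa 0 (by simp)) fun N => ?_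
    have h1 : Tendsto (fun t : ℝ => (t : ℂ) • z) (𝓝 0) (𝓝 0) := by
      have : Continuous fun t : ℝ => (t : ℂ) • z := by fun_prop
      simpa using this.tendsto 0
    refine ((hO N).comp_tendsto h1).trans ?_ |>.congr_left fun t => ?_
    · refine IsBigO.of_bound (‖z‖ ^ N) (Eventually.of_forall fun t => ?_)
      simp only [Function.comp_apply, norm_smul, Complex.norm_real, mul_pow, norm_mul, norm_pow,
        norm_norm]
      rw [mul_comm]
    · rw [hf]
      simp only [Function.comp_apply, hγr]
  have h1 := hfa.eqOn_zero_of_preconnected_of_eventuallyEq_zero isPreconnected_Icc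
    (by simp : (0 : ℝ) ∈ Set.Icc 0 1) hf0 (by simp : (1 : ℝ) ∈ Set.Icc 0 1)
  have h2 : γ ((1 : ℝ) : ℂ) = quadPoint z := by rw [hγr]; simp
  simp only [hf, h2, Pi.zero_apply] at h1
  exact sub_eq_zero.1 h1

/-- The function `(h x).2 - Φ (h x).1` vanishes both at `x` and at the point of the quadric above
`x.1`. These differ by some `δ` in `w` only, the `w`-derivative has norm at least one, and strict
differentiability gives `‖δ‖ ≤ ‖δ‖ / 2`. -/
theorem eventually_mem_quadric_of_graph (hc : ContDiffAt ℂ 1 h 0) (h0 : h 0 = 0)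
    (hre : (fderiv ℂ h 0 (0, 1)).2.re = 1) (hΦ : AnalyticAt ℝ Φ 0)
    (hΦ2 : Φ =O[𝓝 0] fun z => ‖z‖ ^ 2)
    (hgr : ∀ᶠ z in 𝓝 0, (h (quadPoint z)).2 = Φ (h (quadPoint z)).1) :
    ∀ᶠ x in 𝓝 (0 : Ambient n), (h x).2 = Φ (h x).1 → x ∈ quadric n := by
  have hs : HasStrictFDerivAt h (fderiv ℂ h 0) 0 := hc.hasStrictFDerivAt one_ne_zero
  have hΦs : HasStrictFDerivAt Φ (0 : ZSpace n →L[ℝ] ℂ) ((h 0).1) := by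
    rw [h0]
    have h1 : HasFDerivAt Φ (0 : ZSpace n →L[ℝ] ℂ) 0 := by
      refine HasFDerivAt.of_isLittleO ?_
      have hΦ0 : Φ 0 = 0 := by
        obtain ⟨C, hC⟩ := hΦ2.bound
        simpa using hC.self_of_nhds
      simpa [hΦ0] using hΦ2.trans_isLittleO (isLittleO_norm_pow_id (E' := ZSpace n) one_lt_two)
    have := hΦ.hasStrictFDerivAt
    rwa [h1.fderiv] at this
  have hθ : HasStrictFDerivAt (fun x => (h x).2 - Φ (h x).1)
      (((ContinuousLinearMap.snd ℂ (ZSpace n) ℂ).comp (fderiv ℂ h 0)).restrictScalars ℝ) 0 := by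
    have h2 := ((hasStrictFDerivAt_snd (𝕜 := ℂ) (p := h 0)).comp 0 hs).restrictScalars ℝ
    have h3 := hΦs.comp (0 : Ambient n)
      (((hasStrictFDerivAt_fst (𝕜 := ℂ) (p := h 0)).comp 0 hs).restrictScalars ℝ)
    have h4 := h2.fun_sub h3
    rw [ContinuousLinearMap.zero_comp, sub_zero] at h4
    exact h4
  have hbd := hθ.isLittleO.bound (c := 1 / 2) (by norm_num)
  have ht : Tendsto (fun x : Ambient n => (x, quadPoint x.1)) (𝓝 0) (𝓝 (0, 0)) :=
    tendsto_id.prodMk_nhds (tendsto_quadPoint.comp (continuous_fst.tendsto 0))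
  filter_upwards [ht.eventually hbd, (continuous_fst.tendsto (0 : Ambient n)).eventually hgr]
    with x hx1 hx2 hx3
  set δ : ℂ := x.2 - ((‖x.1‖ ^ 2 : ℝ) : ℂ) with hδ
  have h5 : x - quadPoint x.1 = δ • ((0, 1) : Ambient n) := by
    ext1
    · simp [quadPoint]
    · simp [quadPoint, hδ]
  have h6 : ‖δ‖ * ‖(fderiv ℂ h 0 (0, 1)).2‖ ≤ 1 / 2 * ‖δ‖ := by
    have h7 := hx1
    simp only [hx3, hx2, sub_self, zero_sub, norm_neg, h5, ContinuousLinearMap.coe_restrictScalars',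
      ContinuousLinearMap.comp_apply, map_smul, ContinuousLinearMap.coe_snd', norm_smul] at h7
    simpa using h7
  have h8 : 1 ≤ ‖(fderiv ℂ h 0 (0, 1)).2‖ := by
    rw [← hre]
    exact (le_abs_self _).trans (Complex.abs_re_le_norm _)
  have h9 : ‖δ‖ ≤ 0 := by nlinarith [norm_nonneg δ]
  exact sub_eq_zero.1 (norm_le_zero_iff.1 h9)

theorem exists_equiv_of_fderiv {L : Ambient n →L[ℂ] Ambient n} (h1 : ∀ x, (L x).1 = x.1)
    (h2 : (L (0, 1)).2.re = 1) : ∃ L' : Ambient n ≃L[ℂ] Ambient n, (L' : _ →L[ℂ] _) = L := by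
  have hinj : Function.Injective (L : Ambient n →ₗ[ℂ] Ambient n) := by
    rw [← LinearMap.ker_eq_bot, LinearMap.ker_eq_bot']
    intro x hx
    have hx : L x = 0 := hx
    have hx1 : x.1 = 0 := by rw [← h1, hx]; rfl
    have hx2 : x = x.2 • ((0, 1) : Ambient n) := by
      ext1
      · simp [hx1]
      · simp
    rw [hx2, map_smul] at hx
    have h3 : x.2 * (L (0, 1)).2 = 0 := congrArg Prod.snd hx
    rcases mul_eq_zero.1 h3 with h4 | h4
    · rw [hx2, h4, zero_smul]
    · rw [h4] at h2; simp at h2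
  refine ⟨(LinearEquiv.ofInjectiveEndo _ hinj).toContinuousLinearEquiv, ?_⟩
  exact ContinuousLinearMap.ext fun x => rfl

/-- The inverse function theorem applies to `h`, restricted to a neighbourhood where the derivative
stays invertible and membership corresponds. Since `h` goes from the quadric to `M`, the equivalence
is its inverse. -/
theorem HolomorphicallyEquivalent.of_map {M : Set (Ambient n)} (hc : ContDiffAt ℂ 1 h 0)
    (h0 : h 0 = 0) (h1 : ∀ x, (fderiv ℂ h 0 x).1 = x.1)
    (h2 : (fderiv ℂ h 0 (0, 1)).2.re = 1)
    (hM : ∀ᶠ x in 𝓝 (0 : Ambient n), x ∈ quadric n ↔ h x ∈ M) :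
    HolomorphicallyEquivalent M (quadric n) := by
  obtain ⟨L, hL⟩ := exists_equiv_of_fderiv h1 h2
  have hd : HasFDerivAt h (L : Ambient n →L[ℂ] Ambient n) 0 := by
    rw [hL]
    exact (hc.differentiableAt one_ne_zero).hasFDerivAt
  have hgood : ∀ᶠ x in 𝓝 (0 : Ambient n), (x ∈ quadric n ↔ h x ∈ M) ∧ ∃ L' : Ambient n ≃L[ℂ]
      Ambient n, HasFDerivAt h (L' : Ambient n →L[ℂ] Ambient n) x := by
    have h3 : Tendsto (fderiv ℂ h) (𝓝 0) (𝓝 (L : Ambient n →L[ℂ] Ambient n)) := by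
      rw [hL]
      exact (hc.fderiv_right (m := 0) (by simp)).continuousAt
    filter_upwards [hM, h3 L.nhds, hc.eventually (by simp)] with x hx1 hx2 hx3
    obtain ⟨L', hL'⟩ := hx2
    refine ⟨hx1, L', ?_⟩
    rw [hL']
    exact (hx3.differentiableAt one_ne_zero).hasFDerivAt
  obtain ⟨U, hU, hUo, h0U⟩ := eventually_nhds_iff.1 hgood
  set e := (hc.toOpenPartialHomeomorph h hd one_ne_zero).restrOpen U hUo with he
  have heh : ∀ x, e x = h x := fun x => rfl
  have h0e : (0 : Ambient n) ∈ e.source :=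
    ⟨hc.mem_toOpenPartialHomeomorph_source hd one_ne_zero, h0U⟩
  have heU : ∀ x ∈ e.source, x ∈ U := fun x hx => hx.2
  have h0t : (0 : Ambient n) ∈ e.target := by
    have := e.map_source h0e
    rwa [heh, h0] at this
  refine ⟨e.symm, h0t, ?_, ?_, ?_, ?_⟩
  · have := e.left_inv h0e
    rwa [heh, h0] at this
  · intro y hy
    obtain ⟨L', hL'⟩ := (hU _ (heU _ (e.map_target hy))).2
    exact (e.hasFDerivAt_symm hy hL').differentiableAt.differentiableWithinAt
  · intro x hx
    obtain ⟨L', hL'⟩ := (hU _ (heU _ hx)).2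
    exact hL'.differentiableAt.differentiableWithinAt
  · intro y hy
    have h3 := (hU _ (heU _ (e.map_target hy))).1
    rw [h3, ← heh, e.right_inv hy]

/-- The series in a formal equivalence are only known to describe the two germs as graphs, so they
are first identified with the expansions of `|z|² + E` and `|z|²`. The normalised solution is then
constructed, summed and shown to map the quadric exactly. -/
theorem HolomorphicallyEquivalent.of_formallyEquivalent (hn : 1 ≤ n) {M : Set (Ambient n)}
    {E : ZSpace n → ℂ} (hE : AnalyticAt ℝ E 0) (hE3 : E =O[𝓝 0] fun z => ‖z‖ ^ 3)
    (hM : ∀ᶠ p in 𝓝 (0 : Ambient n), p ∈ M ↔ p.2 = ((‖p.1‖ ^ 2 : ℝ) : ℂ) + E p.1)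
    (h : FormallyEquivalent M (quadric n)) : HolomorphicallyEquivalent M (quadric n) := by
  obtain ⟨φ, ψ, ⟨hφ0, Φ', hΦ', hM'⟩, ⟨hψ0, Ψ, hΨ, hq⟩, H, hH, hmap⟩ := h
  obtain ⟨ε, hε⟩ := exists_hasExpansion_of_analyticAt hE
  have hE3' : VanishesTo 3 ε := by
    intro d hd
    have := (hε.hasJet 3).congr_fun (g := fun _ => 0) (by simpa using hE3)
    exact separatesJets_realCoord _ _ this d hd
  have hquad : HasExpansion (fun z : ZSpace n => ((‖z‖ ^ 2 : ℝ) : ℂ)) (quadSeries n) := by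
    obtain ⟨χ, hχ⟩ := exists_hasExpansion_of_analyticAt (analyticAt_normSq (0 : ZSpace n))
    obtain rfl : χ = quadSeries n :=
      HasJet.unique_of_forall separatesJets_realCoord hχ.hasJet hasJet_quadSeries
    exact hχ
  set Φ : ZSpace n → ℂ := fun z => ((‖z‖ ^ 2 : ℝ) : ℂ) + E z with hΦdef
  have hΦ : HasExpansion Φ (quadSeries n + ε) := by
    filter_upwards [hquad, hε] with z h1 h2
    simpa only [map_add, add_mul] using h1.add h2
  -- Two graph descriptions of one germ agree near `0`: the point over `z` tends to the origin
  -- because its expansion has no constant term.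
  have hgraph : ∀ {F G : ZSpace n → ℂ} {φ : RealSeries n} {S : Set (Ambient n)},
      HasExpansion F φ → constantCoeff φ = 0 → (∀ᶠ p in 𝓝 (0 : Ambient n), p ∈ S ↔ p.2 = F p.1) →
      (∀ᶠ p in 𝓝 (0 : Ambient n), p ∈ S ↔ p.2 = G p.1) → F =ᶠ[𝓝 0] G := by
    intro F G φ S hF hφ hS hS'
    have ht := tendsto_zero_of_isBigO_norm
      (isBigO_graph ((hF.hasJet 1).isBigO_norm isCoord_realCoord le_rfl hφ))
    filter_upwards [ht.eventually hS, ht.eventually hS'] with z h1 h2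
    exact h2.1 (h1.2 rfl)
  have hφ : φ = quadSeries n + ε :=
    HasJet.unique_of_forall separatesJets_realCoord (fun N => (hΦ'.hasJet N).congr_eventually
      (hgraph hΦ' hφ0 hM' hM)) hΦ.hasJet
  have hψ : ψ = quadSeries n :=
    HasJet.unique_of_forall separatesJets_realCoord (fun N => (hΨ.hasJet N).congr_eventually
      (hgraph hΨ hψ0 hq (Eventually.of_forall fun p => Iff.rfl))) hquad.hasJet
  rw [hφ, hψ] at hmap
  have i : Fin n := ⟨0, hn⟩
  obtain ⟨p, q, hpq⟩ := exists_isNormalSolution_of_forall i hE3'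
    (exists_isNormalSolution_of_mapsGraph i hE3' hΦ hH hmap)
  obtain ⟨ρ, hρ, hsum⟩ := hε.exists_summable
  obtain ⟨h, hc, h0, h1, h2, hO⟩ := exists_map_of_isNormalSolution i hE3' hΦ hpq hρ hsum
  have hΦan : AnalyticAt ℝ Φ 0 := (analyticAt_normSq 0).add hE
  have hgr := eventually_graph_of_isBigO hc h0 hΦan hO
  refine HolomorphicallyEquivalent.of_map hc h0 h1 h2 ?_
  have ht : Tendsto h (𝓝 0) (𝓝 0) := by
    have := hc.continuousAt.tendsto
    rwa [h0] at this
  filter_upwards [ht.eventually hM, (continuous_fst.tendsto (0 : Ambient n)).eventually hgr,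
    eventually_mem_quadric_of_graph hc h0 h2 hΦan (hΦ.isBigO_sq hE3') hgr] with x hx1 hx2 hx3
  refine ⟨fun hx => ?_, fun hx => hx3 (hx1.1 hx)⟩
  have h3 : quadPoint x.1 = x := Prod.ext rfl (Eq.symm hx)
  rw [hx1, ← h3]
  exact hx2

end Equivalence

end CRSingular

theorem theorem1 (n : ℕ) (hn : 1 ≤ n) (M : Set (CRSingular.Ambient n))
    (E : CRSingular.ZSpace n → ℂ) (hE : AnalyticAt ℝ E 0)
    (hE3 : E =O[𝓝 0] fun z => ‖z‖ ^ 3)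
    (hM : ∀ᶠ p in 𝓝 (0 : CRSingular.Ambient n),
      p ∈ M ↔ p.2 = ((‖p.1‖ ^ 2 : ℝ) : ℂ) + E p.1) :
    CRSingular.HolomorphicallyEquivalent M (CRSingular.quadric n) ↔
      CRSingular.FormallyEquivalent M (CRSingular.quadric n) := by
  exact ⟨CRSingular.FormallyEquivalent.of_holomorphicallyEquivalent hE hE3 hM,
    CRSingular.HolomorphicallyEquivalent.of_formallyEquivalent hn hE hE3 hM⟩
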